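/- **Conventions.** A metric measure space $Z=(Z,\rho,\mu)$ is a nonempty bounded metric space with a finite Borel measure $\mu$ such that every open ball $B(x,s)=\{y:\rho(x,y)<s\}$ has strictly positive measure. It is *nondoubling* if there is no $C<\infty$ with $\mu(B(x,2s))\le C\mu(B(x,s))$ for all $x\in Z$, $s>0$. The centered maximal operator is $\mathcal M f(x)=\sup_{s>0}\frac1{\mu(B(x,s))}\int_{B(x,s)}|f|\,d\mu$. For Borel $f$ put $d_f(t)=\mu(\{|f|>t\})$ and, for $p\in[1,\infty)$, $$\|f\|_{p,q}=p^{1/q}\Big(\int_0^\infty \big(t\,d_f(t)^{1/p}\big)^q\frac{dt}{t}\Big)^{1/q}\ (1\le q<\infty),\qquad \|f\|_{p,\infty}=\sup_{t>0}t\,d_f(t)^{1/p};$$ $L^{p,q}(Z)$ consists of the Borel functions $f:Z\to\mathbb C$ with $\|f\|_{p,q}<\infty$. Let $c(p,q,r,Z)\in[0,\infty]$ be the smallest constant $c$ such that $\|\mathcal M f\|_{p,r}\le c\,\|f\|_{p,q}$ for all $f\in L^{p,q}(Z)$ ($=\infty$ if there is none). We put $1/\infty=0$. **Test spaces of type III.**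 Let $p\in(1,\infty)$, let $N,M,L$ be positive integers, $K\in[1,\infty)$, and let $(m_i)_{i=1}^N,(h_i)_{i=1}^N,(\alpha_k)_{k=1}^M,(\beta_k)_{k=1}^M$ be positive integers with $h_i\mid h_N$; $m_{i+1}\ge 2m_ih_i$; $1\le m_i^{1-p}h_i<2$; $\alpha_1\ge 2m_Nh_N$; $\alpha_{k+1}\ge 2\alpha_kL\beta_kh_N$; $1\le\alpha_k^{1-p}\beta_kh_N<2$. The associated test space consists of distinct points $x_{i,j}$ ($1\le i\le N$, $1\le j\le h_i$) of mass $m_i$ and $x^\circ_{k,l}$ ($1\le k\le M$, $1\le l\le L\beta_kh_N$) of mass $K\alpha_k$; the distance between $x_{i,j}$ and $x^\circ_{k,l}$ is $1$ if $\frac{j-1}{h_i}L\beta_kh_N<l\le\frac{j}{h_i}L\beta_kh_N$, and all other distances between different points are $2$. **Composite test spaces.** A composite test space (for $p$) is the disjoint union $Y=\bigcup_{n\ge1}Y_n$ of a sequence of test spaces of type III (for $p$), whose metrics and measures are first multiplied by positive constants so that $\operatorname{diam}Y_n<1$ and $2\mu_{n+1}(Y_{n+1})\le\mu_n(\{y\})$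 for all $n$ and $y\in Y_n$; points of different components are at distance $1$, and $\mu(E)=\sum_n\mu_n(E\cap Y_n)$. **Theorem.** Fix $p\in(1,\infty)$ and $\delta\in[0,1]$ (respectively, $\delta\in[0,1)$). Let $F:[\delta,1]\to[0,1]$ (respectively, $F:(\delta,1]\to[0,1]$) be concave, nondecreasing and such that $F(u)\le u$ for all $u$ in its domain. Then: 1. There is a nondoubling metric measure space $Z$, which is a composite test space for $p$, such that for all $q,r\in[1,\infty]$ we have $c(p,q,r,Z)<\infty$ if and only if $\frac1q\ge\delta$ (respectively, $\frac1q>\delta$) and $\frac1r\le F\big(\frac1q\big)$. 2. There is a nondoubling metric measure space $Z'$, which is a composite test space for $p$, such that for all $q,r\in[1,\infty]$ we have $c(p,q,r,Z')<\infty$ if and only if $\frac1q\ge\delta$ (respectively, $\frac1q>\delta$) and $\frac1r<F\big(\frac1q\big)$. -/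

import Mathlib

open MeasureTheory Set
open scoped ENNReal NNReal

noncomputable section

/-- A metric measure space `(X, ρ, μ)`: a nonempty bounded metric space with a finite Borel measure
for which every open ball has strictly positive measure. -/
structure MetricMeasureSpace where
  carrier : Type
  [metric : MetricSpace carrier]
  [measurable : MeasurableSpace carrier]
  [borel : BorelSpace carrier]
  μ : Measure carrier
  nonempty : Nonempty carrier
  bounded : Bornology.IsBounded (Set.univ : Set carrier)
  measure_finite : μ Set.univ < ∞
  ball_pos : ∀ (x : carrier) (s : ℝ), 0 < s → 0 < μ (Metric.ball x s)

attribute [instance] MetricMeasureSpace.metric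
attribute [instance] MetricMeasureSpace.measurable
attribute [instance] MetricMeasureSpace.borel

/-- The distribution function `d_g(t) = μ {x | g x > t}` of a function with values in `[0, ∞]`. -/
def distribution {X : Type} [MeasurableSpace X] (μ : Measure X) (g : X → ℝ≥0∞) (t : ℝ) : ℝ≥0∞ :=
  μ {x | ENNReal.ofReal t < g x}

/-- The Lorentz quasinorm `‖g‖_{p,q}`, for `p ∈ [1, ∞)` and `q ∈ [1, ∞]`: it is
`p^{1/q} (∫_0^∞ (t d_g(t)^{1/p})^q dt/t)^{1/q}` if `q < ∞`, and `sup_{t > 0} t d_g(t)^{1/p}` if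
`q = ∞`. -/
def lorentzNorm {X : Type} [MeasurableSpace X] (μ : Measure X) (p : ℝ) (q : ℝ≥0∞)
    (g : X → ℝ≥0∞) : ℝ≥0∞ :=
  if q = ∞ then
    ⨆ (t : ℝ) (_ : 0 < t), ENNReal.ofReal t * distribution μ g t ^ (1 / p)
  else
    ENNReal.ofReal p ^ (1 / q.toReal) *
      (∫⁻ t in Set.Ioi (0 : ℝ),
        (ENNReal.ofReal t * distribution μ g t ^ (1 / p)) ^ q.toReal / ENNReal.ofReal t)
          ^ (1 / q.toReal)

namespace MetricMeasureSpace

/-- The centered Hardy--Littlewood maximal function: the supremum over `s > 0` of the averages of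
`|f|` over the open balls `B(x, s)`. -/
def maximal (Z : MetricMeasureSpace) (f : Z.carrier → ℂ) (x : Z.carrier) : ℝ≥0∞ :=
  ⨆ (s : ℝ) (_ : 0 < s), (∫⁻ y in Metric.ball x s, ‖f y‖ₑ ∂Z.μ) / Z.μ (Metric.ball x s)

/-- `‖M f‖_{p,r} ≤ C ‖f‖_{p,q}` for all Borel functions `f` in `L^{p,q}`. -/
def MaximalBound (Z : MetricMeasureSpace) (p : ℝ) (q r : ℝ≥0∞) (C : ℝ≥0) : Prop :=
  ∀ f : Z.carrier → ℂ, Measurable f → lorentzNorm Z.μ p q (fun x => ‖f x‖ₑ) < ∞ →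
    lorentzNorm Z.μ p r (Z.maximal f) ≤ C * lorentzNorm Z.μ p q (fun x => ‖f x‖ₑ)

/-- The best constant `c(p, q, r, Z)` in `‖M f‖_{p,r} ≤ c ‖f‖_{p,q}`, equal to `∞` if there is no
finite constant. -/
def bestConst (Z : MetricMeasureSpace) (p : ℝ) (q r : ℝ≥0∞) : ℝ≥0∞ :=
  ⨅ (C : ℝ≥0) (_ : Z.MaximalBound p q r C), (C : ℝ≥0∞)

/-- The doubling condition `μ(B(x, 2s)) ≤ C μ(B(x, s))`. -/
def IsDoubling (Z : MetricMeasureSpace) : Prop :=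
  ∃ C : ℝ≥0, ∀ (x : Z.carrier) (s : ℝ), 0 < s →
    Z.μ (Metric.ball x (2 * s)) ≤ C * Z.μ (Metric.ball x s)

end MetricMeasureSpace

/-- The parameters of a test space of type III for the exponent `p`. All indices are shifted to
start from `0`: only the values `m i`, `h i` for `i < N` and `α k`, `β k` for `k < M` are used, and
`h (N - 1)` is the last term of the sequence `h`. -/
structure TypeIII (p : ℝ) where
  N : ℕ
  M : ℕ
  L : ℕ
  K : ℝ
  m : ℕ → ℕ
  h : ℕ → ℕ
  α : ℕ → ℕ
  β : ℕ → ℕ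
  N_pos : 0 < N
  M_pos : 0 < M
  L_pos : 0 < L
  one_le_K : 1 ≤ K
  m_pos : ∀ i < N, 0 < m i
  h_pos : ∀ i < N, 0 < h i
  α_pos : ∀ k < M, 0 < α k
  β_pos : ∀ k < M, 0 < β k
  h_dvd : ∀ i < N, h i ∣ h (N - 1)
  m_growth : ∀ i, i + 1 < N → 2 * m i * h i ≤ m (i + 1)
  m_balance : ∀ i < N, 1 ≤ (m i : ℝ) ^ (1 - p) * h i ∧ (m i : ℝ) ^ (1 - p) * h i < 2
  α_zero : 2 * m (N - 1) * h (N - 1) ≤ α 0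
  α_growth : ∀ k, k + 1 < M → 2 * α k * L * β k * h (N - 1) ≤ α (k + 1)
  α_balance : ∀ k < M, 1 ≤ (α k : ℝ) ^ (1 - p) * β k * h (N - 1) ∧
    (α k : ℝ) ^ (1 - p) * β k * h (N - 1) < 2

namespace TypeIII

/-- The number `L β_k h_N` of points of type `k` on the upper level. -/
def upperCard {p : ℝ} (U : TypeIII p) (k : ℕ) : ℕ := U.L * U.β k * U.h (U.N - 1)

/-- The points: `x_{i,j}` (lower level) with `i < N`, `j < h_i`, and `x°_{k,l}` (upper level) with
`k < M`, `l < L β_k h_N`. -/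
abbrev Point {p : ℝ} (U : TypeIII p) : Type :=
  (Σ i : Fin U.N, Fin (U.h i)) ⊕ (Σ k : Fin U.M, Fin (U.upperCard k))

/-- `x°_{k,l}` belongs to the `j`-th of the `h_i` consecutive blocks, of `L β_k h_N / h_i` points
each, into which the upper points of type `k` are divided. -/
def Linked {p : ℝ} (U : TypeIII p) (x : Σ i : Fin U.N, Fin (U.h i))
    (y : Σ k : Fin U.M, Fin (U.upperCard k)) : Prop :=
  (x.2 : ℕ) * (U.upperCard y.1 / U.h x.1) ≤ (y.2 : ℕ) ∧
    (y.2 : ℕ) < ((x.2 : ℕ) + 1) * (U.upperCard y.1 / U.h x.1)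

open Classical in
/-- The metric: `1` between linked points, `2` between all other pairs of different points. -/
def rho {p : ℝ} (U : TypeIII p) : U.Point → U.Point → ℝ
  | .inl x, .inl y => if x = y then 0 else 2
  | .inr x, .inr y => if x = y then 0 else 2
  | .inl x, .inr y => if U.Linked x y then 1 else 2
  | .inr y, .inl x => if U.Linked x y then 1 else 2

/-- The masses of the points: `m_i` for `x_{i,j}` and `K α_k` for `x°_{k,l}`. -/
def mass {p : ℝ} (U : TypeIII p) : U.Point → ℝ
  | .inl x => U.m x.1
  | .inr y => U.K * U.α y.1

end TypeIII

/-- `Z` is a composite test space for `p`: it is the disjoint union of a sequence of test spaces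
`U n` of type III for `p`, with metrics rescaled by `a n` and measures rescaled by `b n` so that each
component has diameter less than `1` and each point of the `n`-th component has at least twice the
mass of the whole `(n+1)`-st component; points of different components are at distance `1`. (As `Z`
is countable, its measure is determined by the masses of the points.) -/
def MetricMeasureSpace.IsCompositeTestSpace (p : ℝ) (Z : MetricMeasureSpace) : Prop :=
  ∃ (U : ℕ → TypeIII p) (a b : ℕ → ℝ) (e : (Σ n : ℕ, (U n).Point) ≃ Z.carrier),
    (∀ n, 0 < a n) ∧ (∀ n, 0 < b n) ∧
    (∀ n, ∀ x y : (U n).Point, a n * (U n).rho x y < 1) ∧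
    (∀ n, ∀ x : (U n).Point,
      2 * ∑ y : (U (n + 1)).Point, b (n + 1) * (U (n + 1)).mass y ≤ b n * (U n).mass x) ∧
    (∀ n, ∀ x y : (U n).Point, dist (e ⟨n, x⟩) (e ⟨n, y⟩) = a n * (U n).rho x y) ∧
    (∀ n k, n ≠ k → ∀ (x : (U n).Point) (y : (U k).Point), dist (e ⟨n, x⟩) (e ⟨k, y⟩) = 1) ∧
    (∀ n, ∀ x : (U n).Point, Z.μ {e ⟨n, x⟩} = ENNReal.ofReal (b n * (U n).mass x))

end

/-! Write `u = 1/q` and `v = 1/r`. For `q ≤ r` the maximal operator on a composite space is bounded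
from `L^{p,q}` to `L^{p,r}` exactly when the numbers `gain · N^(1-u) · M^v` (`componentConst`), with
`gain = (K L)^(1/p) / K`, are bounded over the components; boundedness of these numbers is necessary
for all `q`, `r`. Since `N ≈ exp A`, `M ≈ exp B` and `gain = exp E` can be prescribed freely with
`A, B ≥ 0` (`TypeIII.exists_of_exponents`), taking logarithms reduces the theorem to finding
countably many functionals `E + A (1 - u) + B v` that are uniformly bounded above at `(u, v)`
precisely on the wanted region (`exists_space_of_region`).

The upper estimate rests on three facts. Levels and components are lacunary, so a Lorentz norm is
comparable to the `ℓ^q` norm of its restrictions to them (`IsLacunaryPartition.dyadicNorm_le`,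
`lq_dyadicNorm_le`). For `p > 1` the Lorentz quasinorm is equivalent to a norm, so a sum of `N`
functions costs a constant independent of `N` (`dyadicNorm_finset_sum_le`). The balance conditions
say that the measure of a level to the power `1/p` is comparable to the mass of one of its points,
up to the scaling of the component and, on upper levels, a power of `K L`. An upper point has
exactly one lower neighbor of each of the `N` types, and each neighbor term reproduces the
restriction of `f` to a lower level with norm multiplied by about `gain`. Summing over lower levels
by Hölder gives `N^(1-u)`, and repeating this on `M` upper levels gives `M^v`. All other radii
contribute uniformly bounded operators (`maximal_le`). The function equal to `1 / m_i` on the `i`-th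
lower level shows sharpness.

For the region, each rational line `a u + b ≥ F(u)` with `a ≥ 0` contributes the functionals `n (v -
a u - b) + s √n`. With `s = 0` their boundedness means `v ≤ F(u)`; with `s = 1` the term `√n`
excludes equality. Lines determine `F` only on `(δ, 1]`, so a further sequence treats `δ`: `n² (δ -
u) + n (v - F(δ)) + s √n` if `δ` belongs to the domain, and `n (δ - u) + √n` if it does not. -/

/-- The `ℓ^q` norm of a family in `[0, ∞]`, for `q ∈ [1, ∞]`. -/
noncomputable def lq {ι : Type*} (q : ℝ≥0∞) (a : ι → ℝ≥0∞) : ℝ≥0∞ :=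
  if q = ∞ then ⨆ i, a i else (∑' i, a i ^ q.toReal) ^ (1 / q.toReal)

/-! ### Sequence norms with values in `[0, ∞]`. -/

section SequenceNorm

variable {ι κ : Type*} {q r : ℝ≥0∞}

theorem lq_top (a : ι → ℝ≥0∞) : lq ∞ a = ⨆ i, a i := by simp [lq]

theorem lq_of_ne_top (hq : q ≠ ∞) (a : ι → ℝ≥0∞) :
    lq q a = (∑' i, a i ^ q.toReal) ^ (1 / q.toReal) := by simp [lq, hq]

theorem one_le_toReal_of_ne_top (h1 : 1 ≤ q) (hq : q ≠ ∞) : 1 ≤ q.toReal := by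
  simpa using ENNReal.toReal_mono hq h1

theorem lq_rpow_toReal (h1 : 1 ≤ q) (hq : q ≠ ∞) (a : ι → ℝ≥0∞) :
    lq q a ^ q.toReal = ∑' i, a i ^ q.toReal := by
  have := one_le_toReal_of_ne_top h1 hq
  rw [lq_of_ne_top hq, ← ENNReal.rpow_mul, one_div_mul_cancel (by linarith), ENNReal.rpow_one]

theorem lq_le_iff (h1 : 1 ≤ q) (hq : q ≠ ∞) (a : ι → ℝ≥0∞) (R : ℝ≥0∞) :
    lq q a ≤ R ↔ ∑' i, a i ^ q.toReal ≤ R ^ q.toReal := by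
  have := one_le_toReal_of_ne_top h1 hq
  rw [← lq_rpow_toReal h1 hq, ENNReal.rpow_le_rpow_iff (by linarith)]

theorem lq_le_iff_finset (h1 : 1 ≤ q) (hq : q ≠ ∞) (a : ι → ℝ≥0∞) (R : ℝ≥0∞) :
    lq q a ≤ R ↔ ∀ s : Finset ι, ∑ i ∈ s, a i ^ q.toReal ≤ R ^ q.toReal := by
  rw [lq_le_iff h1 hq, ENNReal.tsum_eq_iSup_sum, iSup_le_iff]

theorem lq_mono (q : ℝ≥0∞) {a b : ι → ℝ≥0∞} (h : ∀ i, a i ≤ b i) : lq q a ≤ lq q b := by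
  unfold lq
  split_ifs
  · exact iSup_mono h
  · have : 0 ≤ q.toReal := ENNReal.toReal_nonneg
    gcongr
    exact h _

theorem le_lq (h1 : 1 ≤ q) (a : ι → ℝ≥0∞) (i : ι) : a i ≤ lq q a := by
  by_cases hq : q = ∞
  · subst hq
    rw [lq_top]
    exact le_iSup a i
  · have := one_le_toReal_of_ne_top h1 hq
    rw [← ENNReal.rpow_le_rpow_iff (show 0 < q.toReal by linarith), lq_rpow_toReal h1 hq]
    exact ENNReal.le_tsum i

theorem lq_anti (h1 : 1 ≤ q) (hqr : q ≤ r) (a : ι → ℝ≥0∞) : lq r a ≤ lq q a := by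
  by_cases hr : r = ∞
  · subst hr
    rw [lq_top]
    exact iSup_le (le_lq h1 a)
  have hq : q ≠ ∞ := ne_top_of_le_ne_top hr hqr
  have hq1 := one_le_toReal_of_ne_top h1 hq
  have hqr' : q.toReal ≤ r.toReal := ENNReal.toReal_mono hr hqr
  rw [lq_le_iff (h1.trans hqr) hr]
  have key : ∀ x : ℝ≥0∞, x ^ r.toReal = x ^ q.toReal * x ^ (r.toReal - q.toReal) := fun x => by
    rw [← ENNReal.rpow_add_of_nonneg _ _ (by linarith) (by linarith), add_sub_cancel]
  calc ∑' i, a i ^ r.toReal ≤ ∑' i, a i ^ q.toReal * lq q a ^ (r.toReal - q.toReal) := by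
        refine ENNReal.tsum_le_tsum fun i => ?_
        rw [key]
        gcongr
        exact le_lq h1 a i
    _ = lq q a ^ r.toReal := by rw [ENNReal.tsum_mul_right, ← lq_rpow_toReal h1 hq, ← key]

theorem lq_one (a : ι → ℝ≥0∞) : lq 1 a = ∑' i, a i := by simp [lq]

theorem lq_le_tsum (h1 : 1 ≤ q) (a : ι → ℝ≥0∞) : lq q a ≤ ∑' i, a i :=
  (lq_anti le_rfl h1 a).trans_eq (lq_one a)

theorem lq_const_mul (h1 : 1 ≤ q) (c : ℝ≥0∞) (a : ι → ℝ≥0∞) :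
    lq q (fun i => c * a i) = c * lq q a := by
  by_cases hq : q = ∞
  · subst hq
    simp only [lq_top, ENNReal.mul_iSup]
  · have := one_le_toReal_of_ne_top h1 hq
    have h0 : q.toReal ≠ 0 := by linarith
    simp only [lq_of_ne_top hq, ENNReal.mul_rpow_of_nonneg _ _ (zero_le_one.trans this),
      ENNReal.tsum_mul_left]
    rw [ENNReal.mul_rpow_of_nonneg _ _ (by positivity), ← ENNReal.rpow_mul, mul_one_div_cancel h0,
      ENNReal.rpow_one]

theorem lq_add_le (h1 : 1 ≤ q) (a b : ι → ℝ≥0∞) :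
    lq q (fun i => a i + b i) ≤ lq q a + lq q b := by
  by_cases hq : q = ∞
  · subst hq
    simp only [lq_top]
    exact iSup_le fun i => add_le_add (le_iSup a i) (le_iSup b i)
  · have hq1 := one_le_toReal_of_ne_top h1 hq
    rw [lq_le_iff_finset h1 hq]
    intro s
    rw [← ENNReal.rpow_le_rpow_iff (show 0 < 1 / q.toReal by positivity), ← ENNReal.rpow_mul,
      mul_one_div_cancel (by linarith), ENNReal.rpow_one]
    refine (ENNReal.Lp_add_le s a b hq1).trans ?_
    rw [lq_of_ne_top hq, lq_of_ne_top hq]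
    gcongr <;> exact ENNReal.sum_le_tsum s

theorem lq_finset_sum_le (h1 : 1 ≤ q) (s : Finset κ) (a : κ → ι → ℝ≥0∞) :
    lq q (fun i => ∑ j ∈ s, a j i) ≤ ∑ j ∈ s, lq q (a j) := by
  classical
  induction s using Finset.induction_on with
  | empty =>
    refine (lq_le_tsum h1 _).trans ?_
    simp
  | insert j s hj ih =>
    simp only [Finset.sum_insert hj]
    exact (lq_add_le h1 _ _).trans (add_le_add_right ih _)

/-- Minkowski's inequality for finite sums passes to the limit because an `ℓ^q` bound need only be
checked on finite sets of indices. -/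
theorem lq_tsum_le (h1 : 1 ≤ q) (a : ℕ → ι → ℝ≥0∞) :
    lq q (fun i => ∑' j, a j i) ≤ ∑' j, lq q (a j) := by
  by_cases hq : q = ∞
  · subst hq
    simp only [lq_top]
    exact iSup_le fun i => ENNReal.tsum_le_tsum fun j => le_iSup (a j) i
  · have hq1 := one_le_toReal_of_ne_top h1 hq
    rw [lq_le_iff_finset h1 hq]
    intro s
    have h := tendsto_finsetSum s fun i _ =>
      ((ENNReal.continuous_rpow_const (y := q.toReal)).tendsto _).comp
        (ENNReal.tendsto_nat_tsum fun j => a j i)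
    refine le_of_tendsto' h fun n => ?_
    refine ((lq_le_iff_finset h1 hq (fun i => ∑ j ∈ Finset.range n, a j i) _).1 ?_ s)
    exact (lq_finset_sum_le h1 _ _).trans (ENNReal.sum_le_tsum _)

/-- Fubini for iterated norms with the same exponent. It exchanges levels of a function with
measures of its superlevel sets, and dyadic levels with parts of a partition. -/
theorem lq_comm (h1 : 1 ≤ q) (a : ι → κ → ℝ≥0∞) :
    lq q (fun i => lq q fun j => a i j) = lq q fun j => lq q fun i => a i j := by
  by_cases hq : q = ∞
  · subst hq
    simp only [lq_top]
    exact iSup_comm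
  · rw [lq_of_ne_top hq, lq_of_ne_top hq]
    simp only [lq_rpow_toReal h1 hq]
    rw [ENNReal.tsum_comm]

theorem lq_sigma (h1 : 1 ≤ q) {β : ι → Type*} (a : (Σ i, β i) → ℝ≥0∞) :
    lq q a = lq q fun i => lq q fun j => a ⟨i, j⟩ := by
  by_cases hq : q = ∞
  · subst hq
    simp only [lq_top]
    exact iSup_sigma
  · rw [lq_of_ne_top hq, lq_of_ne_top hq]
    simp only [lq_rpow_toReal h1 hq]
    rw [ENNReal.tsum_sigma']

theorem lq_comp_le (q : ℝ≥0∞) {f : ι → κ} (hf : Function.Injective f) (a : κ → ℝ≥0∞) :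
    lq q (fun i => a (f i)) ≤ lq q a := by
  unfold lq
  split_ifs
  · exact iSup_le fun i => le_iSup a (f i)
  · gcongr
    exact ENNReal.tsum_comp_le_tsum_of_injective hf fun k => a k ^ q.toReal

theorem lq_comp_equiv (q : ℝ≥0∞) (e : ι ≃ κ) (a : κ → ℝ≥0∞) :
    lq q (fun i => a (e i)) = lq q a := by
  refine le_antisymm (lq_comp_le q e.injective a) ?_
  simpa using lq_comp_le q e.symm.injective fun i => a (e i)

theorem lq_comp_of_support_subset (h1 : 1 ≤ q) {f : ι → κ} (hf : Function.Injective f)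
    (a : κ → ℝ≥0∞) (h : ∀ k, k ∉ Set.range f → a k = 0) :
    lq q a ≤ lq q (fun i => a (f i)) := by
  by_cases hq : q = ∞
  · subst hq
    simp only [lq_top]
    refine iSup_le fun k => ?_
    by_cases hk : k ∈ Set.range f
    · obtain ⟨i, rfl⟩ := hk
      exact le_iSup (fun i => a (f i)) i
    · simp [h k hk]
  · have hq1 := one_le_toReal_of_ne_top h1 hq
    rw [lq_of_ne_top hq, lq_of_ne_top hq, hf.tsum_eq (f := fun k => a k ^ q.toReal)]
    intro k hk
    by_contra hk'
    simp [h k hk', (by linarith : 0 < q.toReal)] at hk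

/-- Hölder's inequality, the source of the factor `N^(1-1/q)`. Since `(q⁻¹).toReal = 0` for `q = ∞`,
one formula covers all exponents. -/
theorem sum_le_card_rpow_mul_lq (h1 : 1 ≤ q) (n : ℕ) (a : Fin n → ℝ≥0∞) :
    ∑ i, a i ≤ (n : ℝ≥0∞) ^ (1 - (q⁻¹).toReal) * lq q a := by
  by_cases hq : q = ∞
  · subst hq
    have : ∑ i, a i ≤ ∑ _i : Fin n, lq ∞ a := Finset.sum_le_sum fun i _ => le_lq h1 a i
    simpa using this
  · have hq1 := one_le_toReal_of_ne_top h1 hq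
    have hq0 : 0 < q.toReal := by linarith
    rw [← ENNReal.rpow_le_rpow_iff hq0, ENNReal.mul_rpow_of_nonneg _ _ hq0.le,
      lq_rpow_toReal h1 hq, tsum_fintype, ← ENNReal.rpow_mul, ENNReal.toReal_inv, sub_mul,
      inv_mul_cancel₀ hq0.ne', one_mul]
    simpa using ENNReal.rpow_sum_le_const_mul_sum_rpow Finset.univ a hq1

theorem lq_const_fin (h1 : 1 ≤ q) {n : ℕ} (hn : 0 < n) (c : ℝ≥0∞) :
    lq q (fun _ : Fin n => c) = (n : ℝ≥0∞) ^ (q⁻¹).toReal * c := by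
  have : Nonempty (Fin n) := ⟨⟨0, hn⟩⟩
  by_cases hq : q = ∞
  · subst hq
    simp [lq_top]
  · have hq1 := one_le_toReal_of_ne_top h1 hq
    rw [lq_of_ne_top hq, tsum_fintype, Finset.sum_const, Finset.card_univ, Fintype.card_fin,
      nsmul_eq_mul, ENNReal.mul_rpow_of_nonneg _ _ (by positivity), ← ENNReal.rpow_mul,
      mul_one_div_cancel (by linarith), ENNReal.rpow_one, ENNReal.toReal_inv, one_div]

end SequenceNorm

/-! ### Powers of two and geometric series. -/

section Dyadic

/-- The sum of the geometric series with ratio `2 ^ (-s)`. -/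
noncomputable def geomConst (s : ℝ) : ℝ≥0∞ := ∑' i : ℕ, ((2 : ℝ≥0∞) ^ (-s)) ^ i

theorem geomConst_ne_top {s : ℝ} (hs : 0 < s) : geomConst s ≠ ∞ := by
  rw [geomConst, ENNReal.tsum_geometric, ne_eq, ENNReal.inv_eq_top, tsub_eq_zero_iff_le, not_le]
  exact ENNReal.rpow_lt_one_of_one_lt_of_neg (by norm_num) (by linarith)

theorem one_le_geomConst (s : ℝ) : 1 ≤ geomConst s :=
  le_trans (by simp) (ENNReal.le_tsum (f := fun i : ℕ => ((2 : ℝ≥0∞) ^ (-s)) ^ i) 0)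

theorem two_zpow_ne_zero (j : ℤ) : (2 : ℝ≥0∞) ^ j ≠ 0 :=
  (ENNReal.zpow_pos (by norm_num) (by norm_num) j).ne'

theorem two_zpow_ne_top (j : ℤ) : (2 : ℝ≥0∞) ^ j ≠ ∞ :=
  (ENNReal.zpow_lt_top (by norm_num) (by norm_num) j).ne

theorem two_zpow_add (i j : ℤ) : (2 : ℝ≥0∞) ^ (i + j) = 2 ^ i * 2 ^ j :=
  ENNReal.zpow_add (by norm_num) (by norm_num) i j

theorem two_zpow_add_one (j : ℤ) : (2 : ℝ≥0∞) ^ (j + 1) = 2 * 2 ^ j := by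
  rw [two_zpow_add, zpow_one, mul_comm]

theorem two_zpow_le_iff {i j : ℤ} : (2 : ℝ≥0∞) ^ i ≤ 2 ^ j ↔ i ≤ j := by
  have h : StrictMono fun j : ℤ => (2 : ℝ≥0∞) ^ j := by
    refine strictMono_int_of_lt_succ fun n => ?_
    rw [two_zpow_add_one, two_mul]
    exact ENNReal.lt_add_right (two_zpow_ne_top n) (two_zpow_ne_zero n)
  exact h.le_iff_le

theorem ofReal_two_zpow (j : ℤ) : ENNReal.ofReal ((2 : ℝ) ^ j) = 2 ^ j := by
  rw [← Real.rpow_intCast, ← ENNReal.ofReal_rpow_of_pos two_pos, ENNReal.rpow_intCast]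
  simp

theorem exists_two_zpow_le_lt {x : ℝ≥0∞} (h0 : x ≠ 0) (ht : x ≠ ∞) :
    ∃ j : ℤ, 2 ^ j ≤ x ∧ x < 2 * 2 ^ j := by
  obtain ⟨j, h⟩ := ENNReal.exists_mem_Ico_zpow h0 ht ENNReal.one_lt_two (by norm_num)
  exact ⟨j, h.1, two_zpow_add_one j ▸ h.2⟩

theorem exists_two_zpow_lt_le {x : ℝ≥0∞} (h0 : x ≠ 0) (ht : x ≠ ∞) :
    ∃ j : ℤ, 2 ^ j < x ∧ x ≤ 2 * 2 ^ j := by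
  obtain ⟨j, h⟩ := ENNReal.exists_mem_Ioc_zpow h0 ht ENNReal.one_lt_two (by norm_num)
  exact ⟨j, h.1, two_zpow_add_one j ▸ h.2⟩

theorem two_zpow_sub_rpow (m : ℤ) (i : ℕ) (s : ℝ) :
    ((2 : ℝ≥0∞) ^ (m - i)) ^ s = ((2 : ℝ≥0∞) ^ (-s)) ^ i * (2 ^ m) ^ s := by
  rw [← ENNReal.rpow_intCast, ← ENNReal.rpow_intCast, ← ENNReal.rpow_natCast, ← ENNReal.rpow_mul,
    ← ENNReal.rpow_mul, ← ENNReal.rpow_mul, ← ENNReal.rpow_add _ _ (by norm_num) (by norm_num)]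
  congr 1
  push_cast
  ring

/-- The powers of two below `x` form a geometric series dominated by its largest term. -/
theorem tsum_two_zpow_rpow_le {s : ℝ} (hs : 0 < s) (x : ℝ≥0∞) :
    ∑' j : ℤ, (if (2 : ℝ≥0∞) ^ j ≤ x then ((2 : ℝ≥0∞) ^ j) ^ s else 0) ≤ geomConst s * x ^ s := by
  by_cases h0 : x = 0
  · subst h0
    simp [two_zpow_ne_zero]
  by_cases ht : x = ∞
  · subst ht
    have : geomConst s ≠ 0 := (zero_lt_one.trans_le (one_le_geomConst s)).ne'
    simp [ENNReal.top_rpow_of_pos hs, ENNReal.mul_top this]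
  obtain ⟨m, hm, hm'⟩ := exists_two_zpow_le_lt h0 ht
  have hiff : ∀ j : ℤ, (2 : ℝ≥0∞) ^ j ≤ x → j ≤ m := fun j hj => by
    have h := hj.trans_lt hm'
    rw [← two_zpow_add_one] at h
    by_contra! hlt
    exact absurd (two_zpow_le_iff.2 (by omega : m + 1 ≤ j)) (not_le.2 h)
  have hinj : Function.Injective fun i : ℕ => m - (i : ℤ) := fun a b h => by
    simpa using h
  rw [← hinj.tsum_eq]
  · calc _ ≤ ∑' i : ℕ, ((2 : ℝ≥0∞) ^ (-s)) ^ i * (2 ^ m) ^ s := by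
          refine ENNReal.tsum_le_tsum fun i => ?_
          split_ifs
          · rw [two_zpow_sub_rpow]
          · exact zero_le
      _ ≤ _ := by
          rw [ENNReal.tsum_mul_right, ← geomConst]
          gcongr
  · intro j hj
    have hj' : (2 : ℝ≥0∞) ^ j ≤ x := by
      by_contra h
      simp [h] at hj
    have := hiff j hj'
    exact ⟨(m - j).toNat, by simp; omega⟩

theorem tsum_mul_two_zpow_rpow_le {s : ℝ} (hs : 0 < s) (x : ℝ≥0∞) (c : ℝ≥0∞) :
    ∑' j : ℤ, (if (2 : ℝ≥0∞) ^ j ≤ x then c * ((2 : ℝ≥0∞) ^ j) ^ s else 0) ≤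
      c * (geomConst s * x ^ s) := by
  refine le_trans (le_of_eq ?_) (mul_le_mul_right (tsum_two_zpow_rpow_le hs x) c)
  rw [← ENNReal.tsum_mul_left]
  simp only [mul_ite, mul_zero]

end Dyadic

/-! ### Dyadic discretization of the Lorentz quasinorm. -/

section LorentzNorm

variable {X : Type} [MeasurableSpace X] {μ : Measure X} {p θ : ℝ} {q r : ℝ≥0∞}

/-- A dyadic discretization of the Lorentz quasinorm `‖g‖_{p,q}`, with `θ = 1 / p`. -/
noncomputable def dyadicNorm (θ : ℝ) (q : ℝ≥0∞) (μ : Measure X) (g : X → ℝ≥0∞) : ℝ≥0∞ :=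
  lq q fun j : ℤ => 2 ^ j * μ {x | 2 ^ j < g x} ^ θ

theorem distribution_antitone (μ : Measure X) (g : X → ℝ≥0∞) : Antitone (distribution μ g) :=
  fun _ _ h => measure_mono fun _ hx => (ENNReal.ofReal_le_ofReal h).trans_lt hx

theorem distribution_two_zpow (μ : Measure X) (g : X → ℝ≥0∞) (j : ℤ) :
    distribution μ g (2 ^ j) = μ {x | 2 ^ j < g x} := by
  simp only [distribution, ofReal_two_zpow]

theorem iUnion_Ioc_two_zpow : ⋃ j : ℤ, Ioc ((2 : ℝ) ^ j) (2 ^ (j + 1)) = Ioi 0 := by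
  ext t
  simp only [mem_iUnion, mem_Ioi]
  constructor
  · rintro ⟨j, hj⟩
    exact (zpow_pos two_pos j).trans hj.1
  · exact fun ht => exists_mem_Ioc_zpow ht one_lt_two

theorem pairwise_disjoint_Ioc_two_zpow :
    Pairwise (Function.onFun Disjoint fun j : ℤ => Ioc ((2 : ℝ) ^ j) (2 ^ (j + 1))) := by
  have h : Monotone fun j : ℤ => (2 : ℝ) ^ j := fun i j hij => zpow_le_zpow_right₀ one_le_two hij
  exact h.pairwise_disjoint_on_Ioc_succ

theorem volume_Ioc_two_zpow (j : ℤ) : volume (Ioc ((2 : ℝ) ^ j) (2 ^ (j + 1))) = 2 ^ j := by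
  rw [Real.volume_Ioc, zpow_add_one₀ two_ne_zero, mul_two, add_sub_cancel_right, ofReal_two_zpow]

/-- On `(2^j, 2^(j+1)]` the distribution function is at most its value at the left endpoint, and `t`
at most doubles. -/
theorem lorentzNorm_le_dyadicNorm (hp : 0 < p) (hq1 : 1 ≤ q) (μ : Measure X) (g : X → ℝ≥0∞) :
    lorentzNorm μ p q g ≤ ENNReal.ofReal p ^ (1 / q.toReal) * 2 * dyadicNorm (1 / p) q μ g := by
  have hθ : 0 ≤ 1 / p := by positivity
  have key : ∀ (j : ℤ), ∀ t ∈ Ioc ((2 : ℝ) ^ j) (2 ^ (j + 1)),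
      ENNReal.ofReal t * distribution μ g t ^ (1 / p) ≤
        2 * (2 ^ j * μ {x | 2 ^ j < g x} ^ (1 / p)) := fun j t ht => by
    rw [← mul_assoc, ← two_zpow_add_one, ← ofReal_two_zpow (j + 1), ← distribution_two_zpow]
    gcongr
    · exact ht.2
    · exact distribution_antitone μ g ht.1.le
  unfold lorentzNorm
  split_ifs with hq
  · subst hq
    simp only [ENNReal.toReal_top, div_zero, ENNReal.rpow_zero, one_mul]
    refine iSup₂_le fun t ht => ?_
    have ht' : t ∈ ⋃ j : ℤ, Ioc ((2 : ℝ) ^ j) (2 ^ (j + 1)) := by rwa [iUnion_Ioc_two_zpow]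
    obtain ⟨j, hj⟩ := mem_iUnion.1 ht'
    exact (key j t hj).trans (mul_le_mul_right (le_lq hq1 _ j) 2)
  · have h1 := one_le_toReal_of_ne_top hq1 hq
    rw [mul_assoc]
    gcongr
    have h2 : 2 * dyadicNorm (1 / p) q μ g =
        ((2 * dyadicNorm (1 / p) q μ g) ^ q.toReal) ^ (1 / q.toReal) := by
      rw [← ENNReal.rpow_mul, mul_one_div_cancel (by linarith), ENNReal.rpow_one]
    rw [h2]
    gcongr
    rw [dyadicNorm, ← lq_const_mul hq1, lq_rpow_toReal hq1 hq, ← iUnion_Ioc_two_zpow]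
    refine (lintegral_iUnion_le _ _).trans (ENNReal.tsum_le_tsum fun j => ?_)
    calc _ ≤ ∫⁻ t in Ioc ((2 : ℝ) ^ j) (2 ^ (j + 1)),
          (2 * (2 ^ j * μ {x | 2 ^ j < g x} ^ (1 / p))) ^ q.toReal / 2 ^ j := by
          refine setLIntegral_mono' measurableSet_Ioc fun t ht => ?_
          refine ENNReal.div_le_div (ENNReal.rpow_le_rpow (key j t ht) (by linarith)) ?_
          rw [← ofReal_two_zpow]
          exact ENNReal.ofReal_le_ofReal ht.1.le
      _ = _ := by
          rw [setLIntegral_const, volume_Ioc_two_zpow,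
            ENNReal.div_mul_cancel (two_zpow_ne_zero j) (two_zpow_ne_top j)]

/-- Here the right endpoint bounds the distribution function from below, whence the shift to `j +
1`. The factor `p^(1/q)` is dropped since `p ≥ 1`. -/
theorem dyadicNorm_le_lorentzNorm (hp : 1 ≤ p) (hq1 : 1 ≤ q) (μ : Measure X) (g : X → ℝ≥0∞) :
    dyadicNorm (1 / p) q μ g ≤ 4 * lorentzNorm μ p q g := by
  have hθ : 0 ≤ 1 / p := by positivity
  unfold lorentzNorm
  split_ifs with hq
  · subst hq
    rw [dyadicNorm, lq_top]
    refine iSup_le fun j => ?_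
    have h := le_iSup₂ (f := fun (t : ℝ) (_ : 0 < t) =>
      ENNReal.ofReal t * distribution μ g t ^ (1 / p)) ((2 : ℝ) ^ j) (zpow_pos two_pos j)
    simp only [distribution_two_zpow, ofReal_two_zpow] at h
    refine h.trans (le_mul_of_one_le_left zero_le (by norm_num))
  · have h1 := one_le_toReal_of_ne_top hq1 hq
    have hq0 : 0 < q.toReal := by linarith
    set I := ∫⁻ t in Ioi (0 : ℝ),
      (ENNReal.ofReal t * distribution μ g t ^ (1 / p)) ^ q.toReal / ENNReal.ofReal t with hI
    have hp1 : 1 ≤ ENNReal.ofReal p ^ (1 / q.toReal) :=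
      ENNReal.one_le_rpow (by simpa using hp) (by positivity)
    suffices h : dyadicNorm (1 / p) q μ g ≤ 4 * I ^ (1 / q.toReal) by
      refine h.trans ?_
      gcongr
      exact le_mul_of_one_le_left zero_le hp1
    have hterm : ∀ j : ℤ, (2⁻¹ * (2 ^ (j + 1) * μ {x | 2 ^ (j + 1) < g x} ^ (1 / p))) ^ q.toReal ≤
        2 * ∫⁻ t in Ioc ((2 : ℝ) ^ j) (2 ^ (j + 1)),
          (ENNReal.ofReal t * distribution μ g t ^ (1 / p)) ^ q.toReal / ENNReal.ofReal t := by
      intro j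
      have : ∫⁻ t in Ioc ((2 : ℝ) ^ j) (2 ^ (j + 1)),
          (2⁻¹ * (2 ^ (j + 1) * μ {x | 2 ^ (j + 1) < g x} ^ (1 / p))) ^ q.toReal / 2 ^ (j + 1) ≤
          ∫⁻ t in Ioc ((2 : ℝ) ^ j) (2 ^ (j + 1)),
          (ENNReal.ofReal t * distribution μ g t ^ (1 / p)) ^ q.toReal / ENNReal.ofReal t := by
        refine setLIntegral_mono' measurableSet_Ioc fun t ht => ?_
        have e1 : (2⁻¹ : ℝ≥0∞) * 2 ^ (j + 1) = ENNReal.ofReal (2 ^ j) := by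
          rw [two_zpow_add_one, ← mul_assoc, ENNReal.inv_mul_cancel (by norm_num) (by norm_num),
            one_mul, ofReal_two_zpow]
        rw [← mul_assoc, e1, ← distribution_two_zpow, ← ofReal_two_zpow]
        gcongr
        · exact ht.1.le
        · exact distribution_antitone μ g ht.2
        · exact ht.2
      refine le_trans (le_of_eq ?_) (mul_le_mul_right this 2)
      rw [setLIntegral_const, volume_Ioc_two_zpow, mul_left_comm (2 : ℝ≥0∞) (_ / _), ← two_zpow_add_one,
        ENNReal.div_mul_cancel (two_zpow_ne_zero _) (two_zpow_ne_top _)]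
    have hsum : dyadicNorm (1 / p) q μ g ≤ 2 * (2 * I) ^ (1 / q.toReal) := by
      have e : dyadicNorm (1 / p) q μ g = 2 * lq q fun j : ℤ =>
          2⁻¹ * (2 ^ (j + 1) * μ {x | 2 ^ (j + 1) < g x} ^ (1 / p)) := by
        rw [lq_const_mul hq1, ← mul_assoc, ENNReal.mul_inv_cancel (by norm_num) (by norm_num),
          one_mul]
        exact (lq_comp_equiv q (Equiv.addRight (1 : ℤ))
          fun j : ℤ => 2 ^ j * μ {x | 2 ^ j < g x} ^ (1 / p)).symm
      rw [e]
      gcongr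
      rw [lq_of_ne_top hq]
      gcongr
      rw [hI, ← iUnion_Ioc_two_zpow, lintegral_iUnion (fun _ => measurableSet_Ioc)
        pairwise_disjoint_Ioc_two_zpow, ← ENNReal.tsum_mul_left]
      exact ENNReal.tsum_le_tsum hterm
    refine hsum.trans ?_
    rw [ENNReal.mul_rpow_of_nonneg _ _ (by positivity), ← mul_assoc]
    gcongr
    calc (2 : ℝ≥0∞) * 2 ^ (1 / q.toReal) ≤ 2 * 2 ^ (1 : ℝ) := by
          gcongr
          · norm_num
          · rw [div_le_one hq0]
            exact h1
      _ = 4 := by norm_num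

theorem dyadicNorm_anti (h1 : 1 ≤ q) (hqr : q ≤ r) (g : X → ℝ≥0∞) :
    dyadicNorm θ r μ g ≤ dyadicNorm θ q μ g :=
  lq_anti h1 hqr _

theorem dyadicNorm_mono (hθ : 0 ≤ θ) {g h : X → ℝ≥0∞} (hgh : ∀ x, g x ≤ h x) :
    dyadicNorm θ q μ g ≤ dyadicNorm θ q μ h := by
  refine lq_mono q fun j => ?_
  gcongr with x
  exact hgh x

/-- The quasinorm depends only on distribution functions, so functions on different spaces can be
compared. This transfers norms between levels of points and counting measure. -/
theorem dyadicNorm_le_of_dist_le {Y : Type} [MeasurableSpace Y] {ν : Measure Y} (hθ : 0 ≤ θ)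
    (h1 : 1 ≤ q) {g : X → ℝ≥0∞} {h : Y → ℝ≥0∞} {a c : ℝ≥0∞} (hc0 : c ≠ 0) (hc : c ≠ ∞)
    (hd : ∀ t : ℝ≥0∞, t ≠ 0 → t ≠ ∞ → μ {x | t < g x} ≤ a * ν {y | t < c * h y}) :
    dyadicNorm θ q μ g ≤ 2 * c * a ^ θ * dyadicNorm θ q ν h := by
  -- Rounding `c` up to `2^(i+1) ≤ 2c` turns multiplication by `c` into a shift of the dyadic index.
  obtain ⟨i, hi, hi'⟩ := exists_two_zpow_le_lt hc0 hc
  have hterm : ∀ j : ℤ, 2 ^ j * μ {x | 2 ^ j < g x} ^ θ ≤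
      (2 * c * a ^ θ) * (2 ^ (j - (i + 1)) * ν {y | 2 ^ (j - (i + 1)) < h y} ^ θ) := by
    intro j
    have e : (2 : ℝ≥0∞) ^ j = 2 ^ (i + 1) * 2 ^ (j - (i + 1)) := by
      rw [← two_zpow_add]
      congr 1
      ring
    have hsub : {y | 2 ^ j < c * h y} ⊆ {y | 2 ^ (j - (i + 1)) < h y} := fun y hy => by
      have hy' : (2 : ℝ≥0∞) ^ j < 2 ^ (i + 1) * h y := lt_of_lt_of_le hy <| by
        rw [two_zpow_add_one]
        gcongr
      rw [e] at hy'
      exact (ENNReal.mul_lt_mul_iff_right (two_zpow_ne_zero _) (two_zpow_ne_top _)).1 hy'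
    calc 2 ^ j * μ {x | 2 ^ j < g x} ^ θ
        ≤ 2 ^ j * (a * ν {y | 2 ^ (j - (i + 1)) < h y}) ^ θ := by
          gcongr
          exact (hd _ (two_zpow_ne_zero j) (two_zpow_ne_top j)).trans
            (mul_le_mul_right (measure_mono hsub) a)
      _ ≤ (2 * c) * 2 ^ (j - (i + 1)) * (a * ν {y | 2 ^ (j - (i + 1)) < h y}) ^ θ := by
          rw [e, two_zpow_add_one i]
          gcongr
      _ = _ := by
          rw [ENNReal.mul_rpow_of_nonneg _ _ hθ]
          ring
  refine (lq_mono q hterm).trans ?_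
  rw [lq_const_mul h1]
  gcongr
  exact lq_comp_le q (f := fun j : ℤ => j - (i + 1)) (fun a b h => by simpa using h)
    fun j => 2 ^ j * ν {y | 2 ^ j < h y} ^ θ

theorem dyadicNorm_mono_measure (hθ : 0 ≤ θ) {ν : Measure X} (h : μ ≤ ν) (g : X → ℝ≥0∞) :
    dyadicNorm θ q μ g ≤ dyadicNorm θ q ν g := by
  refine lq_mono q fun j => ?_
  gcongr

theorem dyadicNorm_restrict_le (hθ : 0 < θ) (h1 : 1 ≤ q) {g : X → ℝ≥0∞} {S E : Set X} {c : ℝ≥0∞}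
    (hS : MeasurableSet S) (hE : ∀ x ∈ S, x ∈ E → g x ≤ c) (hE' : ∀ x ∈ S, x ∉ E → g x = 0) :
    dyadicNorm θ q (μ.restrict S) g ≤ geomConst 1 * (c * μ E ^ θ) := by
  refine (lq_le_tsum h1 _).trans ?_
  have h := tsum_mul_two_zpow_rpow_le one_pos c (μ E ^ θ)
  simp only [ENNReal.rpow_one] at h
  calc _ ≤ ∑' j : ℤ, (if (2 : ℝ≥0∞) ^ j ≤ c then μ E ^ θ * 2 ^ j else 0) := by
        refine ENNReal.tsum_le_tsum fun j => ?_
        rw [Measure.restrict_apply' hS]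
        have hsub : {x | 2 ^ j < g x} ∩ S ⊆ {x | x ∈ E ∧ 2 ^ j < c} := fun x hx => by
          have hxE : x ∈ E := by
            by_contra h
            have h2 : 2 ^ j < g x := hx.1
            simp [hE' x hx.2 h] at h2
          exact ⟨hxE, lt_of_lt_of_le hx.1 (hE x hx.2 hxE)⟩
        split_ifs with hj
        · rw [mul_comm]
          gcongr
          exact fun x hx => (hsub hx).1
        · have : {x | 2 ^ j < g x} ∩ S = ∅ := by
            refine eq_empty_of_subset_empty (hsub.trans ?_)
            rintro x ⟨-, hx⟩
            exact hj hx.le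
          simp [this, hθ]
    _ ≤ _ := by
        refine h.trans (le_of_eq ?_)
        ring

theorem const_mul_le_dyadicNorm (hθ : 0 ≤ θ) (h1 : 1 ≤ q) {g : X → ℝ≥0∞} {E : Set X} {c : ℝ≥0∞}
    (hc : c ≠ ∞) (hE : ∀ x ∈ E, c ≤ g x) : c * μ E ^ θ ≤ 2 * dyadicNorm θ q μ g := by
  by_cases h0 : c = 0
  · simp [h0]
  obtain ⟨j, hj, hj'⟩ := exists_two_zpow_lt_le h0 hc
  calc c * μ E ^ θ ≤ 2 * 2 ^ j * μ {x | 2 ^ j < g x} ^ θ := by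
        gcongr
        exact fun x hx => hj.trans_le (hE x hx)
    _ ≤ _ := by
        rw [mul_assoc]
        gcongr
        exact le_lq h1 (fun j : ℤ => 2 ^ j * μ {x | 2 ^ j < g x} ^ θ) j

end LorentzNorm

/-! ### Equivalence of the Lorentz quasinorm with an interpolation norm. -/

section Normability

variable {X : Type} [MeasurableSpace X] {μ : Measure X} {θ : ℝ} {q : ℝ≥0∞}

/-- The `K`-functional of the couple `(L^1, L^∞)`. -/
noncomputable def kFunctional (μ : Measure X) (g : X → ℝ≥0∞) (s : ℝ≥0∞) : ℝ≥0∞ :=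
  ∫⁻ t in Ioi (0 : ℝ), min s (distribution μ g t)

/-- The discretized real interpolation norm, equivalent to the Lorentz norm. -/
noncomputable def kNorm (θ : ℝ) (q : ℝ≥0∞) (μ : Measure X) (g : X → ℝ≥0∞) : ℝ≥0∞ :=
  lq q fun m : ℤ => ((2 : ℝ≥0∞) ^ m) ^ (θ - 1) * kFunctional μ g (2 ^ m)

/-- The length of the set of levels `t > 0` whose superlevel set has measure at least `2 ^ m`. -/
noncomputable def levelLength (μ : Measure X) (g : X → ℝ≥0∞) (m : ℤ) : ℝ≥0∞ :=
  volume {t : ℝ | 0 < t ∧ 2 ^ m ≤ distribution μ g t}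

/-- The double sum comparing the discretizations in the level and in the measure. -/
noncomputable def doubleNorm (θ : ℝ) (q : ℝ≥0∞) (μ : Measure X) (g : X → ℝ≥0∞) : ℝ≥0∞ :=
  lq q fun j : ℤ => lq q fun m : ℤ =>
    if (2 : ℝ≥0∞) ^ m ≤ μ {x | 2 ^ j < g x} then 2 ^ j * ((2 : ℝ≥0∞) ^ m) ^ θ else 0

theorem measurable_distribution (μ : Measure X) (g : X → ℝ≥0∞) : Measurable (distribution μ g) :=
  (distribution_antitone μ g).measurable

theorem measurableSet_levels (μ : Measure X) (g : X → ℝ≥0∞) (m : ℤ) :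
    MeasurableSet {t : ℝ | 0 < t ∧ 2 ^ m ≤ distribution μ g t} :=
  MeasurableSet.inter (s₁ := Ioi 0) measurableSet_Ioi
    (measurableSet_le measurable_const (measurable_distribution μ g))

/-- Layer cake formula for the excess of `g` over `l`; the subtraction is truncated at `0`. -/
theorem lintegral_Ioi_distribution [SFinite μ] {g : X → ℝ≥0∞} (hg : Measurable g) (l : ℝ≥0) :
    ∫⁻ t in Ioi (l : ℝ), distribution μ g t = ∫⁻ x, (g x - l) ∂μ := by
  have hm : MeasurableSet {z : ℝ × X | ENNReal.ofReal z.1 < g z.2} :=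
    measurableSet_lt (by fun_prop) (by fun_prop)
  have h1 : ∀ t : ℝ, distribution μ g t =
      ∫⁻ x, {z : ℝ × X | ENNReal.ofReal z.1 < g z.2}.indicator 1 (t, x) ∂μ := fun t => by
    have : (fun x => {z : ℝ × X | ENNReal.ofReal z.1 < g z.2}.indicator
        (1 : ℝ × X → ℝ≥0∞) (t, x)) = {x | ENNReal.ofReal t < g x}.indicator 1 := by
      ext x
      simp [indicator]
    rw [this, lintegral_indicator_one (measurableSet_lt (by fun_prop) hg)]
    rfl
  simp only [h1]
  rw [lintegral_lintegral_swap]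
  · congr 1
    ext x
    have : (fun t => {z : ℝ × X | ENNReal.ofReal z.1 < g z.2}.indicator
        (1 : ℝ × X → ℝ≥0∞) (t, x)) = {t : ℝ | ENNReal.ofReal t < g x}.indicator 1 := by
      ext x
      simp [indicator]
    rw [this, lintegral_indicator_one (measurableSet_lt (by fun_prop) (by fun_prop)),
      Measure.restrict_apply (measurableSet_lt (by fun_prop) (by fun_prop))]
    by_cases hx : g x = ∞
    · simp [hx]
    · have : {t : ℝ | ENNReal.ofReal t < g x} ∩ Ioi (l : ℝ) = Ioo (l : ℝ) (g x).toReal := by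
        ext t
        rw [inter_comm]
        refine and_congr_right fun ht => ?_
        exact ENNReal.ofReal_lt_iff_lt_toReal (l.coe_nonneg.trans (le_of_lt ht)) hx
      rw [this, Real.volume_Ioo, ENNReal.ofReal_sub _ l.coe_nonneg, ENNReal.ofReal_toReal hx,
        ENNReal.ofReal_coe_nnreal]
  · exact ((measurable_const.indicator hm).comp measurable_id).aemeasurable

theorem kFunctional_le [SFinite μ] {g : X → ℝ≥0∞} (hg : Measurable g) (s : ℝ≥0∞) (l : ℝ≥0) :
    kFunctional μ g s ≤ l * s + ∫⁻ x, (g x - l) ∂μ := by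
  rw [← lintegral_Ioi_distribution hg, kFunctional, ← Ioc_union_Ioi_eq_Ioi l.coe_nonneg]
  refine (lintegral_union_le _ _ _).trans (add_le_add ?_ ?_)
  · refine (lintegral_mono fun t => min_le_left _ _).trans ?_
    rw [setLIntegral_const, Real.volume_Ioc, sub_zero, mul_comm, ENNReal.ofReal_coe_nnreal]
  · exact lintegral_mono fun t => min_le_right _ _

/-- The splitting height is the supremum of the levels at which the distribution function exceeds
`s`: below it the minimum equals `s`, above it the distribution function. -/
theorem exists_le_kFunctional [SFinite μ] {g : X → ℝ≥0∞} (hg : Measurable g) {s : ℝ≥0∞}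
    (hs : s ≠ 0) (hK : kFunctional μ g s ≠ ∞) :
    ∃ l : ℝ≥0, l * s + ∫⁻ x, (g x - l) ∂μ ≤ kFunctional μ g s := by
  set A : Set ℝ := {t | 0 < t ∧ s < distribution μ g t} with hA
  have hbdd : BddAbove A := by
    by_contra h
    refine hK ?_
    have hle : ∀ t : ℝ, s ≤ distribution μ g t := fun t => by
      obtain ⟨u, hu, htu⟩ := not_bddAbove_iff.1 h t
      exact hu.2.le.trans (distribution_antitone μ g htu.le)
    simp [kFunctional, hle, ENNReal.mul_top hs]
  -- If `A` is empty, `sSup A = 0`, and the height `0` is the right one.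
  obtain ⟨l, hl⟩ : ∃ l : ℝ≥0, (l : ℝ) = sSup A :=
    ⟨(sSup A).toNNReal, Real.coe_toNNReal _ (Real.sSup_nonneg fun t ht => ht.1.le)⟩
  refine ⟨l, ?_⟩
  rw [← lintegral_Ioi_distribution hg, kFunctional, ← Ioc_union_Ioi_eq_Ioi l.coe_nonneg,
    lintegral_union measurableSet_Ioi Ioc_disjoint_Ioi_same,
    setLIntegral_congr (Ioo_ae_eq_Ioc (a := (0 : ℝ)) (b := l)).symm]
  refine add_le_add ?_ ?_
  · have : ∫⁻ t in Ioo (0 : ℝ) l, s = l * s := by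
      rw [setLIntegral_const, Real.volume_Ioo, sub_zero, mul_comm, ENNReal.ofReal_coe_nnreal]
    rw [← this]
    refine setLIntegral_mono' measurableSet_Ioo fun t ht => le_min le_rfl ?_
    rw [hl] at ht
    have hne : A.Nonempty := by
      by_contra h
      rw [not_nonempty_iff_eq_empty.1 h, Real.sSup_empty] at ht
      exact lt_asymm ht.1 ht.2
    obtain ⟨u, hu, htu⟩ := exists_lt_of_lt_csSup hne ht.2
    exact hu.2.le.trans (distribution_antitone μ g htu.le)
  · refine setLIntegral_mono' measurableSet_Ioi fun t ht => le_min ?_ le_rfl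
    by_contra! h
    exact absurd (le_csSup hbdd (show t ∈ A from ⟨l.coe_nonneg.trans_lt ht, h⟩))
      (not_le.2 (hl ▸ ht))

/-- Add the optimal heights `a` of `f` and `b` of `g`: the excess of `f + g` over `a + b` is at most
the sum of the two excesses. -/
theorem kFunctional_add_le [SFinite μ] {f g : X → ℝ≥0∞} (hf : Measurable f) (hg : Measurable g)
    {s : ℝ≥0∞} (hs : s ≠ 0) :
    kFunctional μ (fun x => f x + g x) s ≤ kFunctional μ f s + kFunctional μ g s := by
  by_cases hKf : kFunctional μ f s = ∞
  · simp [hKf]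
  by_cases hKg : kFunctional μ g s = ∞
  · simp [hKg]
  obtain ⟨a, ha⟩ := exists_le_kFunctional hf hs hKf
  obtain ⟨b, hb⟩ := exists_le_kFunctional hg hs hKg
  refine le_trans ?_ (add_le_add ha hb)
  refine (kFunctional_le (hf.add hg) s (a + b)).trans ?_
  have : ∫⁻ x, (f x + g x - ((a + b : ℝ≥0) : ℝ≥0∞)) ∂μ ≤
      ∫⁻ x, (f x - a) ∂μ + ∫⁻ x, (g x - b) ∂μ := by
    rw [← lintegral_add_left (by fun_prop)]
    refine lintegral_mono fun x => ?_
    push_cast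
    exact add_tsub_add_le_tsub_add_tsub
  refine (add_le_add_right this _).trans (le_of_eq ?_)
  push_cast
  ring

theorem kNorm_add_le [SFinite μ] (h1 : 1 ≤ q) {f g : X → ℝ≥0∞} (hf : Measurable f)
    (hg : Measurable g) : kNorm θ q μ (fun x => f x + g x) ≤ kNorm θ q μ f + kNorm θ q μ g := by
  refine le_trans (lq_mono q fun m => ?_) (lq_add_le h1 _ _)
  rw [← mul_add]
  gcongr
  exact kFunctional_add_le hf hg (two_zpow_ne_zero m)

theorem kNorm_finset_sum_le [SFinite μ] (h1 : 1 ≤ q) {ι : Type*} (s : Finset ι)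
    {f : ι → X → ℝ≥0∞} (hf : ∀ i, Measurable (f i)) :
    kNorm θ q μ (fun x => ∑ i ∈ s, f i x) ≤ ∑ i ∈ s, kNorm θ q μ (f i) := by
  classical
  induction s using Finset.induction_on with
  | empty =>
    refine (lq_le_tsum h1 _).trans ?_
    simp [kFunctional, distribution]
  | insert i s hi ih =>
    simp only [Finset.sum_insert hi]
    exact (kNorm_add_le h1 (hf i) (Finset.measurable_fun_sum s fun i _ => hf i)).trans
      (add_le_add_right ih _)

theorem dyadicNorm_le_doubleNorm [IsFiniteMeasure μ] (hθ : 0 < θ) (h1 : 1 ≤ q) (g : X → ℝ≥0∞) :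
    dyadicNorm θ q μ g ≤ 2 ^ θ * doubleNorm θ q μ g := by
  rw [doubleNorm, ← lq_const_mul h1]
  refine lq_mono q fun j => ?_
  by_cases h0 : μ {x | 2 ^ j < g x} = 0
  · simp [h0, hθ]
  obtain ⟨m, hm, hm'⟩ := exists_two_zpow_le_lt h0 (measure_ne_top μ _)
  have h := le_lq h1 (fun m : ℤ => if (2 : ℝ≥0∞) ^ m ≤ μ {x | 2 ^ j < g x}
    then 2 ^ j * ((2 : ℝ≥0∞) ^ m) ^ θ else 0) m
  simp only [hm, if_true] at h
  calc 2 ^ j * μ {x | 2 ^ j < g x} ^ θ ≤ 2 ^ j * (2 * 2 ^ m) ^ θ := by gcongr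
    _ = 2 ^ θ * (2 ^ j * (2 ^ m) ^ θ) := by
        rw [ENNReal.mul_rpow_of_nonneg _ _ hθ.le]
        ring
    _ ≤ _ := by gcongr

/-- For fixed `j` the sum over `m` is geometric, hence comparable to its largest term, which is the
`j`-th dyadic term. -/
theorem doubleNorm_le_dyadicNorm (hθ : 0 < θ) (h1 : 1 ≤ q) (g : X → ℝ≥0∞) :
    doubleNorm θ q μ g ≤ geomConst θ * dyadicNorm θ q μ g := by
  rw [dyadicNorm, ← lq_const_mul h1]
  refine lq_mono q fun j => (lq_le_tsum h1 _).trans ?_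
  refine (tsum_mul_two_zpow_rpow_le hθ _ _).trans (le_of_eq ?_)
  ring

theorem tsum_levels_le_levelLength (g : X → ℝ≥0∞) (m : ℤ) :
    ∑' j : ℤ, (if (2 : ℝ≥0∞) ^ m ≤ μ {x | 2 ^ j < g x} then (2 : ℝ≥0∞) ^ j else 0) ≤
      2 * levelLength μ g m := by
  have hterm : ∀ j : ℤ, (if (2 : ℝ≥0∞) ^ m ≤ μ {x | 2 ^ j < g x} then (2 : ℝ≥0∞) ^ j else 0) ≤
      2 * volume ({t : ℝ | 0 < t ∧ 2 ^ m ≤ distribution μ g t} ∩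
        Ioc (2 ^ (j - 1)) (2 ^ (j - 1 + 1))) := fun j => by
    split_ifs with h
    · rw [inter_eq_right.2, volume_Ioc_two_zpow, ← two_zpow_add_one, sub_add_cancel]
      rintro t ht
      refine ⟨(zpow_pos two_pos _).trans ht.1, ?_⟩
      rw [← distribution_two_zpow] at h
      refine h.trans (distribution_antitone μ g ?_)
      simpa using ht.2
    · exact zero_le
  refine (ENNReal.tsum_le_tsum hterm).trans ?_
  rw [ENNReal.tsum_mul_left]
  gcongr
  have hmeas := measurableSet_levels μ g m
  refine (tsum_meas_le_meas_iUnion_of_disjoint volume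
    (fun j => hmeas.inter measurableSet_Ioc) ?_).trans (measure_mono (iUnion_subset fun j =>
      inter_subset_left))
  intro i j hij
  exact (pairwise_disjoint_Ioc_two_zpow (show i - 1 ≠ j - 1 by omega)).mono
    inter_subset_right inter_subset_right

/-- The levels in question lie in an interval starting at `0`, whose length is at most twice the
largest power of two occurring, a single term of the `ℓ^q` norm. -/
theorem levelLength_le_lq (h1 : 1 ≤ q) (g : X → ℝ≥0∞) (m : ℤ) :
    levelLength μ g m ≤ 2 * lq q fun j : ℤ =>
      if (2 : ℝ≥0∞) ^ m ≤ μ {x | 2 ^ j < g x} then (2 : ℝ≥0∞) ^ j else 0 := by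
  set R := lq q fun j : ℤ =>
      if (2 : ℝ≥0∞) ^ m ≤ μ {x | 2 ^ j < g x} then (2 : ℝ≥0∞) ^ j else 0 with hR
  by_cases hRt : 2 * R = ∞
  · simp [hRt]
  have hsub : {t : ℝ | 0 < t ∧ 2 ^ m ≤ distribution μ g t} ⊆ Ioc 0 (2 * R).toReal := by
    rintro t ⟨ht, hmt⟩
    refine ⟨ht, ?_⟩
    obtain ⟨j, hj, hj'⟩ := exists_mem_Ioc_zpow ht one_lt_two
    have hjm : (2 : ℝ≥0∞) ^ m ≤ μ {x | 2 ^ j < g x} := by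
      rw [← distribution_two_zpow]
      exact hmt.trans (distribution_antitone μ g hj.le)
    have h := le_lq h1 (fun j : ℤ =>
      if (2 : ℝ≥0∞) ^ m ≤ μ {x | 2 ^ j < g x} then (2 : ℝ≥0∞) ^ j else 0) j
    simp only [hjm, if_true, ← hR] at h
    rw [← ENNReal.ofReal_le_iff_le_toReal hRt]
    refine (ENNReal.ofReal_le_ofReal hj').trans ?_
    rw [ofReal_two_zpow, two_zpow_add_one]
    gcongr
  refine (measure_mono hsub).trans ?_
  rw [Real.volume_Ioc, sub_zero, ENNReal.ofReal_toReal hRt]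

theorem lq_levelLength_le_doubleNorm (h1 : 1 ≤ q) (g : X → ℝ≥0∞) :
    (lq q fun m : ℤ => ((2 : ℝ≥0∞) ^ m) ^ θ * levelLength μ g m) ≤ 2 * doubleNorm θ q μ g := by
  rw [doubleNorm, lq_comm h1, ← lq_const_mul h1]
  refine lq_mono q fun m => ?_
  calc _ ≤ ((2 : ℝ≥0∞) ^ m) ^ θ * (2 * lq q fun j : ℤ =>
        if (2 : ℝ≥0∞) ^ m ≤ μ {x | 2 ^ j < g x} then (2 : ℝ≥0∞) ^ j else 0) := by
        gcongr
        exact levelLength_le_lq h1 g m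
    _ = _ := by
        rw [mul_left_comm, ← lq_const_mul h1]
        simp only [mul_comm (((2 : ℝ≥0∞) ^ m) ^ θ), ite_mul, zero_mul]

theorem doubleNorm_le_lq_levelLength (h1 : 1 ≤ q) (g : X → ℝ≥0∞) :
    doubleNorm θ q μ g ≤ 2 * lq q fun m : ℤ => ((2 : ℝ≥0∞) ^ m) ^ θ * levelLength μ g m := by
  rw [doubleNorm, lq_comm h1, ← lq_const_mul h1]
  refine lq_mono q fun m => (lq_le_tsum h1 _).trans ?_
  rw [mul_left_comm]
  refine le_trans (le_of_eq ?_) (mul_le_mul_right (tsum_levels_le_levelLength g m) _)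
  rw [← ENNReal.tsum_mul_left]
  simp only [mul_comm (((2 : ℝ≥0∞) ^ m) ^ θ), ite_mul, zero_mul]

theorem mul_levelLength_le_kFunctional (g : X → ℝ≥0∞) (m : ℤ) :
    2 ^ m * levelLength μ g m ≤ kFunctional μ g (2 ^ m) := by
  have hmeas := measurableSet_levels μ g m
  rw [levelLength, ← setLIntegral_const]
  calc _ ≤ ∫⁻ t in {t : ℝ | 0 < t ∧ 2 ^ m ≤ distribution μ g t}, min (2 ^ m) (distribution μ g t) :=
        setLIntegral_mono' hmeas fun t ht => le_min le_rfl ht.2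
    _ ≤ _ := lintegral_mono_set fun t ht => ht.1

/-- Where it is nonzero, the integrand is at most twice the largest power of two not exceeding it,
and this power is one term of the series. -/
theorem kFunctional_le_tsum [IsFiniteMeasure μ] (g : X → ℝ≥0∞) (m : ℤ) :
    kFunctional μ g (2 ^ m) ≤ 2 * ∑' i : ℕ, 2 ^ (m - i) * levelLength μ g (m - i) := by
  have hmeas : ∀ k : ℤ, MeasurableSet {t : ℝ | 2 ^ k ≤ distribution μ g t} := fun k =>
    measurableSet_le (by fun_prop) (measurable_distribution μ g)
  have hpt : ∀ t : ℝ, min (2 ^ m) (distribution μ g t) ≤ 2 * ∑' i : ℕ,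
      {t : ℝ | 2 ^ (m - i : ℤ) ≤ distribution μ g t}.indicator
        (fun _ => (2 : ℝ≥0∞) ^ (m - i : ℤ)) t := by
    intro t
    by_cases h0 : distribution μ g t = 0
    · simp [h0]
    obtain ⟨k, hk, hk'⟩ := exists_two_zpow_le_lt h0 (measure_ne_top μ _)
    have hterm := ENNReal.le_tsum (f := fun i : ℕ =>
      {t : ℝ | 2 ^ (m - i : ℤ) ≤ distribution μ g t}.indicator
        (fun _ => (2 : ℝ≥0∞) ^ (m - i : ℤ)) t) (m - min k m).toNat
    have e : m - ((m - min k m).toNat : ℤ) = min k m := by omega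
    simp only [e] at hterm
    rw [indicator_of_mem (show t ∈ {t : ℝ | (2 : ℝ≥0∞) ^ (min k m) ≤ distribution μ g t} from
      (two_zpow_le_iff.2 (min_le_left _ _)).trans hk)] at hterm
    refine le_trans ?_ (mul_le_mul_right hterm 2)
    rcases le_total k m with h | h
    · rw [min_eq_left h]
      exact (min_le_right _ _).trans hk'.le
    · rw [min_eq_right h, two_mul]
      exact (min_le_left _ _).trans le_self_add
  refine (lintegral_mono hpt).trans ?_
  rw [lintegral_const_mul' _ _ (by norm_num), lintegral_tsum fun i =>
    (measurable_const.indicator (hmeas _)).aemeasurable]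
  gcongr with i
  rw [lintegral_indicator_const (hmeas _), Measure.restrict_apply (hmeas _), levelLength]
  gcongr
  exact fun t ht => ⟨ht.2, ht.1⟩

/-- A discrete Hardy inequality: the series for the `K`-functional is a sum of translates with
weights `2^(-(1-θ) i)`, to which Minkowski applies. The constant is finite when `θ < 1`, that is,
when `p > 1`. -/
theorem kNorm_le_lq_levelLength [IsFiniteMeasure μ] (h1 : 1 ≤ q) (g : X → ℝ≥0∞) :
    kNorm θ q μ g ≤ 2 * geomConst (1 - θ) *
      lq q fun m : ℤ => ((2 : ℝ≥0∞) ^ m) ^ θ * levelLength μ g m := by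
  set b : ℤ → ℝ≥0∞ := fun m => ((2 : ℝ≥0∞) ^ m) ^ θ * levelLength μ g m with hb
  have hpow : ∀ (m : ℤ) (s : ℝ), ((2 : ℝ≥0∞) ^ m) ^ (s - 1) * 2 ^ m = (2 ^ m) ^ s := fun m s => by
    conv_lhs => rw [← ENNReal.rpow_one (2 ^ m), ← ENNReal.rpow_mul, one_mul]
    rw [← ENNReal.rpow_add _ _ (two_zpow_ne_zero m) (two_zpow_ne_top m), sub_add_cancel]
  have hterm : ∀ m : ℤ, ((2 : ℝ≥0∞) ^ m) ^ (θ - 1) * kFunctional μ g (2 ^ m) ≤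
      2 * ∑' i : ℕ, ((2 : ℝ≥0∞) ^ (-(1 - θ))) ^ i * b (m - i) := by
    intro m
    refine (mul_le_mul_right (kFunctional_le_tsum g m) _).trans (le_of_eq ?_)
    rw [mul_left_comm, ← ENNReal.tsum_mul_left]
    congr 2
    ext i
    rw [hb, ← mul_assoc, ← mul_assoc]
    congr 1
    rw [← hpow (m - i) θ, two_zpow_sub_rpow, ← mul_assoc, ← mul_assoc, ← mul_pow,
      ← ENNReal.rpow_add _ _ (by norm_num) (by norm_num)]
    simp
  refine (lq_mono q hterm).trans ?_
  rw [lq_const_mul h1, mul_assoc]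
  gcongr
  refine (lq_tsum_le h1 _).trans ?_
  rw [geomConst, ← ENNReal.tsum_mul_right]
  refine ENNReal.tsum_le_tsum fun i => ?_
  rw [lq_const_mul h1]
  gcongr
  exact lq_comp_le q (f := fun m : ℤ => m - i) (fun a b h => by simpa using h) b

theorem kNorm_le_dyadicNorm [IsFiniteMeasure μ] (hθ : 0 < θ) (h1 : 1 ≤ q) (g : X → ℝ≥0∞) :
    kNorm θ q μ g ≤ 4 * geomConst (1 - θ) * geomConst θ * dyadicNorm θ q μ g := by
  refine (kNorm_le_lq_levelLength h1 g).trans ?_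
  calc _ ≤ 2 * geomConst (1 - θ) * (2 * (geomConst θ * dyadicNorm θ q μ g)) := by
        gcongr
        refine (lq_levelLength_le_doubleNorm h1 g).trans ?_
        gcongr
        exact doubleNorm_le_dyadicNorm hθ h1 g
    _ = _ := by ring

theorem dyadicNorm_le_kNorm [IsFiniteMeasure μ] (hθ : 0 < θ) (h1 : 1 ≤ q) (g : X → ℝ≥0∞) :
    dyadicNorm θ q μ g ≤ 2 ^ θ * 2 * kNorm θ q μ g := by
  refine (dyadicNorm_le_doubleNorm hθ h1 g).trans ?_
  rw [mul_assoc]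
  gcongr
  refine (doubleNorm_le_lq_levelLength h1 g).trans ?_
  gcongr
  refine lq_mono q fun m => ?_
  refine le_trans (le_of_eq ?_) (mul_le_mul_right (mul_levelLength_le_kFunctional g m) _)
  rw [← mul_assoc]
  congr 1
  conv_rhs => rw [← ENNReal.rpow_one (2 ^ m), ← ENNReal.rpow_mul, one_mul]
  rw [← ENNReal.rpow_add _ _ (two_zpow_ne_zero m) (two_zpow_ne_top m), sub_add_cancel]

/-- The constant in the triangle inequality for `dyadicNorm`. -/
noncomputable def triangleConst (θ : ℝ) : ℝ≥0∞ :=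
  2 ^ θ * 2 * (4 * geomConst (1 - θ) * geomConst θ)

theorem triangleConst_ne_top (h0 : 0 < θ) (h1 : θ < 1) : triangleConst θ ≠ ∞ := by
  have := geomConst_ne_top h0
  have := geomConst_ne_top (sub_pos.2 h1)
  have : (2 : ℝ≥0∞) ^ θ ≠ ∞ := ENNReal.rpow_ne_top_of_nonneg h0.le (by norm_num)
  unfold triangleConst
  finiteness

/-- Passing to the subadditive `kNorm` and back costs a constant only once, independently of the
number of summands. -/
theorem dyadicNorm_finset_sum_le [IsFiniteMeasure μ] (hθ : 0 < θ) (h1 : 1 ≤ q) {ι : Type*}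
    (s : Finset ι) {f : ι → X → ℝ≥0∞} (hf : ∀ i, Measurable (f i)) :
    dyadicNorm θ q μ (fun x => ∑ i ∈ s, f i x) ≤
      triangleConst θ * ∑ i ∈ s, dyadicNorm θ q μ (f i) := by
  refine (dyadicNorm_le_kNorm hθ h1 _).trans ?_
  rw [triangleConst, mul_assoc (2 ^ θ * 2)]
  gcongr
  refine (kNorm_finset_sum_le h1 s hf).trans ?_
  rw [Finset.mul_sum]
  exact Finset.sum_le_sum fun i _ => kNorm_le_dyadicNorm hθ h1 _

/-- For `s ≥ μ univ` the truncation in the `K`-functional is void and the functional is the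
integral, so one term of `kNorm` with `q = ∞` suffices. -/
theorem lintegral_le_dyadicNorm [IsFiniteMeasure μ] (hθ : 0 < θ) (hθ1 : θ < 1) {g : X → ℝ≥0∞}
    (hg : Measurable g) :
    ∫⁻ x, g x ∂μ ≤ 8 * geomConst (1 - θ) * geomConst θ * μ univ ^ (1 - θ) *
      dyadicNorm θ ∞ μ g := by
  by_cases h0 : μ univ = 0
  · simp [Measure.measure_univ_eq_zero.1 h0]
  obtain ⟨m, hm, hm'⟩ := exists_two_zpow_lt_le h0 (measure_ne_top μ _)
  rw [← two_zpow_add_one] at hm'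
  have hK : ∫⁻ x, g x ∂μ = kFunctional μ g (2 ^ (m + 1)) := by
    have := lintegral_Ioi_distribution (μ := μ) hg 0
    simp only [NNReal.coe_zero, ENNReal.coe_zero, tsub_zero] at this
    rw [← this, kFunctional]
    congr 1
    ext t
    rw [min_eq_right]
    exact (measure_mono (subset_univ _)).trans hm'
  have h := (le_lq le_top (fun m : ℤ => ((2 : ℝ≥0∞) ^ m) ^ (θ - 1) * kFunctional μ g (2 ^ m))
    (m + 1)).trans (kNorm_le_dyadicNorm hθ le_top g)
  have hpow : ((2 : ℝ≥0∞) ^ (m + 1)) ^ (1 - θ) * (2 ^ (m + 1)) ^ (θ - 1) = 1 := by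
    rw [← ENNReal.rpow_add _ _ (two_zpow_ne_zero _) (two_zpow_ne_top _)]
    simp
  calc ∫⁻ x, g x ∂μ = ((2 : ℝ≥0∞) ^ (m + 1)) ^ (1 - θ) * ((2 ^ (m + 1)) ^ (θ - 1) *
        kFunctional μ g (2 ^ (m + 1))) := by rw [← mul_assoc, hpow, one_mul, hK]
    _ ≤ ((2 : ℝ≥0∞) * μ univ) ^ (1 - θ) *
        (4 * geomConst (1 - θ) * geomConst θ * dyadicNorm θ ∞ μ g) := by
        refine mul_le_mul' (ENNReal.rpow_le_rpow ?_ (by linarith)) h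
        rw [two_zpow_add_one]
        gcongr
    _ ≤ (2 * μ univ ^ (1 - θ)) *
        (4 * geomConst (1 - θ) * geomConst θ * dyadicNorm θ ∞ μ g) := by
        rw [ENNReal.mul_rpow_of_nonneg _ _ (by linarith)]
        gcongr
        calc (2 : ℝ≥0∞) ^ (1 - θ) ≤ 2 ^ (1 : ℝ) := by
              gcongr
              · norm_num
              · linarith
          _ = 2 := by simp
    _ = _ := by ring

end Normability

/-! ### Lorentz norms on lacunary partitions. -/

section Lacunary

/-- Each dyadic interval contains at most one nonzero value, so the sum is dominated by a geometric
series ending at the supremum. -/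
theorem tsum_rpow_le_of_separated {Λ : Type*} {x : Λ → ℝ≥0∞} (hx : ∀ a, x a ≠ ∞)
    (hsep : ∀ a b, a ≠ b → x a ≠ 0 → x b ≠ 0 → 2 * x b ≤ x a ∨ 2 * x a ≤ x b)
    {s : ℝ} (hs : 0 < s) : ∑' a, x a ^ s ≤ 2 ^ s * (geomConst s * (⨆ a, x a) ^ s) := by
  classical
  have hpt : ∀ a, x a ^ s ≤ ∑' j : ℤ, if (2 : ℝ≥0∞) ^ j ≤ x a ∧ x a < 2 * 2 ^ j
      then 2 ^ s * ((2 : ℝ≥0∞) ^ j) ^ s else 0 := fun a => by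
    by_cases h0 : x a = 0
    · simp [h0, hs]
    obtain ⟨j, hj, hj'⟩ := exists_two_zpow_le_lt h0 (hx a)
    refine le_trans ?_ (ENNReal.le_tsum j)
    rw [if_pos ⟨hj, hj'⟩, ← ENNReal.mul_rpow_of_nonneg _ _ hs.le]
    gcongr
  refine (ENNReal.tsum_le_tsum hpt).trans ?_
  rw [ENNReal.tsum_comm]
  refine le_trans (ENNReal.tsum_le_tsum fun j => ?_) (tsum_mul_two_zpow_rpow_le hs _ _)
  by_cases hex : ∃ a, (2 : ℝ≥0∞) ^ j ≤ x a ∧ x a < 2 * 2 ^ j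
  · obtain ⟨a, ha⟩ := hex
    rw [tsum_eq_single a, if_pos ha, if_pos (ha.1.trans (le_iSup x a))]
    intro b hb
    refine if_neg fun hb' => ?_
    have hpos := pos_iff_ne_zero.2 (two_zpow_ne_zero j)
    rcases hsep a b hb.symm (hpos.trans_le ha.1).ne' (hpos.trans_le hb'.1).ne' with h | h
    · exact absurd (((mul_le_mul_right hb'.1 2).trans h).trans_lt ha.2) (lt_irrefl _)
    · exact absurd (((mul_le_mul_right ha.1 2).trans h).trans_lt hb'.2) (lt_irrefl _)
  · simp only [not_exists] at hex
    simp [hex]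

variable {X Λ : Type} [MeasurableSpace X] {μ : Measure X} {θ : ℝ} {q : ℝ≥0∞}

/-- A countable partition whose parts can be compared: of any two different parts, each point of
one of them carries at least twice the mass of the other. -/
structure IsLacunaryPartition (μ : Measure X) (E : Λ → Set X) : Prop where
  measurable : ∀ a, MeasurableSet (E a)
  cover : ⋃ a, E a = univ
  disjoint : Pairwise (Function.onFun Disjoint E)
  separated : ∀ a b, a ≠ b →
    (∀ x ∈ E a, 2 * μ (E b) ≤ μ {x}) ∨ (∀ x ∈ E b, 2 * μ (E a) ≤ μ {x})

/-- The constant in the estimates for lacunary partitions. -/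
noncomputable def lacunaryConst (θ : ℝ) : ℝ≥0∞ := 2 ^ θ * geomConst θ

theorem lacunaryConst_ne_top (hθ : 0 < θ) : lacunaryConst θ ≠ ∞ := by
  have := geomConst_ne_top hθ
  have : (2 : ℝ≥0∞) ^ θ ≠ ∞ := ENNReal.rpow_ne_top_of_nonneg hθ.le (by norm_num)
  unfold lacunaryConst
  finiteness

namespace IsLacunaryPartition

variable {E : Λ → Set X}

/-- A nonempty trace of `S` on a part has at least the mass of one point, which makes the measures
of the traces separated by factors of two. -/
theorem tsum_rpow_le [IsFiniteMeasure μ] (hE : IsLacunaryPartition μ E) (hθ : 0 < θ) (S : Set X) :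
    ∑' a, μ (S ∩ E a) ^ θ ≤ lacunaryConst θ * (⨆ a, μ (S ∩ E a)) ^ θ := by
  rw [lacunaryConst, mul_assoc]
  refine tsum_rpow_le_of_separated (fun a => measure_ne_top μ _) (fun a b hab ha hb => ?_) hθ
  obtain ⟨x, hx⟩ := nonempty_of_measure_ne_zero ha
  obtain ⟨y, hy⟩ := nonempty_of_measure_ne_zero hb
  rcases hE.separated a b hab with h | h
  · left
    calc 2 * μ (S ∩ E b) ≤ 2 * μ (E b) := by gcongr; exact inter_subset_right
      _ ≤ μ {x} := h x hx.2
      _ ≤ _ := measure_mono (singleton_subset_iff.2 hx)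
  · right
    calc 2 * μ (S ∩ E a) ≤ 2 * μ (E a) := by gcongr; exact inter_subset_right
      _ ≤ μ {y} := h y hy.2
      _ ≤ _ := measure_mono (singleton_subset_iff.2 hy)

theorem measure_le [IsFiniteMeasure μ] [Countable Λ] (hE : IsLacunaryPartition μ E) (S : Set X) :
    μ S ≤ lacunaryConst 1 * ⨆ a, μ (S ∩ E a) := by
  have h := hE.tsum_rpow_le one_pos S
  simp only [ENNReal.rpow_one] at h
  refine le_trans ?_ h
  conv_lhs => rw [← inter_univ S, ← hE.cover, inter_iUnion]
  exact measure_iUnion_le _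

/-- The measure of each superlevel set is comparable to the supremum of its traces, and a supremum
is at most an `ℓ^q` norm. -/
theorem dyadicNorm_le [IsFiniteMeasure μ] [Countable Λ] (hE : IsLacunaryPartition μ E)
    (hθ : 0 < θ) (h1 : 1 ≤ q) (g : X → ℝ≥0∞) :
    dyadicNorm θ q μ g ≤
      lacunaryConst 1 ^ θ * lq q fun a => dyadicNorm θ q (μ.restrict (E a)) g := by
  simp only [dyadicNorm]
  rw [lq_comm h1, ← lq_const_mul h1]
  refine lq_mono q fun j => ?_
  rw [lq_const_mul h1, mul_left_comm]
  gcongr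
  calc μ {x | 2 ^ j < g x} ^ θ ≤ (lacunaryConst 1 * ⨆ a, μ ({x | 2 ^ j < g x} ∩ E a)) ^ θ := by
        gcongr
        exact hE.measure_le _
    _ = lacunaryConst 1 ^ θ * (⨆ a, μ ({x | 2 ^ j < g x} ∩ E a) ^ θ) := by
        rw [ENNReal.mul_rpow_of_nonneg _ _ hθ.le]
        congr 1
        exact (ENNReal.orderIsoRpow θ hθ).map_iSup _
    _ ≤ _ := by
        gcongr
        refine iSup_le fun a => ?_
        rw [← Measure.restrict_apply' (hE.measurable a)]
        exact le_lq h1 (fun a => μ.restrict (E a) {x | 2 ^ j < g x} ^ θ) a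

theorem lq_dyadicNorm_le [IsFiniteMeasure μ] (hE : IsLacunaryPartition μ E)
    (hθ : 0 < θ) (h1 : 1 ≤ q) (g : X → ℝ≥0∞) :
    (lq q fun a => dyadicNorm θ q (μ.restrict (E a)) g) ≤
      lacunaryConst θ * dyadicNorm θ q μ g := by
  simp only [dyadicNorm]
  rw [lq_comm h1, ← lq_const_mul h1]
  refine lq_mono q fun j => ?_
  rw [lq_const_mul h1, mul_left_comm]
  gcongr
  refine (lq_le_tsum h1 _).trans ?_
  simp only [Measure.restrict_apply' (hE.measurable _)]
  refine (hE.tsum_rpow_le hθ _).trans ?_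
  gcongr
  exact iSup_le fun a => measure_mono inter_subset_left

end IsLacunaryPartition

end Lacunary

/-! ### Combinatorics of a single test space. -/

open Classical in
theorem count_setOf_fin {n : ℕ} (P : Fin n → Prop) :
    Measure.count {l | P l} = ((Finset.univ.filter P).card : ℝ≥0∞) := by
  have : {l | P l} = ((Finset.univ.filter P : Finset (Fin n)) : Set (Fin n)) := by
    ext
    simp
  rw [this, Measure.count_apply_finset]

namespace TypeIII

variable {p : ℝ} (U : TypeIII p)

theorem two_mul_m_mul_h_le {i j : ℕ} (hij : i < j) (hj : j < U.N) :
    2 * U.m i * U.h i ≤ U.m j := by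
  induction j, hij using Nat.le_induction with
  | base => exact U.m_growth i hj
  | succ j hij ih =>
    have h1 := U.m_growth j hj
    have h2 := ih (by omega)
    have h3 := U.h_pos j (by omega)
    nlinarith [Nat.le_mul_of_pos_right (2 * U.m j) h3]

theorem α_zero_le {k : ℕ} (hk : k < U.M) : U.α 0 ≤ U.α k := by
  induction k with
  | zero => rfl
  | succ k ih =>
    have h1 := U.α_growth k hk
    have h2 := ih (by omega)
    have h3 : 0 < U.L * U.β k * U.h (U.N - 1) :=
      Nat.mul_pos (Nat.mul_pos U.L_pos (U.β_pos k (by omega)))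
        (U.h_pos _ (by have := U.N_pos; omega))
    have h4 := Nat.le_mul_of_pos_right (2 * U.α k) h3
    have h5 : 2 * U.α k * U.L * U.β k * U.h (U.N - 1) =
      2 * U.α k * (U.L * U.β k * U.h (U.N - 1)) := by ring
    omega

theorem upperCard_pos {k : ℕ} (hk : k < U.M) : 0 < U.upperCard k :=
  Nat.mul_pos (Nat.mul_pos U.L_pos (U.β_pos k hk)) (U.h_pos _ (by have := U.N_pos; omega))

theorem two_mul_α_mul_upperCard_le {k l : ℕ} (hkl : k < l) (hl : l < U.M) :
    2 * U.α k * U.upperCard k ≤ U.α l := by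
  induction l, hkl using Nat.le_induction with
  | base =>
    have := U.α_growth k hl
    unfold upperCard
    linarith
  | succ j hij ih =>
    have h1 := U.α_growth j hl
    have h2 := ih (by omega)
    have h3 := Nat.le_mul_of_pos_right (2 * U.α j) (U.upperCard_pos (k := j) (by omega))
    have h5 : 2 * U.α j * U.L * U.β j * U.h (U.N - 1) = 2 * U.α j * U.upperCard j := by
      unfold upperCard
      ring
    omega

theorem two_mul_m_mul_h_le_α {i k : ℕ} (hi : i < U.N) (hk : k < U.M) :
    2 * U.m i * U.h i ≤ U.α k := by
  refine le_trans ?_ (U.α_zero_le hk)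
  have h0 := U.α_zero
  rcases Nat.lt_or_ge i (U.N - 1) with h | h
  · have h1 := U.two_mul_m_mul_h_le h (by omega)
    have h2 := Nat.le_mul_of_pos_right (2 * U.m (U.N - 1)) (U.h_pos (U.N - 1) (by omega))
    omega
  · obtain rfl : i = U.N - 1 := by omega
    exact h0

theorem sum_m_mul_h_le_α : ∑ i ∈ Finset.range U.N, U.m i * U.h i ≤ U.α 0 := by
  -- Level masses at least double, so partial sums stay below twice the last term; this `2` is the
  -- one in `α_zero`.
  have key : ∀ n < U.N, ∑ i ∈ Finset.range (n + 1), U.m i * U.h i ≤ 2 * (U.m n * U.h n) := by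
    intro n
    induction n with
    | zero =>
      intro _
      simp only [zero_add, Finset.range_one, Finset.sum_singleton]
      omega
    | succ n ih =>
      intro hn
      rw [Finset.sum_range_succ]
      have h1 := ih (by omega)
      have h2 := U.m_growth n hn
      have h3 := Nat.le_mul_of_pos_right (U.m (n + 1)) (U.h_pos (n + 1) hn)
      rw [mul_assoc] at h2
      omega
  have hN := U.N_pos
  have h := key (U.N - 1) (by omega)
  have h0 := U.α_zero
  rw [Nat.sub_add_cancel hN] at h
  rw [mul_assoc] at h0
  omega

/-- The levels of the space, each consisting of points of equal mass. -/
abbrev Level : Type := Fin U.N ⊕ Fin U.M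

/-- The number of points of a level. -/
def levelCard : U.Level → ℕ
  | .inl i => U.h i
  | .inr k => U.upperCard k

/-- The mass of each point of a level. -/
noncomputable def levelMass : U.Level → ℝ
  | .inl i => U.m i
  | .inr k => U.K * U.α k

/-- The level of a point. -/
def level : U.Point → U.Level
  | .inl x => .inl x.1
  | .inr x => .inr x.1

/-- The points of a level. -/
def levelPoint : (l : U.Level) → Fin (U.levelCard l) → U.Point
  | .inl i, j => .inl ⟨i, j⟩
  | .inr k, j => .inr ⟨k, j⟩

theorem levelPoint_injective (l : U.Level) : Function.Injective (U.levelPoint l) := by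
  intro a b h
  rcases l with i | k
  · exact eq_of_heq (Sigma.mk.inj (Sum.inl_injective h)).2
  · exact eq_of_heq (Sigma.mk.inj (Sum.inr_injective h)).2

theorem level_levelPoint (l : U.Level) (j : Fin (U.levelCard l)) :
    U.level (U.levelPoint l j) = l := by
  rcases l with i | k <;> rfl

theorem exists_levelPoint (x : U.Point) : ∃ j, U.levelPoint (U.level x) j = x := by
  rcases x with x | x
  · exact ⟨x.2, rfl⟩
  · exact ⟨x.2, rfl⟩

theorem mass_eq_levelMass (x : U.Point) : U.mass x = U.levelMass (U.level x) := by
  rcases x with x | x <;> rfl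

theorem levelMass_pos (l : U.Level) : 0 < U.levelMass l := by
  rcases l with i | k
  · have : (0 : ℝ) < U.m i := by exact_mod_cast U.m_pos i i.2
    exact this
  · have := U.one_le_K
    have : (0 : ℝ) < U.α k := by exact_mod_cast U.α_pos k k.2
    simp only [levelMass]
    positivity

theorem mass_pos (x : U.Point) : 0 < U.mass x := U.mass_eq_levelMass x ▸ U.levelMass_pos _

theorem level_separated {l l' : U.Level} (h : l ≠ l') :
    2 * (U.levelCard l' * U.levelMass l') ≤ U.levelMass l ∨
      2 * (U.levelCard l * U.levelMass l) ≤ U.levelMass l' := by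
  have hK := U.one_le_K
  have low : ∀ i j : Fin U.N, i < j → 2 * ((U.h i : ℝ) * U.m i) ≤ U.m j := fun i j hij => by
    have := U.two_mul_m_mul_h_le hij j.2
    have : (2 * U.m i * U.h i : ℝ) ≤ U.m j := by exact_mod_cast this
    linarith
  have up : ∀ i j : Fin U.M, i < j →
      2 * ((U.upperCard i : ℝ) * (U.K * U.α i)) ≤ U.K * U.α j := fun i j hij => by
    have := U.two_mul_α_mul_upperCard_le hij j.2
    have : (2 * U.α i * U.upperCard i : ℝ) ≤ U.α j := by exact_mod_cast this
    nlinarith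
  have mid : ∀ (i : Fin U.N) (k : Fin U.M), 2 * ((U.h i : ℝ) * U.m i) ≤ U.K * U.α k :=
    fun i k => by
      have := U.two_mul_m_mul_h_le_α i.2 k.2
      have : (2 * U.m i * U.h i : ℝ) ≤ U.α k := by exact_mod_cast this
      nlinarith [(Nat.cast_nonneg (U.α k) : (0 : ℝ) ≤ _)]
  rcases l with i | k <;> rcases l' with j | l
  · rcases lt_trichotomy i j with hij | rfl | hij
    · exact Or.inr (low i j hij)
    · exact absurd rfl h
    · exact Or.inl (low j i hij)
  · exact Or.inr (mid i l)
  · exact Or.inl (mid j k)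
  · rcases lt_trichotomy k l with hij | rfl | hij
    · exact Or.inr (up k l hij)
    · exact absurd rfl h
    · exact Or.inl (up l k hij)

theorem rho_self (x : U.Point) : U.rho x x = 0 := by
  rcases x with x | x <;> simp [rho]

theorem rho_comm (x y : U.Point) : U.rho x y = U.rho y x := by
  rcases x with x | x <;> rcases y with y | y <;> simp [rho, eq_comm]

theorem rho_le_two (x y : U.Point) : U.rho x y ≤ 2 := by
  rcases x with x | x <;> rcases y with y | y <;> simp only [rho] <;> split_ifs <;> norm_num

theorem one_le_rho {x y : U.Point} (h : x ≠ y) : 1 ≤ U.rho x y := by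
  rcases x with x | x <;> rcases y with y | y <;> simp only [rho] <;> split_ifs with hxy <;>
    first | exact absurd (congrArg _ hxy) h | norm_num

theorem rho_nonneg (x y : U.Point) : 0 ≤ U.rho x y := by
  by_cases h : x = y
  · rw [h, rho_self]
  · exact zero_le_one.trans (U.one_le_rho h)

theorem rho_triangle (x y z : U.Point) : U.rho x z ≤ U.rho x y + U.rho y z := by
  by_cases h : x = y
  · rw [h, rho_self, zero_add]
  by_cases h' : y = z
  · rw [h', rho_self, add_zero]
  have := U.rho_le_two x z
  have := U.one_le_rho h
  have := U.one_le_rho h'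
  linarith

theorem h_dvd_upperCard {i : ℕ} (hi : i < U.N) (k : ℕ) : U.h i ∣ U.upperCard k :=
  (U.h_dvd i hi).mul_left _

/-- The number of upper points of type `k` linked with a given lower point of type `i`. -/
def blockCard (i k : ℕ) : ℕ := U.upperCard k / U.h i

theorem h_mul_blockCard {i : ℕ} (hi : i < U.N) (k : ℕ) :
    U.h i * U.blockCard i k = U.upperCard k := Nat.mul_div_cancel' (U.h_dvd_upperCard hi k)

theorem blockCard_pos {i k : ℕ} (hi : i < U.N) (hk : k < U.M) : 0 < U.blockCard i k := by
  by_contra h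
  have h0 : U.blockCard i k = 0 := by omega
  have := U.h_mul_blockCard hi k
  have := U.upperCard_pos hk
  simp_all

/-- The index of the block of type `i` that contains the `l`-th upper point of type `k`. -/
def block (i : Fin U.N) (k : Fin U.M) (l : Fin (U.upperCard k)) : Fin (U.h i) :=
  ⟨l / U.blockCard i k, Nat.div_lt_of_lt_mul <| by
    rw [mul_comm, U.h_mul_blockCard i.2]
    exact l.2⟩

/-- The blocks of type `i` partition the upper points of type `k`, so each upper point has exactly
one lower neighbor of every type. -/
theorem linked_iff (i : Fin U.N) (j : Fin (U.h i)) (k : Fin U.M) (l : Fin (U.upperCard k)) :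
    U.Linked ⟨i, j⟩ ⟨k, l⟩ ↔ j = U.block i k l := by
  rw [Fin.ext_iff, eq_comm, block, Nat.div_eq_iff (U.blockCard_pos i.2 k.2), Linked]
  change (j : ℕ) * U.blockCard i k ≤ (l : ℕ) ∧ (l : ℕ) < ((j : ℕ) + 1) * U.blockCard i k ↔ _
  have := U.blockCard_pos i.2 k.2
  rw [add_mul, one_mul]
  refine and_congr Iff.rfl ?_
  omega

theorem exists_linked (i : Fin U.N) (j : Fin (U.h i)) (k : Fin U.M) :
    ∃ l, U.Linked ⟨i, j⟩ ⟨k, l⟩ := by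
  have hpos := U.blockCard_pos i.2 k.2
  refine ⟨⟨j * U.blockCard i k, ?_⟩, ?_, ?_⟩
  · rw [← U.h_mul_blockCard i.2]
    exact Nat.mul_lt_mul_of_pos_right j.2 hpos
  · exact le_rfl
  · exact Nat.mul_lt_mul_of_pos_right (Nat.lt_succ_self _) hpos

-- Within one block a point is determined by its remainder modulo `blockCard`, so no fibre of
-- `block` exceeds that size.
open Classical in
theorem card_block_le (i : Fin U.N) (k : Fin U.M) (P : Fin (U.h i) → Prop) :
    (Finset.univ.filter fun l => P (U.block i k l)).card ≤
      U.blockCard i k * (Finset.univ.filter P).card := by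
  refine Finset.card_le_mul_card_image_of_maps_to (f := U.block i k) (fun l hl => ?_) _
    fun j _ => ?_
  · simpa using hl
  · have hpos := U.blockCard_pos i.2 k.2
    rw [← Finset.card_range (U.blockCard i k)]
    refine Finset.card_le_card_of_injOn (fun l => l % U.blockCard i k) (fun l _ => ?_)
      fun l hl l' hl' h => ?_
    · simpa using Nat.mod_lt _ hpos
    · have e : ∀ l : Fin (U.upperCard k), U.block i k l = j →
          (l : ℕ) / U.blockCard i k = j := fun l hl => congrArg Fin.val hl
      simp only [Finset.coe_filter, Finset.mem_filter, Finset.mem_univ, true_and] at hl hl'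
      have h1 := e l hl.2
      have h2 := e l' hl'.2
      refine Fin.ext ?_
      rw [← Nat.div_add_mod (l : ℕ) (U.blockCard i k), ← Nat.div_add_mod (l' : ℕ)
        (U.blockCard i k), h1, h2]
      congr 1

theorem count_block_le (i : Fin U.N) (k : Fin U.M) (P : Fin (U.h i) → Prop) :
    Measure.count {l | P (U.block i k l)} ≤ U.blockCard i k * Measure.count {j | P j} := by
  rw [count_setOf_fin, count_setOf_fin]
  exact_mod_cast U.card_block_le i k P

end TypeIII

/-! ### Composite test spaces: metric, measure, partitions. -/

/-- The data of a composite test space: a sequence of test spaces of type III with the factors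
rescaling their measures. -/
structure CompositeData (p : ℝ) where
  U : ℕ → TypeIII p
  b : ℕ → ℝ
  b_pos : ∀ n, 0 < b n
  separated : ∀ n, ∀ x : (U n).Point,
    2 * ∑ y : (U (n + 1)).Point, b (n + 1) * (U (n + 1)).mass y ≤ b n * (U n).mass x

namespace CompositeData

variable {p : ℝ} (D : CompositeData p)

/-- The points of the composite test space. -/
structure Point : Type where
  idx : ℕ
  pt : (D.U idx).Point

/-- The set of points as a disjoint union. -/
def pointEquiv : (Σ n, (D.U n).Point) ≃ D.Point where
  toFun x := ⟨x.1, x.2⟩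
  invFun x := ⟨x.1, x.2⟩

instance : Countable D.Point := D.pointEquiv.symm.injective.countable

/-- The distance: the rescaled distance of the test space between points of one component, and `1`
between points of different components. -/
noncomputable def dist (x y : D.Point) : ℝ :=
  if h : x.1 = y.1 then 3⁻¹ * (D.U y.1).rho (h ▸ x.2) y.2 else 1

theorem dist_same (n : ℕ) (x y : (D.U n).Point) :
    D.dist ⟨n, x⟩ ⟨n, y⟩ = 3⁻¹ * (D.U n).rho x y := by
  simp [dist]

theorem dist_ne {n k : ℕ} (h : n ≠ k) (x : (D.U n).Point) (y : (D.U k).Point) :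
    D.dist ⟨n, x⟩ ⟨k, y⟩ = 1 := by
  simp [dist, h]

theorem dist_le_one (x y : D.Point) : D.dist x y ≤ 1 := by
  obtain ⟨n, x⟩ := x
  obtain ⟨k, y⟩ := y
  by_cases h : n = k
  · subst h
    rw [dist_same]
    linarith [(D.U n).rho_le_two x y]
  · rw [D.dist_ne h]

noncomputable instance : MetricSpace D.Point where
  dist := D.dist
  dist_self := fun ⟨n, x⟩ => by
    rw [dist_same, TypeIII.rho_self, mul_zero]
  dist_comm := fun ⟨n, x⟩ ⟨k, y⟩ => by
    by_cases h : n = k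
    · subst h
      rw [dist_same, dist_same, TypeIII.rho_comm]
    · rw [D.dist_ne h, D.dist_ne (Ne.symm h)]
  dist_triangle := fun x y z => by
    have hnn : ∀ x y : D.Point, 0 ≤ D.dist x y := fun ⟨n, x⟩ ⟨k, y⟩ => by
      by_cases h : n = k
      · subst h
        rw [dist_same]
        linarith [(D.U n).rho_nonneg x y]
      · rw [D.dist_ne h]
        exact zero_le_one
    have hxz := D.dist_le_one x z
    have h1 := hnn x y
    have h2 := hnn y z
    obtain ⟨n, x⟩ := x
    obtain ⟨k, y⟩ := y
    obtain ⟨l, z⟩ := z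
    by_cases h : n = k
    · by_cases h' : k = l
      · subst h h'
        simp only [dist_same]
        linarith [(D.U n).rho_triangle x y z]
      · rw [D.dist_ne h' y z]
        linarith
    · rw [D.dist_ne h x y]
      linarith
  eq_of_dist_eq_zero := fun {x y} hxy => by
    change D.dist x y = 0 at hxy
    obtain ⟨n, x⟩ := x
    obtain ⟨k, y⟩ := y
    by_cases h : n = k
    · subst h
      rw [dist_same] at hxy
      by_contra hne
      have hne' : x ≠ y := fun h => hne (by rw [h])
      linarith [(D.U n).one_le_rho hne']
    · rw [D.dist_ne h] at hxy
      norm_num at hxy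

theorem dist_def (x y : D.Point) : Dist.dist x y = D.dist x y := rfl

/-- With scaling factor `1/3` all distances are `0`, `1/3`, `2/3` or `1`, so a ball depends only on
its center and the position of its radius relative to `1/3`, `2/3`, `1`. -/
theorem ball_of_le_third {s : ℝ} (hs : 0 < s) (hs' : s ≤ 1 / 3) (x : D.Point) :
    Metric.ball x s = {x} := by
  ext y
  rw [Metric.mem_ball, mem_singleton_iff, dist_def]
  constructor
  · intro h
    obtain ⟨n, x⟩ := x
    obtain ⟨k, y⟩ := y
    by_cases hn : k = n
    · subst hn
      rw [dist_same] at h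
      by_contra hne
      have hne' : y ≠ x := fun h => hne (by rw [h])
      linarith [(D.U k).one_le_rho hne']
    · rw [D.dist_ne hn] at h
      linarith
  · rintro rfl
    rw [← dist_def, dist_self]
    exact hs

theorem mem_ball_of_le_two_thirds {s : ℝ} (hs : 1 / 3 < s) (hs' : s ≤ 2 / 3) {n : ℕ}
    (x : (D.U n).Point) (y : D.Point) :
    y ∈ Metric.ball (⟨n, x⟩ : D.Point) s ↔ ∃ z, y = ⟨n, z⟩ ∧ (D.U n).rho z x < 2 := by
  rw [Metric.mem_ball, dist_def]
  obtain ⟨k, y⟩ := y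
  constructor
  · intro h
    by_cases hn : k = n
    · subst hn
      rw [dist_same] at h
      exact ⟨y, rfl, by linarith⟩
    · rw [D.dist_ne hn] at h
      linarith
  · rintro ⟨z, hz, hzx⟩
    obtain rfl : k = n := congrArg Point.idx hz
    obtain rfl : y = z := eq_of_heq (Point.mk.inj hz).2
    rw [dist_same]
    have : (D.U k).rho y x ≤ 1 := by
      rcases x with x | x <;> rcases y with y | y <;> simp only [TypeIII.rho] at hzx ⊢ <;>
        split_ifs at hzx ⊢ <;> linarith
    linarith

theorem ball_of_le_one {s : ℝ} (hs : 2 / 3 < s) (hs' : s ≤ 1) (x : D.Point) :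
    Metric.ball x s = {y | y.1 = x.1} := by
  ext y
  rw [Metric.mem_ball, dist_def]
  obtain ⟨n, x⟩ := x
  obtain ⟨k, y⟩ := y
  change _ ↔ k = n
  constructor
  · intro h
    by_contra hn
    rw [D.dist_ne hn] at h
    linarith
  · rintro rfl
    rw [dist_same]
    linarith [(D.U k).rho_le_two y x]

theorem ball_of_one_lt {s : ℝ} (hs : 1 < s) (x : D.Point) : Metric.ball x s = univ :=
  eq_univ_of_forall fun y => (D.dist_le_one y x).trans_lt hs

instance : DiscreteTopology D.Point :=
  discreteTopology_iff_isOpen_singleton.2 fun x => by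
    rw [← D.ball_of_le_third (s := 1 / 3) (by norm_num) le_rfl x]
    exact Metric.isOpen_ball

instance : MeasurableSpace D.Point := ⊤

instance : DiscreteMeasurableSpace D.Point := ⟨fun _ => trivial⟩

instance : BorelSpace D.Point := ⟨borel_eq_top_of_discrete.symm⟩

/-- The mass of a point. -/
noncomputable def weight (x : D.Point) : ℝ≥0∞ := ENNReal.ofReal (D.b x.1 * (D.U x.1).mass x.2)

/-- The measure of the composite test space. -/
noncomputable def measure : Measure D.Point := Measure.sum fun x => D.weight x • Measure.dirac x

theorem measure_apply (S : Set D.Point) : D.measure S = ∑' x, S.indicator D.weight x := by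
  rw [measure, Measure.sum_apply _ (MeasurableSet.of_discrete)]
  refine tsum_congr fun x => ?_
  by_cases hx : x ∈ S <;> simp [hx]

theorem measure_singleton (x : D.Point) : D.measure {x} = D.weight x := by
  rw [measure_apply, tsum_eq_single x]
  · simp
  · intro y hy
    simp [hy]

theorem measure_range {ι : Type*} {f : ι → D.Point} (hf : Function.Injective f) :
    D.measure (range f) = ∑' i, D.weight (f i) := by
  rw [measure_apply, ← hf.tsum_eq]
  · simp
  · intro x hx
    by_contra h
    simp [h] at hx

/-- The total mass of a component. -/
noncomputable def total (n : ℕ) : ℝ := ∑ y : (D.U n).Point, D.b n * (D.U n).mass y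

theorem point_nonempty (n : ℕ) : Nonempty (D.U n).Point :=
  ⟨Sum.inl ⟨⟨0, (D.U n).N_pos⟩, ⟨0, (D.U n).h_pos 0 (D.U n).N_pos⟩⟩⟩

theorem term_pos (n : ℕ) (x : (D.U n).Point) : 0 < D.b n * (D.U n).mass x :=
  mul_pos (D.b_pos n) ((D.U n).mass_pos x)

theorem term_le_total (n : ℕ) (x : (D.U n).Point) : D.b n * (D.U n).mass x ≤ D.total n :=
  Finset.single_le_sum (fun y _ => (D.term_pos n y).le) (Finset.mem_univ x)

theorem total_pos (n : ℕ) : 0 < D.total n :=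
  let ⟨x⟩ := D.point_nonempty n
  (D.term_pos n x).trans_le (D.term_le_total n x)

theorem two_mul_total_le {n k : ℕ} (h : n < k) (x : (D.U n).Point) :
    2 * D.total k ≤ D.b n * (D.U n).mass x := by
  induction k, h using Nat.le_induction with
  | base => exact D.separated n x
  | succ k hk ih =>
    obtain ⟨y⟩ := D.point_nonempty k
    have h1 : 2 * D.total (k + 1) ≤ _ := D.separated k y
    have h2 := D.term_le_total k y
    have h3 := D.total_pos k
    linarith

theorem measure_component (n : ℕ) : D.measure {x | x.1 = n} = ENNReal.ofReal (D.total n) := by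
  have hinj : Function.Injective fun x : (D.U n).Point => (⟨n, x⟩ : D.Point) := fun x y h =>
    eq_of_heq (Point.mk.inj h).2
  have hr : range (fun x : (D.U n).Point => (⟨n, x⟩ : D.Point)) = {x | x.1 = n} := by
    ext ⟨k, x⟩
    constructor
    · rintro ⟨y, hy⟩
      exact (congrArg Point.idx hy).symm
    · rintro rfl
      exact ⟨x, rfl⟩
  rw [← hr, D.measure_range hinj, tsum_fintype, total,
    ENNReal.ofReal_sum_of_nonneg fun y _ => (D.term_pos n y).le]
  rfl

theorem measure_component_le (n : ℕ) :
    D.measure {x | x.1 = n} ≤ 2⁻¹ ^ n * ENNReal.ofReal (D.total 0) := by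
  rw [measure_component]
  induction n with
  | zero => simp
  | succ n ih =>
    obtain ⟨y⟩ := D.point_nonempty n
    have h1 : 2 * D.total (n + 1) ≤ _ := D.separated n y
    have h2 := D.term_le_total n y
    calc ENNReal.ofReal (D.total (n + 1)) ≤ ENNReal.ofReal (2⁻¹ * D.total n) :=
          ENNReal.ofReal_le_ofReal (by linarith)
      _ = 2⁻¹ * ENNReal.ofReal (D.total n) := by
          rw [ENNReal.ofReal_mul (by norm_num), ENNReal.ofReal_inv_of_pos two_pos]
          simp
      _ ≤ _ := by
          rw [pow_succ', mul_assoc]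
          gcongr

instance : IsFiniteMeasure D.measure := ⟨by
  have : (univ : Set D.Point) = ⋃ n, {x : D.Point | x.1 = n} := by
    ext x
    simp
  rw [this]
  refine (measure_iUnion_le _).trans_lt ?_
  refine (ENNReal.tsum_le_tsum D.measure_component_le).trans_lt ?_
  rw [ENNReal.tsum_mul_right, ENNReal.tsum_geometric]
  refine ENNReal.mul_lt_top ?_ ENNReal.ofReal_lt_top
  simp⟩

theorem weight_pos (x : D.Point) : 0 < D.weight x := ENNReal.ofReal_pos.2 (D.term_pos x.1 x.2)

/-- The composite test space. -/
noncomputable def space : MetricMeasureSpace where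
  carrier := D.Point
  μ := D.measure
  nonempty := let ⟨x⟩ := D.point_nonempty 0; ⟨⟨0, x⟩⟩
  bounded := Metric.isBounded_iff.2 ⟨1, fun x _ y _ => D.dist_le_one x y⟩
  measure_finite := measure_lt_top _ _
  ball_pos := fun x s hs => by
    refine (D.weight_pos x).trans_le ?_
    rw [← D.measure_singleton]
    exact measure_mono (singleton_subset_iff.2 (Metric.mem_ball_self hs))

/-- A ball of radius `1` is a component and a ball of radius `2` the whole space, while the
component masses tend to `0`. -/
theorem not_isDoubling_space : ¬ D.space.IsDoubling := by
  rintro ⟨C, hC⟩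
  have hb : ∀ n, D.measure univ ≤ C * (2⁻¹ ^ n * ENNReal.ofReal (D.total 0)) := fun n => by
    obtain ⟨x⟩ := D.point_nonempty n
    have h : D.measure (Metric.ball (⟨n, x⟩ : D.Point) (2 * 1)) ≤
      C * D.measure (Metric.ball (⟨n, x⟩ : D.Point) 1) := hC ⟨n, x⟩ 1 one_pos
    rw [D.ball_of_one_lt (by norm_num), D.ball_of_le_one (by norm_num) le_rfl] at h
    refine h.trans ?_
    gcongr
    exact D.measure_component_le n
  have hlim : Filter.Tendsto (fun n : ℕ => (C : ℝ≥0∞) * (2⁻¹ ^ n * ENNReal.ofReal (D.total 0)))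
      Filter.atTop (nhds (C * (0 * ENNReal.ofReal (D.total 0)))) := by
    refine ENNReal.Tendsto.const_mul (ENNReal.Tendsto.mul_const ?_ (Or.inr ENNReal.ofReal_ne_top))
      (Or.inr ENNReal.coe_ne_top)
    exact ENNReal.tendsto_pow_atTop_nhds_zero_of_lt_one ENNReal.one_half_lt_one
  have h0 : D.measure univ ≤ 0 := by
    have := ge_of_tendsto' hlim hb
    simpa using this
  obtain ⟨x⟩ := D.point_nonempty 0
  have h1 : D.weight ⟨0, x⟩ ≤ D.measure univ := by
    rw [← D.measure_singleton]
    exact measure_mono (subset_univ _)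
  exact absurd (h1.trans h0) (not_le.2 (D.weight_pos _))

theorem isCompositeTestSpace_space : D.space.IsCompositeTestSpace p :=
  ⟨D.U, fun _ => 3⁻¹, D.b, D.pointEquiv, fun _ => by norm_num, D.b_pos,
    fun n x y => by linarith [(D.U n).rho_le_two x y], D.separated, D.dist_same,
    fun _ _ h => D.dist_ne h, fun n x => D.measure_singleton ⟨n, x⟩⟩

/-- The level of a point. -/
def level (x : D.Point) : Σ n, (D.U n).Level := ⟨x.1, (D.U x.1).level x.2⟩

/-- The mass of each point of a level. -/
noncomputable def levelWeight (l : Σ n, (D.U n).Level) : ℝ≥0∞ :=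
  ENNReal.ofReal (D.b l.1 * (D.U l.1).levelMass l.2)

theorem weight_eq (x : D.Point) : D.weight x = D.levelWeight (D.level x) := by
  rw [weight, TypeIII.mass_eq_levelMass]
  rfl

/-- The points of a level. -/
def levelPoint (l : Σ n, (D.U n).Level) (j : Fin ((D.U l.1).levelCard l.2)) : D.Point :=
  ⟨l.1, (D.U l.1).levelPoint l.2 j⟩

theorem levelPoint_injective (l : Σ n, (D.U n).Level) : Function.Injective (D.levelPoint l) :=
  fun _ _ h => (D.U l.1).levelPoint_injective l.2 (eq_of_heq (Point.mk.inj h).2)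

theorem level_levelPoint (l : Σ n, (D.U n).Level) (j : Fin ((D.U l.1).levelCard l.2)) :
    D.level (D.levelPoint l j) = l := by
  obtain ⟨n, l⟩ := l
  simp only [level, levelPoint, TypeIII.level_levelPoint]

theorem exists_levelPoint (x : D.Point) : ∃ j, D.levelPoint (D.level x) j = x := by
  obtain ⟨n, x⟩ := x
  obtain ⟨j, hj⟩ := (D.U n).exists_levelPoint x
  exact ⟨j, congrArg (Point.mk n) hj⟩

theorem measure_level_inter (l : Σ n, (D.U n).Level) (P : D.Point → Prop) :
    D.measure ({x | P x} ∩ {x | D.level x = l}) =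
      Measure.count {j | P (D.levelPoint l j)} * D.levelWeight l := by
  classical
  have hr : {x | P x} ∩ {x | D.level x = l} =
      range fun j : {j // P (D.levelPoint l j)} => D.levelPoint l j := by
    ext x
    constructor
    · rintro ⟨hx, rfl⟩
      obtain ⟨j, hj⟩ := D.exists_levelPoint x
      exact ⟨⟨j, by rw [hj]; exact hx⟩, hj⟩
    · rintro ⟨⟨j, hj⟩, rfl⟩
      exact ⟨hj, D.level_levelPoint l j⟩
  rw [hr, D.measure_range fun i j h => Subtype.ext (D.levelPoint_injective l h)]
  simp only [weight_eq, level_levelPoint]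
  rw [tsum_fintype, Finset.sum_const, nsmul_eq_mul, Finset.card_univ, Fintype.card_subtype,
    count_setOf_fin]

theorem measure_level (l : Σ n, (D.U n).Level) :
    D.measure {x | D.level x = l} = (D.U l.1).levelCard l.2 * D.levelWeight l := by
  have h := D.measure_level_inter l fun _ => True
  simpa using h

theorem component_lacunary : IsLacunaryPartition D.measure fun n => {x : D.Point | x.1 = n} where
  measurable _ := MeasurableSet.of_discrete
  cover := by
    ext x
    simp
  disjoint _ _ h := disjoint_left.2 fun _ hx hy => h (hx.symm.trans hy)
  separated n k h := by
    have key : ∀ n k, n < k → ∀ x ∈ {x : D.Point | x.1 = n},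
        2 * D.measure {x | x.1 = k} ≤ D.measure {x} := by
      rintro n k hnk ⟨_, x⟩ rfl
      rw [measure_singleton, measure_component, ← ENNReal.ofReal_ofNat,
        ← ENNReal.ofReal_mul (by norm_num)]
      exact ENNReal.ofReal_le_ofReal (D.two_mul_total_le hnk x)
    rcases lt_or_gt_of_ne h with h | h
    · exact Or.inl (key n k h)
    · exact Or.inr (key k n h)

theorem level_lacunary : IsLacunaryPartition D.measure fun l => {x : D.Point | D.level x = l} where
  measurable _ := MeasurableSet.of_discrete
  cover := by
    ext x
    simp
  disjoint _ _ h := disjoint_left.2 fun _ hx hy => h (hx.symm.trans hy)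
  separated := by
    rintro ⟨n, l⟩ ⟨k, l'⟩ h
    by_cases hnk : n = k
    · subst hnk
      have hll : l ≠ l' := fun e => h (by rw [e])
      have key : ∀ l l' : (D.U n).Level,
          2 * ((D.U n).levelCard l' * (D.U n).levelMass l') ≤ (D.U n).levelMass l →
          ∀ x ∈ {x | D.level x = ⟨n, l⟩}, 2 * D.measure {x | D.level x = ⟨n, l'⟩} ≤
            D.measure {x} := by
        intro l l' h x hx
        rw [measure_singleton, weight_eq, show D.level x = _ from hx, measure_level, levelWeight,
          levelWeight, ← ENNReal.ofReal_ofNat, ← ENNReal.ofReal_natCast,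
          ← ENNReal.ofReal_mul (by positivity), ← ENNReal.ofReal_mul (by norm_num)]
        refine ENNReal.ofReal_le_ofReal ?_
        have := mul_le_mul_of_nonneg_left h (D.b_pos n).le
        dsimp only
        linarith
      exact ((D.U n).level_separated hll).imp (key l l') (key l' l)
    · have hsub : ∀ (n : ℕ) (l : (D.U n).Level),
          {x | D.level x = ⟨n, l⟩} ⊆ {x : D.Point | x.1 = n} := fun n l x hx =>
        congrArg Sigma.fst (show D.level x = _ from hx)
      refine (D.component_lacunary.separated n k hnk).imp (fun H x hx => ?_) fun H x hx => ?_
      · exact (mul_le_mul_right (measure_mono (hsub k l')) 2).trans (H x (hsub n l hx))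
      · exact (mul_le_mul_right (measure_mono (hsub n l)) 2).trans (H x (hsub k l' hx))

end CompositeData

/-! ### Pointwise estimate of the maximal function. -/

/-- The constant in the estimate of averages by the weak Lorentz norm. -/
noncomputable def averageConst (θ : ℝ) : ℝ≥0∞ := 8 * geomConst (1 - θ) * geomConst θ

theorem averageConst_ne_top {θ : ℝ} (h0 : 0 < θ) (h1 : θ < 1) : averageConst θ ≠ ∞ := by
  have := geomConst_ne_top h0
  have := geomConst_ne_top (sub_pos.2 h1)
  unfold averageConst
  finiteness

namespace CompositeData

variable {p : ℝ} (D : CompositeData p)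

/-- The integral over `S` is at most a constant times `μ(S)^(1-θ)` times the weak norm; dividing by
`μ(S)` leaves `μ(S)^(-θ) ≤ A^(-θ)`. -/
theorem average_le {θ : ℝ} (hθ : 0 < θ) (hθ1 : θ < 1) (F : D.Point → ℝ≥0∞) {S R : Set D.Point}
    (hSR : S ⊆ R) {A : ℝ≥0∞} (hA0 : A ≠ 0) (hA : A ≤ D.measure S) :
    (∫⁻ y in S, F y ∂D.measure) / D.measure S ≤
      averageConst θ * (A ^ (-θ) * dyadicNorm θ ∞ (D.measure.restrict R) F) := by
  have hS0 : D.measure S ≠ 0 := ((pos_iff_ne_zero.2 hA0).trans_le hA).ne'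
  have hSt : D.measure S ≠ ∞ := measure_ne_top _ _
  have h := lintegral_le_dyadicNorm (μ := D.measure.restrict S) hθ hθ1 (g := F)
    (Measurable.of_discrete)
  rw [Measure.restrict_apply_univ, ← averageConst] at h
  refine ENNReal.div_le_of_le_mul (h.trans ?_)
  have e : D.measure S ^ (1 - θ) = D.measure S ^ (-θ) * D.measure S := by
    conv_rhs => rw [← ENNReal.rpow_one (D.measure S), ← ENNReal.rpow_mul, one_mul]
    rw [← ENNReal.rpow_add _ _ hS0 hSt, neg_add_eq_sub]
  rw [e]
  calc averageConst θ * (D.measure S ^ (-θ) * D.measure S) *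
        dyadicNorm θ ∞ (D.measure.restrict S) F
      = averageConst θ * (D.measure S ^ (-θ) * dyadicNorm θ ∞ (D.measure.restrict S) F) *
        D.measure S := by ring
    _ ≤ _ := by
        gcongr averageConst θ * (?_ * ?_) * _
        · rw [ENNReal.rpow_neg, ENNReal.rpow_neg]
          gcongr
        · exact dyadicNorm_mono_measure hθ.le (Measure.restrict_mono hSR le_rfl) F

/-- The centered maximal function of a function with values in `[0, ∞]`. -/
noncomputable def maximal (F : D.Point → ℝ≥0∞) (x : D.Point) : ℝ≥0∞ :=
  ⨆ (s : ℝ) (_ : 0 < s), (∫⁻ y in Metric.ball x s, F y ∂D.measure) / D.measure (Metric.ball x s)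

theorem maximal_space (f : D.Point → ℂ) :
    D.space.maximal f = D.maximal fun y => ‖f y‖ₑ := rfl

/-- A lower point. -/
def lowerPoint (n : ℕ) (i : Fin (D.U n).N) (j : Fin ((D.U n).h i)) : D.Point := ⟨n, .inl ⟨i, j⟩⟩

/-- An upper point. -/
def upperPoint (n : ℕ) (k : Fin (D.U n).M) (l : Fin ((D.U n).upperCard k)) : D.Point :=
  ⟨n, .inr ⟨k, l⟩⟩

/-- The lower point of type `i` at distance less than `2 / 3` from a given upper point. -/
def neighbor (n : ℕ) (k : Fin (D.U n).M) (l : Fin ((D.U n).upperCard k)) (i : Fin (D.U n).N) :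
    D.Point := D.lowerPoint n i ((D.U n).block i k l)

theorem weight_lowerPoint (n : ℕ) (i : Fin (D.U n).N) (j : Fin ((D.U n).h i)) :
    D.weight (D.lowerPoint n i j) = ENNReal.ofReal (D.b n * (D.U n).m i) := rfl

theorem weight_upperPoint (n : ℕ) (k : Fin (D.U n).M) (l : Fin ((D.U n).upperCard k)) :
    D.weight (D.upperPoint n k l) = ENNReal.ofReal (D.b n * ((D.U n).K * (D.U n).α k)) := rfl

theorem weight_ne_top (x : D.Point) : D.weight x ≠ ∞ := ENNReal.ofReal_ne_top

theorem neighbor_injective (n : ℕ) (k : Fin (D.U n).M) (l : Fin ((D.U n).upperCard k)) :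
    Function.Injective (D.neighbor n k l) := fun i i' h => by
  have h1 := eq_of_heq (Point.mk.inj h).2
  exact congrArg Sigma.fst (Sum.inl_injective h1)

theorem ball_upperPoint {s : ℝ} (hs : 1 / 3 < s) (hs' : s ≤ 2 / 3) (n : ℕ) (k : Fin (D.U n).M)
    (l : Fin ((D.U n).upperCard k)) :
    Metric.ball (D.upperPoint n k l) s =
      {D.upperPoint n k l} ∪ ⋃ i, {D.neighbor n k l i} := by
  ext y
  rw [upperPoint, D.mem_ball_of_le_two_thirds hs hs']
  simp only [mem_union, mem_singleton_iff, mem_iUnion]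
  constructor
  · rintro ⟨z, rfl, hz⟩
    rcases z with ⟨i, j⟩ | z
    · right
      refine ⟨i, ?_⟩
      simp only [TypeIII.rho] at hz
      split_ifs at hz with hl
      · rw [TypeIII.linked_iff] at hl
        rw [hl]
        rfl
      · exact absurd hz (lt_irrefl _)
    · left
      simp only [TypeIII.rho] at hz
      split_ifs at hz with hl
      · rw [hl]
      · exact absurd hz (lt_irrefl _)
  · rintro (rfl | ⟨i, rfl⟩)
    · refine ⟨_, rfl, ?_⟩
      rw [TypeIII.rho_self]
      norm_num
    · refine ⟨_, rfl, ?_⟩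
      simp only [TypeIII.rho]
      rw [if_pos ((D.U n).linked_iff i _ k l |>.2 rfl)]
      norm_num

theorem exists_upperPoint_mem_ball {s : ℝ} (hs : 1 / 3 < s) (hs' : s ≤ 2 / 3) (n : ℕ)
    (i : Fin (D.U n).N) (j : Fin ((D.U n).h i)) (k : Fin (D.U n).M) :
    ∃ l, D.upperPoint n k l ∈ Metric.ball (D.lowerPoint n i j) s := by
  obtain ⟨l, hl⟩ := (D.U n).exists_linked i j k
  refine ⟨l, ?_⟩
  rw [lowerPoint, D.mem_ball_of_le_two_thirds hs hs']
  refine ⟨_, rfl, ?_⟩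
  simp only [TypeIII.rho]
  rw [if_pos hl]
  norm_num

/-- The set of the points of the `n`-th component. -/
def component (n : ℕ) : Set D.Point := {x | x.idx = n}

/-- The set of the lower points of the `n`-th component. -/
def lower (n : ℕ) : Set D.Point := {x | x.idx = n ∧ x.pt.isLeft}

theorem lower_subset_component (n : ℕ) : D.lower n ⊆ D.component n := fun _ hx => hx.1

theorem measure_ne_zero_of_mem {S : Set D.Point} {x : D.Point} (hx : x ∈ S) :
    D.measure S ≠ 0 := by
  refine ((D.weight_pos x).trans_le ?_).ne'
  rw [← D.measure_singleton]
  exact measure_mono (singleton_subset_iff.2 hx)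

theorem lower_nonempty (n : ℕ) : (D.lower n).Nonempty :=
  ⟨D.lowerPoint n ⟨0, (D.U n).N_pos⟩ ⟨0, (D.U n).h_pos 0 (D.U n).N_pos⟩, rfl, rfl⟩

theorem component_nonempty (n : ℕ) : (D.component n).Nonempty :=
  (D.lower_nonempty n).mono (D.lower_subset_component n)

/-- This makes a ball of intermediate radius about a lower point heavier than the whole lower part,
and one about an upper point at most twice as heavy as its center. -/
theorem measure_lower_le (n : ℕ) (k : Fin (D.U n).M) (l : Fin ((D.U n).upperCard k)) :
    D.measure (D.lower n) ≤ D.weight (D.upperPoint n k l) := by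
  have hsub : D.lower n ⊆ ⋃ i : Fin (D.U n).N, {x | D.level x = ⟨n, .inl i⟩} := by
    rintro ⟨k, x⟩ ⟨hk, hx⟩
    obtain rfl : k = n := hk
    rcases x with x | x
    · exact mem_iUnion.2 ⟨x.1, rfl⟩
    · simp at hx
  refine (measure_mono hsub).trans ((measure_iUnion_le _).trans ?_)
  have hb := (D.b_pos n).le
  have e : ∀ i : Fin (D.U n).N, D.measure {x | D.level x = ⟨n, .inl i⟩} =
      ENNReal.ofReal (D.b n * ((D.U n).m i * (D.U n).h i)) := fun i => by
    rw [measure_level, levelWeight, ← ENNReal.ofReal_natCast, ← ENNReal.ofReal_mul (by positivity)]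
    congr 1
    simp only [TypeIII.levelCard, TypeIII.levelMass]
    ring
  simp only [e]
  rw [tsum_fintype, ← ENNReal.ofReal_sum_of_nonneg fun i _ => by positivity, ← Finset.mul_sum,
    weight_upperPoint]
  refine ENNReal.ofReal_le_ofReal (mul_le_mul_of_nonneg_left ?_ hb)
  have h1 : ∑ i : Fin (D.U n).N, ((D.U n).m i * (D.U n).h i : ℝ) ≤ (D.U n).α k := by
    have := (D.U n).sum_m_mul_h_le_α.trans ((D.U n).α_zero_le k.2)
    rw [Finset.sum_range] at this
    exact_mod_cast this
  have h2 := (D.U n).one_le_K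
  nlinarith [(Nat.cast_nonneg ((D.U n).α k) : (0 : ℝ) ≤ _)]

/-- The sum of the contributions of the lower neighbors to the averages over the balls of
intermediate radius centered at an upper point. -/
noncomputable def neighborSum (F : D.Point → ℝ≥0∞) : D.Point → ℝ≥0∞
  | ⟨_, .inl _⟩ => 0
  | ⟨n, .inr ⟨k, l⟩⟩ => ∑ i : Fin (D.U n).N,
      ENNReal.ofReal ((D.U n).m i / ((D.U n).K * (D.U n).α k)) * F (D.neighbor n k l i)

theorem K_mul_α_pos (n : ℕ) (k : Fin (D.U n).M) : 0 < (D.U n).K * (D.U n).α k := by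
  have := (D.U n).one_le_K
  have : (0 : ℝ) < (D.U n).α k := by exact_mod_cast (D.U n).α_pos k k.2
  positivity

theorem setLIntegral_singleton (F : D.Point → ℝ≥0∞) (x : D.Point) :
    ∫⁻ y in {x}, F y ∂D.measure = F x * D.weight x := by
  rw [lintegral_singleton, measure_singleton]

theorem average_ball_upperPoint_le (F : D.Point → ℝ≥0∞) {s : ℝ} (hs : 1 / 3 < s) (hs' : s ≤ 2 / 3)
    (n : ℕ) (k : Fin (D.U n).M) (l : Fin ((D.U n).upperCard k)) :
    (∫⁻ y in Metric.ball (D.upperPoint n k l) s, F y ∂D.measure) /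
      D.measure (Metric.ball (D.upperPoint n k l) s) ≤
      F (D.upperPoint n k l) + D.neighborSum F (D.upperPoint n k l) := by
  set x := D.upperPoint n k l with hx
  have hle : D.weight x ≤ D.measure (Metric.ball x s) := by
    rw [← measure_singleton]
    exact measure_mono (singleton_subset_iff.2 (Metric.mem_ball_self (by linarith)))
  refine (ENNReal.div_le_div_left hle _).trans (ENNReal.div_le_of_le_mul ?_)
  rw [hx, D.ball_upperPoint hs hs', ← hx]
  refine (lintegral_union_le _ _ _).trans ?_
  rw [add_mul]
  refine add_le_add (D.setLIntegral_singleton F x).le ((lintegral_iUnion_le _ _).trans ?_)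
  rw [tsum_fintype]
  simp only [setLIntegral_singleton]
  rw [hx, upperPoint, neighborSum, ← upperPoint, Finset.sum_mul]
  refine Finset.sum_le_sum fun i _ => ?_
  have hpos := D.K_mul_α_pos n k
  have e : D.b n * (D.U n).m i = (D.U n).m i / ((D.U n).K * (D.U n).α k) *
      (D.b n * ((D.U n).K * (D.U n).α k)) := by
    rw [mul_left_comm, div_mul_cancel₀ _ hpos.ne']
  rw [neighbor, weight_lowerPoint, weight_upperPoint, mul_right_comm,
    ← ENNReal.ofReal_mul (by positivity), ← e, mul_comm]

/-- A function constant on each of the sets `E n`. -/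
noncomputable def blockConst (θ : ℝ) (F : D.Point → ℝ≥0∞) (E : ℕ → Set D.Point) (x : D.Point) :
    ℝ≥0∞ :=
  (E x.idx).indicator (fun _ => averageConst θ * (D.measure (E x.idx) ^ (-θ) *
    dyadicNorm θ ∞ (D.measure.restrict (D.component x.idx)) F)) x

/-- The four ranges of the radius give singletons, neighborhoods, components and the whole space. In
the second range, lower centers yield the term on `D.lower`, while upper centers yield `neighborSum`
and a further copy of `F x`. -/
theorem maximal_le {θ : ℝ} (hθ : 0 < θ) (hθ1 : θ < 1) (F : D.Point → ℝ≥0∞) (x : D.Point) :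
    D.maximal F x ≤ F x + averageConst θ * (D.measure univ ^ (-θ) * dyadicNorm θ ∞ D.measure F) +
      D.blockConst θ F D.lower x + D.blockConst θ F D.component x + D.neighborSum F x := by
  refine iSup₂_le fun s hs => ?_
  rcases le_or_gt s (1 / 3) with h1 | h1
  · rw [D.ball_of_le_third hs h1, setLIntegral_singleton, measure_singleton,
      ENNReal.mul_div_cancel_right (D.weight_pos x).ne' (D.weight_ne_top x)]
    simp only [add_assoc]
    exact le_self_add
  rcases le_or_gt s (2 / 3) with h2 | h2
  · obtain ⟨n, x⟩ := x
    rcases x with ⟨i, j⟩ | ⟨k, l⟩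
    · obtain ⟨l, hl⟩ := D.exists_upperPoint_mem_ball h1 h2 n i j ⟨0, (D.U n).M_pos⟩
      have hA : D.measure (D.lower n) ≤ D.measure (Metric.ball (D.lowerPoint n i j) s) := by
        refine (D.measure_lower_le n _ l).trans ?_
        rw [← measure_singleton]
        exact measure_mono (singleton_subset_iff.2 hl)
      have hsub : Metric.ball (D.lowerPoint n i j) s ⊆ D.component n := by
        refine (Metric.ball_subset_ball (by linarith : s ≤ 1)).trans ?_
        rw [D.ball_of_le_one (by norm_num) le_rfl]
        rfl
      obtain ⟨y, hy⟩ := D.lower_nonempty n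
      have h := D.average_le hθ hθ1 F hsub (D.measure_ne_zero_of_mem hy) hA
      have e : D.blockConst θ F D.lower ⟨n, .inl ⟨i, j⟩⟩ = averageConst θ *
          (D.measure (D.lower n) ^ (-θ) * dyadicNorm θ ∞ (D.measure.restrict (D.component n)) F) :=
        indicator_of_mem (show (⟨n, .inl ⟨i, j⟩⟩ : D.Point) ∈ D.lower n from ⟨rfl, rfl⟩) _
      refine h.trans ?_
      rw [e, add_assoc (_ + _), add_comm (_ + _)]
      exact le_add_self.trans le_add_self
    · refine (D.average_ball_upperPoint_le F h1 h2 n k l).trans ?_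
      rw [add_assoc, add_assoc, add_assoc]
      refine add_le_add le_rfl ?_
      rw [← add_assoc, ← add_assoc]
      exact le_add_self
  rcases le_or_gt s 1 with h3 | h3
  · obtain ⟨y, hy⟩ := D.component_nonempty x.idx
    have h := D.average_le hθ hθ1 F (subset_refl (D.component x.idx))
      (D.measure_ne_zero_of_mem hy) le_rfl
    rw [D.ball_of_le_one h2 h3]
    have e : D.blockConst θ F D.component x = averageConst θ *
        (D.measure (D.component x.idx) ^ (-θ) *
          dyadicNorm θ ∞ (D.measure.restrict (D.component x.idx)) F) :=
      indicator_of_mem (show x ∈ D.component x.idx from rfl) _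
    refine h.trans ?_
    rw [e, add_right_comm]
    exact le_add_self
  · obtain ⟨y, hy⟩ := D.component_nonempty 0
    have h := D.average_le hθ hθ1 F (subset_refl univ)
      (D.measure_ne_zero_of_mem (mem_univ y)) le_rfl
    rw [D.ball_of_one_lt h3]
    refine h.trans ?_
    rw [Measure.restrict_univ, add_comm (F x), add_assoc, add_assoc, add_assoc]
    exact le_self_add

end CompositeData

/-! ### Consequences of the balance conditions. -/

/-- With `mul_rpow_le_of_lt_two`: if `m^(1-p) h ≈ 1`, then `h` points of mass `m` have total mass
about `m^p`. -/
theorem le_mul_rpow_of_one_le {p m h : ℝ} (hp : 0 < p) (hm : 0 < m) (h1 : 1 ≤ m ^ (1 - p) * h) :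
    m ≤ (h * m) ^ (1 / p) := by
  have h2 : m ^ p ≤ h * m := by
    calc m ^ p ≤ m ^ p * (m ^ (1 - p) * h) := le_mul_of_one_le_right (by positivity) h1
      _ = h * m := by
          rw [← mul_assoc, ← Real.rpow_add hm, add_sub_cancel, Real.rpow_one, mul_comm]
  calc m = (m ^ p) ^ (1 / p) := by
        rw [← Real.rpow_mul hm.le, mul_one_div_cancel hp.ne', Real.rpow_one]
    _ ≤ _ := by gcongr

theorem mul_rpow_le_of_lt_two {p m h : ℝ} (hp : 0 < p) (hm : 0 < m) (hh : 0 ≤ h)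
    (h1 : m ^ (1 - p) * h < 2) : (h * m) ^ (1 / p) ≤ 2 ^ (1 / p) * m := by
  have h2 : h * m ≤ 2 * m ^ p := by
    calc h * m = m ^ p * (m ^ (1 - p) * h) := by
          rw [← mul_assoc, ← Real.rpow_add hm, add_sub_cancel, Real.rpow_one, mul_comm]
      _ ≤ m ^ p * 2 := by gcongr
      _ = 2 * m ^ p := mul_comm _ _
  calc (h * m) ^ (1 / p) ≤ (2 * m ^ p) ^ (1 / p) := by gcongr
    _ = 2 ^ (1 / p) * m := by
        rw [Real.mul_rpow (by norm_num) (by positivity), ← Real.rpow_mul hm.le,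
          mul_one_div_cancel hp.ne', Real.rpow_one]

namespace TypeIII

variable {p : ℝ} (U : TypeIII p)

/-- The factor by which the operator norm of the maximal operator depends on `K` and `L`. -/
noncomputable def gain : ℝ := (U.K * U.L) ^ (1 / p) / U.K

theorem K_mul_L_pos : 0 < U.K * U.L := by
  have := U.one_le_K
  have : (0 : ℝ) < U.L := by exact_mod_cast U.L_pos
  positivity

theorem m_le_rpow (hp : 0 < p) (i : Fin U.N) : (U.m i : ℝ) ≤ (U.h i * U.m i) ^ (1 / p) :=
  le_mul_rpow_of_one_le hp (by exact_mod_cast U.m_pos i i.2) (U.m_balance i i.2).1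

theorem rpow_le_m (hp : 0 < p) (i : Fin U.N) :
    ((U.h i : ℝ) * U.m i) ^ (1 / p) ≤ 2 ^ (1 / p) * U.m i :=
  mul_rpow_le_of_lt_two hp (by exact_mod_cast U.m_pos i i.2) (by positivity) (U.m_balance i i.2).2

theorem upper_rpow (k : Fin U.M) : ((U.upperCard k : ℝ) * (U.K * U.α k)) ^ (1 / p) =
    (U.K * U.L) ^ (1 / p) * ((U.β k * U.h (U.N - 1)) * U.α k) ^ (1 / p) := by
  rw [← Real.mul_rpow U.K_mul_L_pos.le (by positivity), upperCard]
  congr 1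
  push_cast
  ring

theorem α_le_rpow (hp : 0 < p) (k : Fin U.M) :
    (U.K * U.L) ^ (1 / p) * U.α k ≤ ((U.upperCard k : ℝ) * (U.K * U.α k)) ^ (1 / p) := by
  have := U.K_mul_L_pos
  rw [upper_rpow]
  gcongr
  exact le_mul_rpow_of_one_le hp (by exact_mod_cast U.α_pos k k.2)
    (by have := (U.α_balance k k.2).1; rwa [mul_assoc] at this)

theorem rpow_le_α (hp : 0 < p) (k : Fin U.M) :
    ((U.upperCard k : ℝ) * (U.K * U.α k)) ^ (1 / p) ≤
      (U.K * U.L) ^ (1 / p) * (2 ^ (1 / p) * U.α k) := by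
  have := U.K_mul_L_pos
  rw [upper_rpow]
  gcongr
  exact mul_rpow_le_of_lt_two hp (by exact_mod_cast U.α_pos k k.2) (by positivity)
    (by have := (U.α_balance k k.2).2; rwa [mul_assoc] at this)

end TypeIII

/-! ### Norm estimates for the terms of the pointwise bound. -/

namespace CompositeData

variable {p : ℝ} (D : CompositeData p) {q r : ℝ≥0∞}

theorem measure_level_rpow (hp : 0 < p) (l : Σ n, (D.U n).Level) :
    D.measure {x | D.level x = l} ^ (1 / p) = ENNReal.ofReal (D.b l.1 ^ (1 / p) *
      ((D.U l.1).levelCard l.2 * (D.U l.1).levelMass l.2) ^ (1 / p)) := by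
  have h1 := D.b_pos l.1
  have h2 := (D.U l.1).levelMass_pos l.2
  rw [measure_level, levelWeight, ← ENNReal.ofReal_natCast, ← ENNReal.ofReal_mul (by positivity),
    ENNReal.ofReal_rpow_of_nonneg (by positivity) (by positivity),
    ← Real.mul_rpow h1.le (by positivity)]
  congr 2
  ring

/-- On each component the constant is normalized by `μ(E n)^(-θ)`, so its norm is controlled by that
of `F` there; the components are summed by lacunarity and `ℓ^q ⊆ ℓ^r`. -/
theorem dyadicNorm_blockConst_le {θ : ℝ} (hθ : 0 < θ) (hq : 1 ≤ q) (hqr : q ≤ r)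
    (F : D.Point → ℝ≥0∞) {E : ℕ → Set D.Point}
    (hE0 : ∀ n, (E n).Nonempty) :
    dyadicNorm θ r D.measure (D.blockConst θ F E) ≤ lacunaryConst 1 ^ θ *
      (geomConst 1 * averageConst θ * (lacunaryConst θ * dyadicNorm θ q D.measure F)) := by
  have hr := hq.trans hqr
  refine (D.component_lacunary.dyadicNorm_le hθ hr _).trans ?_
  gcongr
  have hterm : ∀ n, dyadicNorm θ r (D.measure.restrict {x | x.idx = n}) (D.blockConst θ F E) ≤
      geomConst 1 * averageConst θ *
        dyadicNorm θ q (D.measure.restrict {x : D.Point | x.idx = n}) F := fun n => by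
    have h := dyadicNorm_restrict_le (μ := D.measure) hθ hr (g := D.blockConst θ F E)
      (S := {x | x.idx = n}) (E := E n) (c := averageConst θ * (D.measure (E n) ^ (-θ) *
        dyadicNorm θ ∞ (D.measure.restrict (D.component n)) F)) MeasurableSet.of_discrete
      (fun x hx _ => by
        obtain rfl : x.idx = n := hx
        exact indicator_le_self _ _ _)
      (fun x hx hxE => by
        obtain rfl : x.idx = n := hx
        exact indicator_of_notMem hxE _)
    refine h.trans ?_
    obtain ⟨y, hy⟩ := hE0 n
    have e : D.measure (E n) ^ (-θ) * D.measure (E n) ^ θ = 1 := by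
      rw [← ENNReal.rpow_add _ _ (D.measure_ne_zero_of_mem hy) (measure_ne_top _ _)]
      simp
    calc _ = geomConst 1 * averageConst θ * ((D.measure (E n) ^ (-θ) * D.measure (E n) ^ θ) *
          dyadicNorm θ ∞ (D.measure.restrict (D.component n)) F) := by ring
      _ ≤ _ := by
          rw [e, one_mul]
          gcongr
          exact dyadicNorm_anti hq le_top F
  refine (lq_mono r hterm).trans ?_
  rw [lq_const_mul hr]
  gcongr
  exact (lq_anti hq hqr _).trans (D.component_lacunary.lq_dyadicNorm_le hθ hq F)

/-- As `l` varies, each lower point of type `i` occurs at most `blockCard` times, so the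
distribution function is at most multiplied by that number. -/
theorem dyadicNorm_neighbor_le (hp : 1 < p) (hq : 1 ≤ q) (F : D.Point → ℝ≥0∞) (n : ℕ)
    (k : Fin (D.U n).M) (i : Fin (D.U n).N) :
    dyadicNorm (1 / p) q Measure.count (fun l : Fin ((D.U n).upperCard k) =>
      ENNReal.ofReal ((D.U n).m i / ((D.U n).K * (D.U n).α k)) * F (D.neighbor n k l i)) ≤
    2 * ENNReal.ofReal ((D.U n).m i / ((D.U n).K * (D.U n).α k)) *
      ENNReal.ofReal ((D.U n).blockCard i k / (D.b n * (D.U n).m i)) ^ (1 / p) *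
        dyadicNorm (1 / p) q (D.measure.restrict {x | D.level x = ⟨n, .inl i⟩}) F := by
  have hb := D.b_pos n
  have hm : (0 : ℝ) < (D.U n).m i := by exact_mod_cast (D.U n).m_pos i i.2
  have hc := div_pos hm (D.K_mul_α_pos n k)
  refine dyadicNorm_le_of_dist_le (by positivity) hq (ENNReal.ofReal_pos.2 hc).ne'
    ENNReal.ofReal_ne_top fun t _ _ => ?_
  set c := ENNReal.ofReal ((D.U n).m i / ((D.U n).K * (D.U n).α k))
  rw [Measure.restrict_apply' MeasurableSet.of_discrete, measure_level_inter]
  have hcard := (D.U n).count_block_le i k fun j => t < c * F (D.lowerPoint n i j)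
  refine le_of_le_of_eq (b := ENNReal.ofReal ((D.U n).blockCard i k / (D.b n * (D.U n).m i)) *
        (Measure.count {j | t < c * F (D.lowerPoint n i j)} *
          ENNReal.ofReal (D.b n * (D.U n).m i))) ?_ rfl
  calc _ ≤ (((D.U n).blockCard i k : ℕ) : ℝ≥0∞) *
        Measure.count {j | t < c * F (D.lowerPoint n i j)} := hcard
    _ = ENNReal.ofReal ((D.U n).blockCard i k / (D.b n * (D.U n).m i)) *
        (Measure.count {j | t < c * F (D.lowerPoint n i j)} *
          ENNReal.ofReal (D.b n * (D.U n).m i)) := by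
        rw [mul_left_comm, ← ENNReal.ofReal_mul (by positivity), div_mul_cancel₀ _ (by positivity),
          ENNReal.ofReal_natCast, mul_comm]

theorem dyadicNorm_neighborSum_level_le (hp : 1 < p) (hq : 1 ≤ q) (F : D.Point → ℝ≥0∞) (n : ℕ)
    (k : Fin (D.U n).M) :
    dyadicNorm (1 / p) q (D.measure.restrict {x | D.level x = ⟨n, .inr k⟩}) (D.neighborSum F) ≤
      4 * triangleConst (1 / p) * 2 ^ (1 / p) * ENNReal.ofReal (D.U n).gain *
        ∑ i, dyadicNorm (1 / p) q (D.measure.restrict {x | D.level x = ⟨n, .inl i⟩}) F := by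
  have hp0 : 0 < p := by linarith
  have hθ : 0 < 1 / p := by positivity
  have hb := D.b_pos n
  have hKα := D.K_mul_α_pos n k
  set w := ENNReal.ofReal (D.b n * ((D.U n).K * (D.U n).α k)) with hw
  have h1 : dyadicNorm (1 / p) q (D.measure.restrict {x | D.level x = ⟨n, .inr k⟩})
      (D.neighborSum F) ≤ 2 * 1 * w ^ (1 / p) * dyadicNorm (1 / p) q Measure.count
        fun l : Fin ((D.U n).upperCard k) => ∑ i : Fin (D.U n).N,
          ENNReal.ofReal ((D.U n).m i / ((D.U n).K * (D.U n).α k)) * F (D.neighbor n k l i) := by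
    refine dyadicNorm_le_of_dist_le hθ.le hq one_ne_zero ENNReal.one_ne_top fun t _ _ => ?_
    rw [Measure.restrict_apply' MeasurableSet.of_discrete, measure_level_inter, mul_comm]
    simp only [one_mul]
    exact le_of_eq rfl
  have h2 := dyadicNorm_finset_sum_le (μ := (Measure.count : Measure (Fin ((D.U n).upperCard k))))
    hθ hq Finset.univ (f := fun (i : Fin (D.U n).N) l =>
      ENNReal.ofReal ((D.U n).m i / ((D.U n).K * (D.U n).α k)) * F (D.neighbor n k l i))
    fun i => Measurable.of_discrete
  refine h1.trans ((mul_le_mul_right h2 _).trans ?_)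
  rw [Finset.mul_sum, Finset.mul_sum, Finset.mul_sum]
  refine Finset.sum_le_sum fun i _ => ?_
  refine (mul_le_mul_right (mul_le_mul_right (D.dyadicNorm_neighbor_le hp hq F n k i) _) _).trans ?_
  have hm : (0 : ℝ) < (D.U n).m i := by exact_mod_cast (D.U n).m_pos i i.2
  have hh : (0 : ℝ) < (D.U n).h i := by exact_mod_cast (D.U n).h_pos i i.2
  -- The quotient of the measures of the two levels appears because `h_i · blockCard = upperCard`;
  -- balance replaces its power `1/p` by masses, `m_i` and `α_k` cancel, and `gain` remains.
  have key : w ^ (1 / p) * (ENNReal.ofReal ((D.U n).m i / ((D.U n).K * (D.U n).α k)) *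
      ENNReal.ofReal ((D.U n).blockCard i k / (D.b n * (D.U n).m i)) ^ (1 / p)) ≤
      2 ^ (1 / p) * ENNReal.ofReal (D.U n).gain := by
    have e2 : (2 : ℝ≥0∞) ^ (1 / p) = ENNReal.ofReal (2 ^ (1 / p)) := by
      rw [← ENNReal.ofReal_rpow_of_pos two_pos, ENNReal.ofReal_ofNat]
    rw [hw, e2, ENNReal.ofReal_rpow_of_nonneg (by positivity) hθ.le,
      ENNReal.ofReal_rpow_of_nonneg (by positivity) hθ.le, ← ENNReal.ofReal_mul (by positivity),
      ← ENNReal.ofReal_mul (by positivity), ← ENNReal.ofReal_mul (by positivity)]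
    refine ENNReal.ofReal_le_ofReal ?_
    have hbc : ((D.U n).h i : ℝ) * (D.U n).blockCard i k = (D.U n).upperCard k := by
      exact_mod_cast (D.U n).h_mul_blockCard i.2 k
    have e3 : (D.b n * ((D.U n).K * (D.U n).α k)) ^ (1 / p) *
        ((D.U n).blockCard i k / (D.b n * (D.U n).m i)) ^ (1 / p) =
        ((D.U n).upperCard k * ((D.U n).K * (D.U n).α k)) ^ (1 / p) /
          ((D.U n).h i * (D.U n).m i) ^ (1 / p) := by
      rw [← Real.mul_rpow (by positivity) (by positivity),
        ← Real.div_rpow (by positivity) (by positivity), ← hbc]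
      congr 1
      field_simp
    rw [mul_left_comm, e3]
    have h3 := (D.U n).m_le_rpow hp0 i
    have h4 := (D.U n).rpow_le_α hp0 k
    have hα : (0 : ℝ) < (D.U n).α k := by exact_mod_cast (D.U n).α_pos k k.2
    have hK : (0 : ℝ) < (D.U n).K := by linarith [(D.U n).one_le_K]
    calc _ ≤ (D.U n).m i / ((D.U n).K * (D.U n).α k) *
          (((D.U n).K * (D.U n).L) ^ (1 / p) * (2 ^ (1 / p) * (D.U n).α k) / (D.U n).m i) := by
          gcongr
      _ = _ := by
          rw [TypeIII.gain]
          field_simp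
  calc _ = 4 * triangleConst (1 / p) *
        (w ^ (1 / p) * (ENNReal.ofReal ((D.U n).m i / ((D.U n).K * (D.U n).α k)) *
          ENNReal.ofReal ((D.U n).blockCard i k / (D.b n * (D.U n).m i)) ^ (1 / p))) *
        dyadicNorm (1 / p) q (D.measure.restrict {x | D.level x = ⟨n, .inl i⟩}) F := by
        have : (4 : ℝ≥0∞) = 2 * 2 := by norm_num
        rw [this]
        ring
    _ ≤ 4 * triangleConst (1 / p) * (2 ^ (1 / p) * ENNReal.ofReal (D.U n).gain) *
        dyadicNorm (1 / p) q (D.measure.restrict {x | D.level x = ⟨n, .inl i⟩}) F := by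
        gcongr
    _ = _ := by ring

/-- The order of magnitude of the operator norm from `L^{p,q}` to `L^{p,r}` of the maximal operator
on the `n`-th component. -/
noncomputable def componentConst (q r : ℝ≥0∞) (n : ℕ) : ℝ≥0∞ :=
  ENNReal.ofReal (D.U n).gain * ((D.U n).N : ℝ≥0∞) ^ (1 - (q⁻¹).toReal) *
    ((D.U n).M : ℝ≥0∞) ^ (r⁻¹).toReal

/-- Hölder over the `N` lower levels gives one bound valid on each of the `M` upper levels; its
`ℓ^r` norm supplies `M^(1/r)`. Components are joined by `ℓ^q ⊆ ℓ^r`, the reason for `q ≤ r`. -/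
theorem dyadicNorm_neighborSum_le (hp : 1 < p) (hq : 1 ≤ q) (hqr : q ≤ r) {Q : ℝ≥0∞}
    (hQ : ∀ n, D.componentConst q r n ≤ Q) (F : D.Point → ℝ≥0∞) :
    dyadicNorm (1 / p) r D.measure (D.neighborSum F) ≤ lacunaryConst 1 ^ (1 / p) *
      (4 * triangleConst (1 / p) * 2 ^ (1 / p) * Q *
        (lacunaryConst (1 / p) * dyadicNorm (1 / p) q D.measure F)) := by
  have hr := hq.trans hqr
  have hp0 : 0 < p := by linarith
  have hθ : 0 < 1 / p := by positivity
  refine (D.level_lacunary.dyadicNorm_le hθ hr _).trans ?_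
  gcongr
  rw [lq_sigma hr]
  set R : (Σ n, (D.U n).Level) → ℝ≥0∞ := fun l =>
    dyadicNorm (1 / p) q (D.measure.restrict {x | D.level x = l}) F with hR
  set C := 4 * triangleConst (1 / p) * 2 ^ (1 / p) with hC
  have hterm : ∀ n, (lq r fun l : (D.U n).Level => dyadicNorm (1 / p) r
      (D.measure.restrict {x | D.level x = ⟨n, l⟩}) (D.neighborSum F)) ≤
      C * Q * lq q fun l => R ⟨n, l⟩ := by
    intro n
    have hinl : (lq q fun i => R ⟨n, .inl i⟩) ≤ lq q fun l => R ⟨n, l⟩ :=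
      lq_comp_le q Sum.inl_injective fun l => R ⟨n, l⟩
    refine (lq_comp_of_support_subset hr (f := Sum.inr) Sum.inr_injective _ ?_).trans ?_
    · rintro (i | k) hk
      · have h := dyadicNorm_restrict_le (μ := D.measure) hθ hr (g := D.neighborSum F)
          (S := {x | D.level x = ⟨n, .inl i⟩}) (E := ∅) (c := 0) MeasurableSet.of_discrete
          (by simp) (fun x hx _ => by
            obtain ⟨k, x | x⟩ := x
            · rfl
            · have hx' : D.level ⟨k, .inr x⟩ = ⟨n, .inl i⟩ := hx
              obtain rfl : k = n := congrArg Sigma.fst hx'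
              exact absurd (eq_of_heq (Sigma.mk.inj hx').2) Sum.inr_ne_inl)
        simpa using h
      · exact absurd ⟨k, rfl⟩ hk
    calc _ ≤ lq r fun _ : Fin (D.U n).M => C * ENNReal.ofReal (D.U n).gain *
          (((D.U n).N : ℝ≥0∞) ^ (1 - (q⁻¹).toReal) * lq q fun l => R ⟨n, l⟩) := by
          refine lq_mono r fun k => ?_
          refine (dyadicNorm_anti hq hqr _).trans ?_
          refine (D.dyadicNorm_neighborSum_level_le hp hq F n k).trans ?_
          gcongr
          refine (sum_le_card_rpow_mul_lq hq _ _).trans ?_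
          gcongr
      _ = C * D.componentConst q r n * lq q fun l => R ⟨n, l⟩ := by
          rw [lq_const_fin hr (D.U n).M_pos, componentConst]
          ring
      _ ≤ _ := by
          gcongr
          exact hQ n
  refine (lq_mono r hterm).trans ?_
  rw [lq_const_mul hr]
  gcongr
  refine (lq_anti hq hqr _).trans ?_
  rw [← lq_sigma hq]
  exact D.level_lacunary.lq_dyadicNorm_le hθ hq F

end CompositeData

/-! ### Finiteness of the best constant and its sharp test functions. -/

namespace CompositeData

variable {p : ℝ} (D : CompositeData p) {q r : ℝ≥0∞}

theorem exists_dyadicNorm_maximal_le (hp : 1 < p) (hq : 1 ≤ q) (hqr : q ≤ r) {Q : ℝ≥0∞}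
    (hQt : Q ≠ ∞) (hQ : ∀ n, D.componentConst q r n ≤ Q) :
    ∃ C : ℝ≥0∞, C ≠ ∞ ∧ ∀ F : D.Point → ℝ≥0∞,
      dyadicNorm (1 / p) r D.measure (D.maximal F) ≤ C * dyadicNorm (1 / p) q D.measure F := by
  have hr := hq.trans hqr
  have hp0 : 0 < p := by linarith
  have hθ : 0 < 1 / p := by positivity
  have hθ1 : 1 / p < 1 := (div_lt_one hp0).2 hp
  set G := geomConst 1 with hG
  set A := averageConst (1 / p) with hA
  set T := triangleConst (1 / p) with hT
  set L := lacunaryConst 1 ^ (1 / p) with hL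
  set L' := lacunaryConst (1 / p) with hL'
  refine ⟨T * (1 + G * A + L * (G * A * L') + L * (G * A * L') +
    L * (4 * T * 2 ^ (1 / p) * Q * L')), ?_, fun F => ?_⟩
  · have h1 : G ≠ ∞ := geomConst_ne_top one_pos
    have h2 : A ≠ ∞ := averageConst_ne_top hθ hθ1
    have h3 : T ≠ ∞ := triangleConst_ne_top hθ hθ1
    have h4 : L ≠ ∞ := ENNReal.rpow_ne_top_of_nonneg hθ.le (lacunaryConst_ne_top one_pos)
    have h5 : L' ≠ ∞ := lacunaryConst_ne_top hθ
    have h6 : (2 : ℝ≥0∞) ^ (1 / p) ≠ ∞ := ENNReal.rpow_ne_top_of_nonneg hθ.le (by norm_num)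
    finiteness
  set N := dyadicNorm (1 / p) q D.measure F with hN
  set c := A * (D.measure univ ^ (-(1 / p)) * dyadicNorm (1 / p) ∞ D.measure F) with hc
  have hsum := dyadicNorm_finset_sum_le (μ := D.measure) hθ hr Finset.univ
    (f := ![F, fun _ => c, D.blockConst (1 / p) F D.lower, D.blockConst (1 / p) F D.component,
      D.neighborSum F]) fun _ => Measurable.of_discrete
  simp only [Fin.sum_univ_five, Matrix.cons_val] at hsum
  refine (dyadicNorm_mono hθ.le fun x => D.maximal_le hθ hθ1 F x).trans (hsum.trans ?_)
  rw [mul_assoc]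
  gcongr
  rw [add_mul, add_mul, add_mul, add_mul, one_mul]
  have hconst : dyadicNorm (1 / p) r D.measure (fun _ => c) ≤ G * A * N := by
    have h := dyadicNorm_restrict_le (μ := D.measure) hθ hr (g := fun _ => c) (S := univ)
      (E := univ) (c := c) MeasurableSet.univ (fun _ _ _ => le_rfl)
      (fun x _ hx => absurd (mem_univ x) hx)
    rw [Measure.restrict_univ] at h
    refine h.trans ?_
    obtain ⟨y, hy⟩ := D.component_nonempty 0
    have e : D.measure univ ^ (-(1 / p)) * D.measure univ ^ (1 / p) = 1 := by
      rw [← ENNReal.rpow_add _ _ (D.measure_ne_zero_of_mem (mem_univ y)) (measure_ne_top _ _)]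
      simp
    calc G * (c * D.measure univ ^ (1 / p)) = G * A * ((D.measure univ ^ (-(1 / p)) *
          D.measure univ ^ (1 / p)) * dyadicNorm (1 / p) ∞ D.measure F) := by
          rw [hc]
          ring
      _ ≤ _ := by
          rw [e, one_mul]
          gcongr
          exact dyadicNorm_anti hq le_top F
  refine add_le_add (add_le_add (add_le_add (add_le_add (dyadicNorm_anti hq hqr F) hconst) ?_) ?_) ?_
  · refine (D.dyadicNorm_blockConst_le hθ hq hqr F D.lower_nonempty).trans (le_of_eq ?_)
    ring
  · refine (D.dyadicNorm_blockConst_le hθ hq hqr F D.component_nonempty).trans (le_of_eq ?_)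
    ring
  · refine (D.dyadicNorm_neighborSum_le hp hq hqr hQ F).trans (le_of_eq ?_)
    ring

theorem bestConst_lt_top (hp : 1 < p) (hq : 1 ≤ q) (hqr : q ≤ r) {Q : ℝ≥0∞} (hQt : Q ≠ ∞)
    (hQ : ∀ n, D.componentConst q r n ≤ Q) : D.space.bestConst p q r < ∞ := by
  obtain ⟨C, hC, h⟩ := D.exists_dyadicNorm_maximal_le hp hq hqr hQt hQ
  have hp0 : 0 < p := by linarith
  set B := ENNReal.ofReal p ^ (1 / r.toReal) * 2 * (C * 4) with hB
  have hBt : B ≠ ∞ := by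
    have : ENNReal.ofReal p ^ (1 / r.toReal) ≠ ∞ :=
      ENNReal.rpow_ne_top_of_nonneg (by positivity) ENNReal.ofReal_ne_top
    finiteness
  refine lt_of_le_of_lt (iInf₂_le B.toNNReal fun f _ _ => ?_) ENNReal.coe_lt_top
  rw [ENNReal.coe_toNNReal hBt]
  set F : D.Point → ℝ≥0∞ := fun y => ‖f y‖ₑ with hF
  calc lorentzNorm D.measure p r (D.maximal F)
      ≤ ENNReal.ofReal p ^ (1 / r.toReal) * 2 * dyadicNorm (1 / p) r D.measure (D.maximal F) :=
        lorentzNorm_le_dyadicNorm hp0 (hq.trans hqr) _ _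
    _ ≤ ENNReal.ofReal p ^ (1 / r.toReal) * 2 * (C * (4 * lorentzNorm D.measure p q F)) := by
        gcongr
        refine (h F).trans ?_
        gcongr
        exact dyadicNorm_le_lorentzNorm hp.le hq _ _
    _ = B * lorentzNorm D.measure p q F := by
        rw [hB]
        ring

/-- The function testing the maximal operator on the `n`-th component. -/
noncomputable def testFun (n : ℕ) : D.Point → ℝ
  | ⟨k, .inl x⟩ => if k = n then 1 / (D.U k).m x.1 else 0
  | ⟨_, .inr _⟩ => 0

theorem testFun_nonneg (n : ℕ) (x : D.Point) : 0 ≤ D.testFun n x := by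
  obtain ⟨k, x | x⟩ := x
  · simp only [testFun]
    split_ifs
    · positivity
    · exact le_rfl
  · exact le_rfl

theorem exists_lowerPoint {n : ℕ} {i : Fin (D.U n).N} {x : D.Point}
    (hx : D.level x = ⟨n, .inl i⟩) : ∃ j, x = D.lowerPoint n i j := by
  obtain ⟨k, x | x⟩ := x
  · obtain rfl : k = n := congrArg Sigma.fst hx
    obtain rfl : x.1 = i := Sum.inl_injective (eq_of_heq (Sigma.mk.inj hx).2)
    exact ⟨x.2, rfl⟩
  · obtain rfl : k = n := congrArg Sigma.fst hx
    exact absurd (eq_of_heq (Sigma.mk.inj hx).2) Sum.inr_ne_inl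

theorem exists_upperPoint {n : ℕ} {k : Fin (D.U n).M} {x : D.Point}
    (hx : D.level x = ⟨n, .inr k⟩) : ∃ l, x = D.upperPoint n k l := by
  obtain ⟨m, x | x⟩ := x
  · obtain rfl : m = n := congrArg Sigma.fst hx
    exact absurd (eq_of_heq (Sigma.mk.inj hx).2) Sum.inl_ne_inr
  · obtain rfl : m = n := congrArg Sigma.fst hx
    obtain rfl : x.1 = k := Sum.inr_injective (eq_of_heq (Sigma.mk.inj hx).2)
    exact ⟨x.2, rfl⟩

theorem testFun_lowerPoint (n : ℕ) (i : Fin (D.U n).N) (j : Fin ((D.U n).h i)) :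
    D.testFun n (D.lowerPoint n i j) = 1 / (D.U n).m i := by
  simp [testFun, lowerPoint]

/-- The value `1 / m_i` offsets the measure of the `i`-th level to the power `1/p`, so the `N` lower
levels contribute comparably. -/
theorem dyadicNorm_testFun_le (hp : 1 < p) (hq : 1 ≤ q) (n : ℕ) :
    dyadicNorm (1 / p) q D.measure (fun x => ENNReal.ofReal (D.testFun n x)) ≤
      lacunaryConst 1 ^ (1 / p) * (((D.U n).N : ℝ≥0∞) ^ (q⁻¹).toReal *
        (geomConst 1 * (ENNReal.ofReal (2 ^ (1 / p)) * ENNReal.ofReal (D.b n ^ (1 / p))))) := by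
  have hp0 : 0 < p := by linarith
  have hθ : 0 < 1 / p := by positivity
  refine (D.level_lacunary.dyadicNorm_le hθ hq _).trans ?_
  gcongr
  rw [← lq_const_fin hq (D.U n).N_pos]
  have hinj : Function.Injective fun i : Fin (D.U n).N =>
      (⟨n, .inl i⟩ : Σ n, (D.U n).Level) := fun i i' h =>
    Sum.inl_injective (eq_of_heq (Sigma.mk.inj h).2)
  refine (lq_comp_of_support_subset hq hinj _ ?_).trans (lq_mono q fun i => ?_)
  · intro l hl
    have h := dyadicNorm_restrict_le (μ := D.measure) hθ hq
      (g := fun x => ENNReal.ofReal (D.testFun n x))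
      (S := {x | D.level x = l}) (E := ∅) (c := 0) MeasurableSet.of_discrete
      (by simp) (fun x hx _ => by
        obtain ⟨k, x | x⟩ := x
        · have hk : k ≠ n := by
            rintro rfl
            exact hl ⟨x.1, hx⟩
          simp [testFun, hk]
        · simp [testFun])
    simpa using h
  · refine (dyadicNorm_restrict_le (μ := D.measure) hθ hq
      (S := {x | D.level x = ⟨n, .inl i⟩}) (E := {x | D.level x = ⟨n, .inl i⟩})
      (c := ENNReal.ofReal (1 / (D.U n).m i)) MeasurableSet.of_discrete (fun x hx _ => ?_)
      (fun x hx hx' => absurd hx hx')).trans ?_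
    · obtain ⟨j, rfl⟩ := D.exists_lowerPoint hx
      rw [testFun_lowerPoint]
    · have hm : (0 : ℝ) < (D.U n).m i := by exact_mod_cast (D.U n).m_pos i i.2
      have hb := D.b_pos n
      rw [D.measure_level_rpow hp0, ← ENNReal.ofReal_mul (by positivity),
        ← ENNReal.ofReal_mul (by positivity)]
      refine mul_le_mul_right (ENNReal.ofReal_le_ofReal ?_) _
      have h := (D.U n).rpow_le_m hp0 i
      simp only [TypeIII.levelCard, TypeIII.levelMass]
      calc _ ≤ 1 / ((D.U n).m i : ℝ) * (D.b n ^ (1 / p) * (2 ^ (1 / p) * (D.U n).m i)) := by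
            gcongr
        _ = _ := by
            field_simp

/-- In the ball of radius `2/3` each of the `N` lower neighbors contributes exactly `b n` to the
integral, and the ball has at most twice the mass of its center. -/
theorem le_maximal_testFun (n : ℕ) (k : Fin (D.U n).M) (l : Fin ((D.U n).upperCard k)) :
    ENNReal.ofReal ((D.U n).N / (2 * ((D.U n).K * (D.U n).α k))) ≤
      D.maximal (fun x => ENNReal.ofReal (D.testFun n x)) (D.upperPoint n k l) := by
  have hpos := D.K_mul_α_pos n k
  have hb := D.b_pos n
  set x := D.upperPoint n k l with hx
  set F : D.Point → ℝ≥0∞ := fun x => ENNReal.ofReal (D.testFun n x) with hF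
  have hball := D.ball_upperPoint (s := 2 / 3) (by norm_num) le_rfl n k l
  rw [← hx] at hball
  refine le_trans ?_ (le_iSup₂ (f := fun (s : ℝ) (_ : 0 < s) =>
    (∫⁻ y in Metric.ball x s, F y ∂D.measure) / D.measure (Metric.ball x s)) (2 / 3) (by norm_num))
  have hx0 : D.measure (Metric.ball x (2 / 3)) ≠ 0 :=
    D.measure_ne_zero_of_mem (Metric.mem_ball_self (by norm_num))
  rw [ENNReal.le_div_iff_mul_le (Or.inl hx0) (Or.inl (measure_ne_top _ _))]
  have hmeas : D.measure (Metric.ball x (2 / 3)) ≤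
      ENNReal.ofReal (2 * (D.b n * ((D.U n).K * (D.U n).α k))) := by
    rw [hball]
    refine (measure_union_le _ _).trans ?_
    have h1 : D.measure (⋃ i, {D.neighbor n k l i}) ≤ D.weight x := by
      refine (measure_mono (iUnion_subset fun i => ?_)).trans (D.measure_lower_le n k l)
      rintro _ rfl
      exact ⟨rfl, rfl⟩
    rw [measure_singleton]
    refine (add_le_add le_rfl h1).trans (le_of_eq ?_)
    rw [← two_mul, hx, weight_upperPoint, ENNReal.ofReal_mul two_pos.le, ENNReal.ofReal_ofNat]
  have hint : ENNReal.ofReal ((D.U n).N * D.b n) ≤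
      ∫⁻ y in Metric.ball x (2 / 3), F y ∂D.measure := by
    refine le_trans (le_of_eq ?_) (lintegral_mono_set
      (show (⋃ i, {D.neighbor n k l i}) ⊆ Metric.ball x (2 / 3) by
        rw [hball]; exact subset_union_right))
    rw [lintegral_iUnion (fun _ => MeasurableSet.of_discrete) fun i i' h =>
      disjoint_singleton.2 fun h' => h (D.neighbor_injective n k l h')]
    simp only [setLIntegral_singleton]
    have e : ∀ i, F (D.neighbor n k l i) * D.weight (D.neighbor n k l i) =
        ENNReal.ofReal (D.b n) := fun i => by
      have hm : (0 : ℝ) < (D.U n).m i := by exact_mod_cast (D.U n).m_pos i i.2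
      change ENNReal.ofReal (D.testFun n (D.lowerPoint n i _)) * D.weight (D.lowerPoint n i _) = _
      rw [testFun_lowerPoint, weight_lowerPoint, ← ENNReal.ofReal_mul (by positivity)]
      congr 1
      field_simp
    simp only [e]
    rw [tsum_fintype, Finset.sum_const, Finset.card_univ, Fintype.card_fin, nsmul_eq_mul,
      ENNReal.ofReal_mul (by positivity), ENNReal.ofReal_natCast]
  refine (mul_le_mul_right hmeas _).trans (le_trans (le_of_eq ?_) hint)
  rw [← ENNReal.ofReal_mul (by positivity)]
  congr 1
  generalize (D.U n).K * (D.U n).α k = X at hpos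
  field_simp

theorem le_dyadicNorm_maximal_testFun (hp : 1 < p) (hr : 1 ≤ r) (n : ℕ) :
    ((D.U n).M : ℝ≥0∞) ^ (r⁻¹).toReal * ((D.U n).N * ENNReal.ofReal (D.b n ^ (1 / p)) *
      ENNReal.ofReal (D.U n).gain) ≤ 4 * lacunaryConst (1 / p) * dyadicNorm (1 / p) r D.measure
        (D.maximal fun x => ENNReal.ofReal (D.testFun n x)) := by
  have hp0 : 0 < p := by linarith
  have hθ : 0 < 1 / p := by positivity
  set G := D.maximal fun x => ENNReal.ofReal (D.testFun n x) with hG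
  have h1 := D.level_lacunary.lq_dyadicNorm_le hθ hr G
  have hinj : Function.Injective fun k : Fin (D.U n).M =>
      (⟨n, .inr k⟩ : Σ n, (D.U n).Level) := fun i i' h =>
    Sum.inr_injective (eq_of_heq (Sigma.mk.inj h).2)
  have h2 := (lq_comp_le r hinj _).trans h1
  rw [← lq_const_fin hr (D.U n).M_pos, mul_assoc (4 : ℝ≥0∞)]
  refine le_trans ?_ (mul_le_mul_right h2 4)
  rw [← lq_const_mul hr]
  refine lq_mono r fun k => ?_
  have hpos := D.K_mul_α_pos n k
  have hb := D.b_pos n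
  have h3 := const_mul_le_dyadicNorm (μ := D.measure.restrict {x | D.level x = ⟨n, .inr k⟩})
    hθ.le hr (g := G) (E := {x | D.level x = ⟨n, .inr k⟩})
    (c := ENNReal.ofReal ((D.U n).N / (2 * ((D.U n).K * (D.U n).α k)))) ENNReal.ofReal_ne_top
    (fun x hx => by
      obtain ⟨l, rfl⟩ := D.exists_upperPoint hx
      exact D.le_maximal_testFun n k l)
  rw [Measure.restrict_apply_self, D.measure_level_rpow hp0,
    ← ENNReal.ofReal_mul (by positivity)] at h3
  have e : (4 : ℝ≥0∞) = 2 * 2 := by norm_num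
  rw [e, mul_assoc (2 : ℝ≥0∞) 2]
  refine le_trans ?_ (mul_le_mul_right h3 2)
  rw [← ENNReal.ofReal_natCast, ← ENNReal.ofReal_mul (by positivity),
    ← ENNReal.ofReal_mul (by positivity), ← ENNReal.ofReal_ofNat,
    ← ENNReal.ofReal_mul (by positivity)]
  refine ENNReal.ofReal_le_ofReal ?_
  have h4 := (D.U n).α_le_rpow hp0 k
  have hα : (0 : ℝ) < (D.U n).α k := by exact_mod_cast (D.U n).α_pos k k.2
  have hK : (0 : ℝ) < (D.U n).K := by linarith [(D.U n).one_le_K]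
  calc _ = 2 * ((D.U n).N / (2 * ((D.U n).K * (D.U n).α k)) *
        (D.b n ^ (1 / p) * (((D.U n).K * (D.U n).L) ^ (1 / p) * (D.U n).α k))) := by
        rw [TypeIII.gain]
        field_simp
    _ ≤ _ := by
        gcongr
        exact h4

theorem componentConst_le_of_maximalBound (hp : 1 < p) (hq : 1 ≤ q) (hr : 1 ≤ r) {C : ℝ≥0}
    (hC : D.space.MaximalBound p q r C) :
    ∃ B : ℝ≥0∞, B ≠ ∞ ∧ ∀ n, D.componentConst q r n ≤ B := by
  have hp0 : 0 < p := by linarith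
  have hθ : 0 < 1 / p := by positivity
  have hu1 : (q⁻¹).toReal ≤ 1 := by
    have : q⁻¹ ≤ 1 := ENNReal.inv_le_one.2 hq
    simpa using ENNReal.toReal_mono ENNReal.one_ne_top this
  set P := ENNReal.ofReal p ^ (1 / q.toReal) with hP
  have hPt : P ≠ ∞ := ENNReal.rpow_ne_top_of_nonneg (by positivity) ENNReal.ofReal_ne_top
  set B := 4 * lacunaryConst (1 / p) * (4 * (C * (P * 2 * (lacunaryConst 1 ^ (1 / p) *
    (geomConst 1 * ENNReal.ofReal (2 ^ (1 / p))))))) with hB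
  refine ⟨B, ?_, fun n => ?_⟩
  · have h1 := geomConst_ne_top one_pos
    have h4 : lacunaryConst 1 ^ (1 / p) ≠ ∞ :=
      ENNReal.rpow_ne_top_of_nonneg hθ.le (lacunaryConst_ne_top one_pos)
    have h5 := lacunaryConst_ne_top hθ
    finiteness
  set b := ENNReal.ofReal (D.b n ^ (1 / p)) with hb
  have hb0 : b ≠ 0 := (ENNReal.ofReal_pos.2 (Real.rpow_pos_of_pos (D.b_pos n) _)).ne'
  have hbt : b ≠ ∞ := ENNReal.ofReal_ne_top
  set Nu := ((D.U n).N : ℝ≥0∞) ^ (q⁻¹).toReal with hNu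
  have hN0 : ((D.U n).N : ℝ≥0∞) ≠ 0 := Nat.cast_ne_zero.2 (D.U n).N_pos.ne'
  have hNt : ((D.U n).N : ℝ≥0∞) ≠ ∞ := ENNReal.natCast_ne_top _
  have hNu0 : Nu ≠ 0 := (ENNReal.rpow_pos (pos_iff_ne_zero.2 hN0) hNt).ne'
  have hNut : Nu ≠ ∞ := ENNReal.rpow_ne_top_of_nonneg ENNReal.toReal_nonneg hNt
  set f : D.Point → ℂ := fun x => (D.testFun n x : ℂ) with hf
  set F : D.Point → ℝ≥0∞ := fun x => ENNReal.ofReal (D.testFun n x) with hF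
  have hfF : (fun x => ‖f x‖ₑ) = F := by
    ext x
    rw [hf, ← ofReal_norm, Complex.norm_real,
      Real.norm_of_nonneg (D.testFun_nonneg n x)]
  have hup : lorentzNorm D.measure p q F ≤ P * 2 * (lacunaryConst 1 ^ (1 / p) *
      (Nu * (geomConst 1 * (ENNReal.ofReal (2 ^ (1 / p)) * b)))) := by
    refine (lorentzNorm_le_dyadicNorm hp0 hq _ _).trans ?_
    gcongr
    exact D.dyadicNorm_testFun_le hp hq n
  have hfin : lorentzNorm D.measure p q F < ∞ := by
    refine hup.trans_lt (lt_top_iff_ne_top.2 ?_)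
    have h1 := geomConst_ne_top one_pos
    have h4 : lacunaryConst 1 ^ (1 / p) ≠ ∞ :=
      ENNReal.rpow_ne_top_of_nonneg hθ.le (lacunaryConst_ne_top one_pos)
    finiteness
  have hbound : lorentzNorm D.measure p r (D.maximal F) ≤ C * lorentzNorm D.measure p q F := by
    have h := hC f (Measurable.of_discrete (α := D.Point))
    rw [maximal_space] at h
    change lorentzNorm D.measure p q (fun x : D.Point => ‖f x‖ₑ) < ∞ →
      lorentzNorm D.measure p r (D.maximal fun x => ‖f x‖ₑ) ≤
        C * lorentzNorm D.measure p q (fun x : D.Point => ‖f x‖ₑ) at h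
    rw [hfF] at h
    exact h hfin
  have hmain := D.le_dyadicNorm_maximal_testFun hp hr n
  have e1 : ((D.U n).N : ℝ≥0∞) ^ (1 - (q⁻¹).toReal) * Nu = (D.U n).N := by
    rw [hNu, ← ENNReal.rpow_add _ _ hN0 hNt, sub_add_cancel, ENNReal.rpow_one]
  have hNb0 : Nu * b ≠ 0 := mul_ne_zero hNu0 hb0
  have hNbt : Nu * b ≠ ∞ := ENNReal.mul_ne_top hNut hbt
  -- `N^(1/q) b_n^(1/p)` is the size of the test function; cancelling it removes the scaling and
  -- turns `N` into `N^(1-1/q)`.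
  rw [← ENNReal.mul_le_mul_iff_left hNb0 hNbt]
  calc D.componentConst q r n * (Nu * b) = ((D.U n).M : ℝ≥0∞) ^ (r⁻¹).toReal *
        ((((D.U n).N : ℝ≥0∞) ^ (1 - (q⁻¹).toReal) * Nu) * b * ENNReal.ofReal (D.U n).gain) := by
        rw [componentConst]
        ring
    _ ≤ 4 * lacunaryConst (1 / p) * (4 * (C * (P * 2 * (lacunaryConst 1 ^ (1 / p) *
      (Nu * (geomConst 1 * (ENNReal.ofReal (2 ^ (1 / p)) * b))))))) := by
        rw [e1]
        refine hmain.trans ?_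
        gcongr
        refine (dyadicNorm_le_lorentzNorm hp.le hr _ _).trans ?_
        gcongr
        refine hbound.trans ?_
        gcongr
    _ = B * (Nu * b) := by
        rw [hB]
        ring

theorem exists_bound_of_bestConst_lt_top (hp : 1 < p) (hq : 1 ≤ q) (hr : 1 ≤ r)
    (h : D.space.bestConst p q r < ∞) :
    ∃ B : ℝ≥0∞, B ≠ ∞ ∧ ∀ n, D.componentConst q r n ≤ B := by
  simp only [MetricMeasureSpace.bestConst, iInf_lt_iff] at h
  obtain ⟨C, hC, -⟩ := h
  exact D.componentConst_le_of_maximalBound hp hq hr hC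

end CompositeData

/-! ### Existence of test spaces with prescribed parameters. -/

/-- Rounding `m^(p-1)` up to a power of two gives the balance interval `[1, 2)`; powers of two with
monotone exponents divide one another. -/
theorem exists_two_pow_balance {p : ℝ} (hp : 1 < p) : ∃ h : ℕ → ℕ,
    (∀ m, 0 < m → 0 < h m ∧ 1 ≤ (m : ℝ) ^ (1 - p) * h m ∧ (m : ℝ) ^ (1 - p) * h m < 2) ∧
      ∀ m m', 0 < m → m ≤ m' → h m ∣ h m' := by
  refine ⟨fun m => 2 ^ ⌈(p - 1) * Real.logb 2 m⌉₊, fun m hm => ⟨by positivity, ?_⟩,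
    fun m m' hm hmm => pow_dvd_pow 2 (Nat.ceil_mono ?_)⟩
  · have hm1 : (1 : ℝ) ≤ m := by exact_mod_cast hm
    have hm0 : (0 : ℝ) < m := by linarith
    set x := (p - 1) * Real.logb 2 m with hx
    have hx0 : 0 ≤ x := mul_nonneg (by linarith) (Real.logb_nonneg (by norm_num) hm1)
    have e : (2 : ℝ) ^ x = (m : ℝ) ^ (p - 1) := by
      rw [hx, mul_comm, Real.rpow_mul (by norm_num), Real.rpow_logb two_pos (by norm_num) hm0]
    have h1 : (m : ℝ) ^ (1 - p) * (m : ℝ) ^ (p - 1) = 1 := by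
      rw [← Real.rpow_add hm0]
      simp
    have hpos : 0 < (m : ℝ) ^ (1 - p) := by positivity
    push_cast
    rw [← Real.rpow_natCast]
    constructor
    · calc 1 = (m : ℝ) ^ (1 - p) * 2 ^ x := by rw [e, h1]
        _ ≤ _ := mul_le_mul_of_nonneg_left
          (Real.rpow_le_rpow_of_exponent_le one_le_two (Nat.le_ceil x)) hpos.le
    · calc (m : ℝ) ^ (1 - p) * 2 ^ (⌈x⌉₊ : ℝ) < (m : ℝ) ^ (1 - p) * 2 ^ (x + 1) :=
            mul_lt_mul_of_pos_left
              (Real.rpow_lt_rpow_of_exponent_lt one_lt_two (Nat.ceil_lt_add_one hx0)) hpos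
        _ = 2 := by
            rw [Real.rpow_add two_pos, e, ← mul_assoc, h1, Real.rpow_one, one_mul]
  · have hm0 : (0 : ℝ) < m := by exact_mod_cast hm
    exact mul_le_mul_of_nonneg_left
      (Real.logb_le_logb_of_le one_lt_two hm0 (by exact_mod_cast hmm)) (by linarith)

namespace TypeIII

variable {p : ℝ}

theorem exists_of_sizes (hp : 1 < p) {N M L : ℕ} {K : ℝ} (hN : 0 < N) (hM : 0 < M) (hL : 0 < L)
    (hK : 1 ≤ K) : ∃ U : TypeIII p, U.N = N ∧ U.M = M ∧ U.L = L ∧ U.K = K := by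
  obtain ⟨h, hh, hdvd⟩ := exists_two_pow_balance hp
  set m : ℕ → ℕ := fun n => Nat.rec 1 (fun _ x => 2 * x * h x) n with hm
  have hmpos : ∀ i, 0 < m i := fun i => by
    induction i with
    | zero => exact one_pos
    | succ i ih => exact Nat.mul_pos (Nat.mul_pos two_pos ih) (hh _ ih).1
  have hmmono : Monotone m := monotone_nat_of_le_succ fun i => by
    have h1 := Nat.le_mul_of_pos_right (2 * m i) (hh _ (hmpos i)).1
    change m i ≤ 2 * m i * h (m i)
    omega
  set a : ℕ → ℕ := fun n => Nat.rec (2 * m (N - 1) * h (m (N - 1)))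
    (fun _ x => 2 * x * L * h x) n with ha
  have hapos : ∀ k, 0 < a k := fun k => by
    induction k with
    | zero => exact Nat.mul_pos (Nat.mul_pos two_pos (hmpos _)) (hh _ (hmpos _)).1
    | succ k ih => exact Nat.mul_pos (Nat.mul_pos (Nat.mul_pos two_pos ih) hL) (hh _ ih).1
  have hamono : Monotone a := monotone_nat_of_le_succ fun k => by
    have h1 := Nat.le_mul_of_pos_right (2 * a k) (Nat.mul_pos hL (hh _ (hapos k)).1)
    change a k ≤ 2 * a k * L * h (a k)
    rw [mul_assoc]
    omega
  have hma : ∀ k, m (N - 1) ≤ a k := fun k => by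
    have h1 := Nat.le_mul_of_pos_right (2 * m (N - 1)) (hh _ (hmpos (N - 1))).1
    have h2 : 2 * m (N - 1) * h (m (N - 1)) ≤ a k := hamono (Nat.zero_le k)
    omega
  -- With `β_k = h(α_k) / h_N` the product `β_k h_N` is `h(α_k)`, so the upper balance is that of
  -- the function `h`.
  have hβ : ∀ k, h (a k) / h (m (N - 1)) * h (m (N - 1)) = h (a k) := fun k =>
    Nat.div_mul_cancel (hdvd _ _ (hmpos _) (hma k))
  refine ⟨{ N := N, M := M, L := L, K := K, m := m, h := fun i => h (m i), α := a,
            β := fun k => h (a k) / h (m (N - 1)), N_pos := hN, M_pos := hM, L_pos := hL,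
            one_le_K := hK, m_pos := fun i _ => hmpos i, h_pos := fun i _ => (hh _ (hmpos i)).1,
            α_pos := fun k _ => hapos k, β_pos := fun k _ => ?_,
            h_dvd := fun i hi => hdvd _ _ (hmpos i) (hmmono (by omega)),
            m_growth := fun i _ => le_rfl, m_balance := fun i _ => (hh _ (hmpos i)).2,
            α_zero := le_rfl, α_growth := fun k _ => ?_, α_balance := fun k _ => ?_ },
    rfl, rfl, rfl, rfl⟩
  · refine Nat.pos_of_ne_zero fun h0 => ?_
    have h1 := hβ k
    have h2 := (hh _ (hapos k)).1
    rw [h0, zero_mul] at h1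
    omega
  · rw [mul_assoc (2 * a k * L), hβ]
  · have e : ((h (a k) / h (m (N - 1)) : ℕ) : ℝ) * (h (m (N - 1)) : ℕ) = h (a k) := by
      exact_mod_cast hβ k
    rw [mul_assoc, e]
    exact (hh _ (hapos k)).2

theorem one_le_mass (U : TypeIII p) (x : U.Point) : 1 ≤ U.mass x := by
  rcases x with x | x
  · have : (1 : ℝ) ≤ U.m x.1 := by exact_mod_cast U.m_pos _ x.1.2
    exact this
  · have : (1 : ℝ) ≤ U.α x.1 := by exact_mod_cast U.α_pos _ x.1.2
    exact one_le_mul_of_one_le_of_one_le U.one_le_K this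

theorem exists_of_exponents (hp : 1 < p) {A B : ℝ} (hA : 0 ≤ A) (hB : 0 ≤ B) (E : ℝ) :
    ∃ U : TypeIII p, (Real.exp A ≤ U.N ∧ (U.N : ℝ) ≤ 2 * Real.exp A) ∧
      (Real.exp B ≤ U.M ∧ (U.M : ℝ) ≤ 2 * Real.exp B) ∧ U.gain = Real.exp E := by
  have hp0 : 0 < p := by linarith
  have hθ : 0 < 1 / p := by positivity
  have hθ1 : 0 < 1 - 1 / p := sub_pos.2 ((div_lt_one hp0).2 hp)
  have hceil : ∀ A : ℝ, 0 ≤ A → 0 < ⌈Real.exp A⌉₊ ∧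
      Real.exp A ≤ ⌈Real.exp A⌉₊ ∧ (⌈Real.exp A⌉₊ : ℝ) ≤ 2 * Real.exp A := fun A hA => by
    have h1 := Real.one_le_exp hA
    have h2 := Nat.ceil_lt_add_one (Real.exp_pos A).le
    exact ⟨Nat.ceil_pos.2 (Real.exp_pos A), Nat.le_ceil _, by linarith⟩
  -- The integer `L` overshoots, `L^(1/p) ≥ exp E`, and the real parameter `K ≥ 1` corrects this
  -- exactly: `gain = L^(1/p) / K^(1-1/p)`.
  set L := ⌈Real.exp (p * E)⌉₊ with hL
  have hL0 : 0 < L := Nat.ceil_pos.2 (Real.exp_pos _)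
  have hL0' : (0 : ℝ) < L := by exact_mod_cast hL0
  have hLE : Real.exp E ≤ (L : ℝ) ^ (1 / p) := by
    calc Real.exp E = Real.exp (p * E) ^ (1 / p) := by
          rw [← Real.exp_mul]
          congr 1
          field_simp
      _ ≤ _ := by
          gcongr
          exact Nat.le_ceil _
  set J := (L : ℝ) ^ (1 / p) / Real.exp E with hJ
  have hJ1 : 1 ≤ J := (one_le_div (Real.exp_pos E)).2 hLE
  set K := J ^ (1 / (1 - 1 / p)) with hK
  have hK1 : 1 ≤ K := Real.one_le_rpow hJ1 (by positivity)
  have hK0 : 0 < K := by linarith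
  obtain ⟨U, hUN, hUM, hUL, hUK⟩ := exists_of_sizes hp (hceil A hA).1 (hceil B hB).1 hL0 hK1
  refine ⟨U, by rw [hUN]; exact (hceil A hA).2, by rw [hUM]; exact (hceil B hB).2, ?_⟩
  have hKJ : K ^ (1 - 1 / p) = J := by
    rw [hK, ← Real.rpow_mul (by linarith), one_div_mul_cancel hθ1.ne', Real.rpow_one]
  rw [gain, hUK, hUL, Real.mul_rpow hK0.le hL0'.le]
  have e : K = K ^ (1 / p) * J := by
    rw [← hKJ, ← Real.rpow_add hK0]
    simp
  have hKp : 0 < K ^ (1 / p) := by positivity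
  calc K ^ (1 / p) * (L : ℝ) ^ (1 / p) / K = K ^ (1 / p) * (L : ℝ) ^ (1 / p) / (K ^ (1 / p) * J) := by
        rw [← e]
    _ = (L : ℝ) ^ (1 / p) / J := mul_div_mul_left _ _ hKp.ne'
    _ = Real.exp E := by
        have : 0 < (L : ℝ) ^ (1 / p) := by positivity
        rw [hJ]
        field_simp

end TypeIII

/-- Any components can be combined: since point masses are at least `1`, it suffices to give
component `n + 1` half the mass `b n`. -/
theorem CompositeData.exists_of_components {p : ℝ} (U : ℕ → TypeIII p) :
    ∃ D : CompositeData p, D.U = U := by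
  set S : ℕ → ℝ := fun n => ∑ y : (U n).Point, (U n).mass y with hS
  have hSpos : ∀ n, 0 < S n := fun n => by
    have x : (U n).Point :=
      Sum.inl ⟨⟨0, (U n).N_pos⟩, ⟨0, (U n).h_pos 0 (U n).N_pos⟩⟩
    exact ((U n).mass_pos x).trans_le
      (Finset.single_le_sum (fun y _ => ((U n).mass_pos y).le) (Finset.mem_univ x))
  set b : ℕ → ℝ := fun n => Nat.rec 1 (fun k x => x / (2 * S (k + 1))) n with hb
  have hbpos : ∀ n, 0 < b n := fun n => by
    induction n with
    | zero => exact one_pos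
    | succ n ih => exact div_pos ih (mul_pos two_pos (hSpos _))
  refine ⟨⟨U, b, hbpos, fun n x => ?_⟩, rfl⟩
  have e : b (n + 1) = b n / (2 * S (n + 1)) := rfl
  rw [← Finset.mul_sum]
  change 2 * (b (n + 1) * S (n + 1)) ≤ _
  have h1 := hSpos (n + 1)
  have h2 := (U n).one_le_mass x
  calc 2 * (b (n + 1) * S (n + 1)) = b n := by
        rw [e]
        field_simp
    _ ≤ b n * (U n).mass x := le_mul_of_one_le_right (hbpos n).le h2

theorem rpow_between_exp {A s : ℝ} {N : ℕ} (hs0 : 0 ≤ s) (hs1 : s ≤ 1) (h1 : Real.exp A ≤ N)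
    (h2 : (N : ℝ) ≤ 2 * Real.exp A) :
    Real.exp (A * s) ≤ (N : ℝ) ^ s ∧ (N : ℝ) ^ s ≤ 2 * Real.exp (A * s) := by
  rw [Real.exp_mul]
  constructor
  · gcongr
  · calc (N : ℝ) ^ s ≤ (2 * Real.exp A) ^ s := by gcongr
      _ = 2 ^ s * Real.exp A ^ s := Real.mul_rpow (by norm_num) (Real.exp_pos A).le
      _ ≤ 2 * Real.exp A ^ s := by
          gcongr
          calc (2 : ℝ) ^ s ≤ 2 ^ (1 : ℝ) := by
                gcongr
                norm_num
            _ = 2 := Real.rpow_one 2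

theorem toReal_inv_mem_Icc {q : ℝ≥0∞} (hq : 1 ≤ q) : (q⁻¹).toReal ∈ Icc (0 : ℝ) 1 := by
  refine ⟨ENNReal.toReal_nonneg, ?_⟩
  simpa using ENNReal.toReal_mono ENNReal.one_ne_top (ENNReal.inv_le_one.2 hq)

/-! ### From composite spaces to families of affine constraints. -/

/-- Composite test spaces realizing a prescribed sequence of exponential constraints on
`(1 / q, 1 / r)`. -/
theorem exists_space_of_exponents {p : ℝ} (hp : 1 < p) (A B E : ℕ → ℝ) (hA : ∀ n, 0 ≤ A n)
    (hB : ∀ n, 0 ≤ B n) :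
    ∃ Z : MetricMeasureSpace, ¬ Z.IsDoubling ∧ Z.IsCompositeTestSpace p ∧
      ∀ q r : ℝ≥0∞, 1 ≤ q → 1 ≤ r →
        (q ≤ r → (∃ c, ∀ n, E n + A n * (1 - (q⁻¹).toReal) + B n * (r⁻¹).toReal ≤ c) →
          Z.bestConst p q r < ∞) ∧
        (Z.bestConst p q r < ∞ →
          ∃ c, ∀ n, E n + A n * (1 - (q⁻¹).toReal) + B n * (r⁻¹).toReal ≤ c) := by
  choose U hUN hUM hUg using fun n => TypeIII.exists_of_exponents hp (hA n) (hB n) (E n)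
  obtain ⟨D, rfl⟩ := CompositeData.exists_of_components U
  refine ⟨D.space, D.not_isDoubling_space, D.isCompositeTestSpace_space, fun q r hq hr => ?_⟩
  have hu := toReal_inv_mem_Icc hq
  have hv := toReal_inv_mem_Icc hr
  set u := (q⁻¹).toReal with hu'
  set v := (r⁻¹).toReal with hv'
  have hc : ∀ n, D.componentConst q r n = ENNReal.ofReal (Real.exp (E n) *
      ((D.U n).N : ℝ) ^ (1 - u) * ((D.U n).M : ℝ) ^ v) := fun n => by
    rw [CompositeData.componentConst, hUg, ENNReal.ofReal_mul (by positivity),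
      ENNReal.ofReal_mul (by positivity),
      ← ENNReal.ofReal_rpow_of_nonneg (by positivity) (by linarith [hu.2]),
      ← ENNReal.ofReal_rpow_of_nonneg (by positivity) hv.1, ENNReal.ofReal_natCast,
      ENNReal.ofReal_natCast]
  have hN : ∀ n, _ := fun n => rpow_between_exp (s := 1 - u) (by linarith [hu.2])
    (by linarith [hu.1]) (hUN n).1 (hUN n).2
  have hM : ∀ n, _ := fun n => rpow_between_exp hv.1 hv.2 (hUM n).1 (hUM n).2
  constructor
  · rintro hqr ⟨c, h⟩
    -- Rounding `exp A` and `exp B` to integers costs a factor of at most `2` each.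
    refine D.bestConst_lt_top hp hq hqr (Q := ENNReal.ofReal (4 * Real.exp c))
      ENNReal.ofReal_ne_top fun n => ?_
    rw [hc]
    refine ENNReal.ofReal_le_ofReal ?_
    calc _ ≤ Real.exp (E n) * (2 * Real.exp (A n * (1 - u))) * (2 * Real.exp (B n * v)) := by
          gcongr
          · exact (hN n).2
          · exact (hM n).2
      _ = 4 * Real.exp (E n + A n * (1 - u) + B n * v) := by
          rw [Real.exp_add, Real.exp_add]
          ring
      _ ≤ _ := by
          gcongr
          exact h n
  · intro h
    obtain ⟨Q, hQ, hle⟩ := D.exists_bound_of_bestConst_lt_top hp hq hr h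
    refine ⟨Real.log Q.toReal, fun n => ?_⟩
    have h1 : Real.exp (E n + A n * (1 - u) + B n * v) ≤ Q.toReal := by
      refine (ENNReal.ofReal_le_iff_le_toReal hQ).1 (le_trans ?_ (hle n))
      rw [hc]
      refine ENNReal.ofReal_le_ofReal ?_
      rw [Real.exp_add, Real.exp_add]
      gcongr
      · exact (hN n).1
      · exact (hM n).1
    rw [← Real.log_exp (E n + A n * (1 - u) + B n * v)]
    exact Real.log_le_log (Real.exp_pos _) h1

/-- The condition `v ≤ u` on the region supplies `q ≤ r` for sufficiency. An enumeration with
repetitions is harmless, as only boundedness of the family matters. -/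
theorem exists_space_of_region {p : ℝ} (hp : 1 < p) {ι : Type*} [Countable ι] [Nonempty ι]
    (A B E : ι → ℝ) (hA : ∀ i, 0 ≤ A i) (hB : ∀ i, 0 ≤ B i) (R : ℝ → ℝ → Prop)
    (hR : ∀ u v, u ∈ Icc (0 : ℝ) 1 → v ∈ Icc (0 : ℝ) 1 →
      ((∃ c, ∀ i, E i + A i * (1 - u) + B i * v ≤ c) ↔ R u v))
    (hle : ∀ u v, u ∈ Icc (0 : ℝ) 1 → v ∈ Icc (0 : ℝ) 1 → R u v → v ≤ u) :
    ∃ Z : MetricMeasureSpace, ¬ Z.IsDoubling ∧ Z.IsCompositeTestSpace p ∧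
      ∀ q r : ℝ≥0∞, 1 ≤ q → 1 ≤ r →
        (Z.bestConst p q r < ∞ ↔ R (q⁻¹).toReal (r⁻¹).toReal) := by
  obtain ⟨g, hg⟩ := exists_surjective_nat ι
  obtain ⟨Z, hZ, hZ', h⟩ := exists_space_of_exponents hp (A ∘ g) (B ∘ g) (E ∘ g)
    (fun n => hA _) (fun n => hB _)
  refine ⟨Z, hZ, hZ', fun q r hq hr => ?_⟩
  have hu := toReal_inv_mem_Icc hq
  have hv := toReal_inv_mem_Icc hr
  obtain ⟨h1, h2⟩ := h q r hq hr
  constructor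
  · intro hc
    obtain ⟨c, hc⟩ := h2 hc
    exact (hR _ _ hu hv).1 ⟨c, hg.forall.2 hc⟩
  · intro hRuv
    obtain ⟨c, hc⟩ := (hR _ _ hu hv).2 hRuv
    refine h1 ?_ ⟨c, fun n => hc (g n)⟩
    have hq' : q⁻¹ ≠ ∞ := ENNReal.inv_ne_top.2 (zero_lt_one.trans_le hq).ne'
    have hr' : r⁻¹ ≠ ∞ := ENNReal.inv_ne_top.2 (zero_lt_one.trans_le hr).ne'
    exact ENNReal.inv_le_inv.1 ((ENNReal.toReal_le_toReal hr' hq').1 (hle _ _ hu hv hRuv))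

/-! ### Rational majorants of concave functions; weak and strict inequalities. -/

/-- Instead of a supporting line, take the secant over a short interval `[u, w]` and raise it to the
height `F w` at `u`. It majorizes `F` by concavity off the interval and by monotonicity on it;
coefficients are then rounded up, which is safe as `D ⊆ [0, 1]`. -/
theorem exists_rat_line_majorant {δ u ε : ℝ} {D : Set ℝ} {F : ℝ → ℝ} (hδ : 0 ≤ δ)
    (hD : Ioc δ 1 ⊆ D) (hD' : D ⊆ Icc δ 1) (hF : ConcaveOn ℝ D F) (hm : MonotoneOn F D)
    (hu : u ∈ Ioc δ 1) (hε : 0 < ε) :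
    ∃ a b : ℚ, 0 ≤ a ∧ (∀ w ∈ D, F w ≤ a * w + b) ∧ a * u + b < F u + ε := by
  -- At `u = 1` there is no room to the right, but a constant slightly above `F 1` works by
  -- monotonicity.
  rcases hu.2.eq_or_lt with rfl | hu1
  · obtain ⟨b, hb, hb'⟩ := exists_rat_btwn (lt_add_of_pos_right (F 1) hε)
    refine ⟨0, b, le_rfl, fun w hw => ?_, by simpa using hb'⟩
    have := hm hw (hD hu) (hD' hw).2
    simp only [Rat.cast_zero, zero_mul, zero_add]
    linarith
  have hδu : δ < u := hu.1
  have huD : u ∈ D := hD hu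
  set w' := (δ + u) / 2 with hw'
  have hw'D : w' ∈ D := hD ⟨by linarith, by linarith⟩
  have hw'u : w' < u := by linarith
  set σ := (F u - F w') / (u - w') with hσ
  have hσ0 : 0 ≤ σ := div_nonneg (sub_nonneg.2 (hm hw'D huD hw'u.le)) (by linarith)
  -- The slope to the right of `u` is at most the slope `σ` to its left, so this step raises `F` by
  -- at most `ε / 4`.
  set τ := min (1 - u) (ε / (4 * (σ + 1))) with hτ
  have hτ0 : 0 < τ := lt_min (by linarith) (by positivity)
  have hτ1 : τ ≤ 1 - u := min_le_left _ _
  have hτε : σ * τ ≤ ε / 4 := by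
    calc σ * τ ≤ (σ + 1) * (ε / (4 * (σ + 1))) := by
          gcongr
          · linarith
          · exact min_le_right _ _
      _ = ε / 4 := by field_simp
  set w := u + τ with hw
  have huw : u < w := by linarith
  have hwD : w ∈ D := hD ⟨by linarith, by linarith⟩
  set a₀ := (F w - F u) / (w - u) with ha₀
  have ha₀0 : 0 ≤ a₀ := div_nonneg (sub_nonneg.2 (hm huD hwD huw.le)) (by linarith)
  have ha₀σ : a₀ ≤ σ := hF.slope_anti_adjacent hw'D hwD hw'u huw
  have ha₀τ : a₀ * τ = F w - F u := by
    rw [ha₀, hw, add_sub_cancel_left, div_mul_cancel₀ _ hτ0.ne']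
  have hFw : F w ≤ F u + ε / 4 := by nlinarith
  have hFuw : F u ≤ F w := hm huD hwD huw.le
  have hmaj : ∀ x ∈ D, F x ≤ F w + a₀ * (x - u) := by
    intro x hx
    rcases lt_or_ge x u with hxu | hxu
    · have h1 : a₀ ≤ (F u - F x) / (u - x) := hF.slope_anti_adjacent hx hwD hxu huw
      rw [le_div_iff₀ (by linarith)] at h1
      linarith
    rcases le_or_gt x w with hxw | hxw
    · have h1 := hm hx hwD hxw
      have h2 := mul_nonneg ha₀0 (sub_nonneg.2 hxu)
      linarith
    · have h1 : (F x - F w) / (x - w) ≤ a₀ := hF.slope_anti_adjacent huD hx huw hxw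
      rw [div_le_iff₀ (by linarith)] at h1
      have h2 := mul_nonneg ha₀0 (sub_nonneg.2 huw.le)
      linarith
  obtain ⟨a, ha, ha'⟩ := exists_rat_btwn (show a₀ < a₀ + ε / 4 by linarith)
  obtain ⟨b, hb, hb'⟩ := exists_rat_btwn (show F w - a₀ * u < F w - a₀ * u + ε / 4 by linarith)
  refine ⟨a, b, by exact_mod_cast ha₀0.trans ha.le, fun x hx => ?_, ?_⟩
  · have h1 := hmaj x hx
    have h2 : a₀ * x ≤ a * x := mul_le_mul_of_nonneg_right ha.le (hδ.trans (hD' hx).1)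
    linarith
  · have h1 : (a - a₀) * u ≤ ε / 4 * 1 :=
      mul_le_mul (by linarith) hu1.le (by linarith) (by linarith)
    linarith

/-- Complete the square in `√n`: a negative linear term absorbs the square root. -/
theorem mul_add_mul_sqrt_le {n s x ε : ℝ} (hn : 0 ≤ n) (hε : 0 < ε) (hx : x ≤ -ε) :
    n * x + s * √n ≤ s ^ 2 / (4 * ε) := by
  rw [le_div_iff₀ (by linarith)]
  have h1 : n * x ≤ n * (-ε) := mul_le_mul_of_nonneg_left hx hn
  have h2 : √n ^ 2 = n := Real.sq_sqrt hn
  calc _ ≤ (n * -ε + s * √n) * (4 * ε) := by gcongr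
    _ = s ^ 2 - (s - 2 * ε * √n) ^ 2 + 4 * ε ^ 2 * (√n ^ 2 - n) := by ring
    _ ≤ _ := by
      rw [h2]
      linarith [sq_nonneg (s - 2 * ε * √n)]

/-- Strict inequality if `s ≠ 0`, weak inequality if `s = 0`. -/
def BelowOrEq (s v y : ℝ) : Prop := v < y ∨ (v = y ∧ s = 0)

theorem belowOrEq_zero {v y : ℝ} : BelowOrEq 0 v y ↔ v ≤ y := by
  simp [BelowOrEq, le_iff_lt_or_eq]

theorem belowOrEq_one {v y : ℝ} : BelowOrEq 1 v y ↔ v < y := by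
  simp [BelowOrEq]

theorem BelowOrEq.le {s v y : ℝ} (h : BelowOrEq s v y) : v ≤ y := by
  rcases h with h | h
  · exact h.le
  · exact h.1.le

theorem BelowOrEq.exists_bound {s v y : ℝ} (h : BelowOrEq s v y) :
    ∃ c, ∀ (n : ℕ) (z : ℝ), y ≤ z → n * (v - z) + s * √n ≤ c := by
  rcases h with h | ⟨rfl, rfl⟩
  · exact ⟨s ^ 2 / (4 * (y - v)), fun n z hz =>
      mul_add_mul_sqrt_le n.cast_nonneg (by linarith) (by linarith)⟩
  · refine ⟨0, fun n z hz => ?_⟩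
    have := mul_nonneg (n.cast_nonneg (α := ℝ)) (sub_nonneg.2 hz)
    linarith

theorem belowOrEq_of_bound {s v y : ℝ} (hs : 0 ≤ s) {c : ℝ}
    (h : ∀ n : ℕ, n * (v - y) + s * √n ≤ c) : BelowOrEq s v y := by
  rcases lt_trichotomy v y with hvy | rfl | hvy
  · exact Or.inl hvy
  · refine Or.inr ⟨rfl, ?_⟩
    by_contra hs'
    have hs0 : 0 < s := lt_of_le_of_ne hs (Ne.symm hs')
    -- At equality only `s √n` is left; along squares it is `s n`, which is unbounded.
    obtain ⟨n, hn⟩ := exists_nat_gt (|c| / s)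
    have h1 := h (n ^ 2)
    rw [sub_self, mul_zero, zero_add, Nat.cast_pow, Real.sqrt_sq n.cast_nonneg] at h1
    rw [div_lt_iff₀ hs0] at hn
    linarith [le_abs_self c]
  · obtain ⟨n, hn⟩ := exists_nat_gt (c / (v - y))
    rw [div_lt_iff₀ (by linarith)] at hn
    linarith [h n, mul_nonneg hs (Real.sqrt_nonneg n)]

/-- For each `n` use a majorant within `1 / (n + 1)` of `F` at `u`; multiplied by `n` the error
stays below `1`. The bound `c` must be uniform over the lines. -/
theorem belowOrEq_of_line_bound {δ u v s c : ℝ} {D : Set ℝ} {F : ℝ → ℝ} (hδ : 0 ≤ δ)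
    (hD : Ioc δ 1 ⊆ D) (hD' : D ⊆ Icc δ 1) (hF : ConcaveOn ℝ D F) (hm : MonotoneOn F D)
    (hu : u ∈ Ioc δ 1) (hs : 0 ≤ s)
    (h : ∀ a b : ℚ, 0 ≤ a → (∀ w ∈ D, F w ≤ a * w + b) →
      ∀ n : ℕ, n * (v - (a * u + b)) + s * √n ≤ c) :
    BelowOrEq s v (F u) := by
  refine belowOrEq_of_bound (c := c + 1) hs fun n => ?_
  obtain ⟨a, b, ha, hab, hlt⟩ :=
    exists_rat_line_majorant hδ hD hD' hF hm hu (ε := 1 / ((n : ℝ) + 1)) (by positivity)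
  have h1 := h a b ha hab n
  have h2 : (n : ℝ) * (a * u + b - F u) ≤ n * (1 / ((n : ℝ) + 1)) :=
    mul_le_mul_of_nonneg_left (by linarith) n.cast_nonneg
  have h3 : (n : ℝ) * (1 / ((n : ℝ) + 1)) ≤ 1 := by
    rw [mul_one_div, div_le_one (by positivity)]
    linarith
  linarith

/-! ### Realization of the regions. -/

/-- Lines with rational coefficients and nonnegative slope that majorize `F` on `D`. -/
abbrev RatMajorant (D : Set ℝ) (F : ℝ → ℝ) : Type :=
  {ab : ℚ × ℚ // 0 ≤ ab.1 ∧ ∀ w ∈ D, F w ≤ ab.1 * w + ab.2}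

/-- The majorants settle every `u` in `(δ, 1]`. The extra sequence only has to confine `u` to `D`
and decide the endpoint, where a monotone concave `F` may jump up immediately to the right, unseen
by lines. -/
theorem exists_space_of_constraints {p : ℝ} (hp : 1 < p) {δ s : ℝ} {D : Set ℝ} {F : ℝ → ℝ}
    (hδ : 0 ≤ δ) (hD : Ioc δ 1 ⊆ D) (hD' : D ⊆ Icc δ 1) (hF : ConcaveOn ℝ D F)
    (hm : MonotoneOn F D) (hFle : ∀ u ∈ D, F u ≤ u) (hs : 0 ≤ s)
    (A B E : ℕ → ℝ) (hA : ∀ n, 0 ≤ A n) (hB : ∀ n, 0 ≤ B n)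
    (hfwd : ∀ u v, u ∈ Icc (0 : ℝ) 1 → v ∈ Icc (0 : ℝ) 1 → u ∈ D → BelowOrEq s v (F u) →
      ∃ c, ∀ n, E n + A n * (1 - u) + B n * v ≤ c)
    (hbwd : ∀ u v, u ∈ Icc (0 : ℝ) 1 → v ∈ Icc (0 : ℝ) 1 →
      (∃ c, ∀ n, E n + A n * (1 - u) + B n * v ≤ c) →
      u ∈ Ioc δ 1 ∨ (u ∈ D ∧ BelowOrEq s v (F u))) :
    ∃ Z : MetricMeasureSpace, ¬ Z.IsDoubling ∧ Z.IsCompositeTestSpace p ∧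
      ∀ q r : ℝ≥0∞, 1 ≤ q → 1 ≤ r →
        (Z.bestConst p q r < ∞ ↔
          (q⁻¹).toReal ∈ D ∧ BelowOrEq s (r⁻¹).toReal (F (q⁻¹).toReal)) := by
  refine exists_space_of_region hp (ι := (RatMajorant D F × ℕ) ⊕ ℕ)
    -- The exponents are chosen so that the functional is `n (v - (a u + b)) + s √n`; nonnegative
    -- slopes `a` are needed for a nonnegative exponent of `N`.
    (Sum.elim (fun i => (i.2 : ℝ) * i.1.1.1) A) (Sum.elim (fun i => (i.2 : ℝ)) B)
    (Sum.elim (fun i => -((i.2 : ℝ) * i.1.1.2) - i.2 * i.1.1.1 + s * √(i.2 : ℝ)) E) ?_ ?_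
    (fun u v => u ∈ D ∧ BelowOrEq s v (F u)) ?_ ?_
  · rintro (i | n)
    · have : (0 : ℝ) ≤ i.1.1.1 := by exact_mod_cast i.1.2.1
      simp only [Sum.elim_inl]
      positivity
    · exact hA n
  · rintro (i | n)
    · exact Nat.cast_nonneg _
    · exact hB n
  · intro u v hu hv
    have key : ∀ (a b : ℚ) (n : ℕ),
        -((n : ℝ) * b) - n * a + s * √(n : ℝ) + n * a * (1 - u) + n * v =
          n * (v - (a * u + b)) + s * √n := by
      intro a b n
      ring
    constructor
    · rintro ⟨c, hc⟩
      rcases hbwd u v hu hv ⟨c, fun n => hc (Sum.inr n)⟩ with hu' | h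
      · refine ⟨hD hu', belowOrEq_of_line_bound hδ hD hD' hF hm hu' hs (c := c) ?_⟩
        intro a b ha hab n
        have := hc (Sum.inl (⟨(a, b), ha, hab⟩, n))
        simp only [Sum.elim_inl, key] at this
        exact this
      · exact h
    · rintro ⟨huD, hb⟩
      obtain ⟨c₁, h₁⟩ := hb.exists_bound
      obtain ⟨c₂, h₂⟩ := hfwd u v hu hv huD hb
      refine ⟨max c₁ c₂, ?_⟩
      rintro (⟨⟨⟨a, b⟩, ha, hab⟩, n⟩ | n)
      · simp only [Sum.elim_inl, key]
        exact (h₁ n _ (hab u huD)).trans (le_max_left _ _)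
      · exact (h₂ n).trans (le_max_right _ _)
  · rintro u v - - ⟨huD, hb⟩
    exact hb.le.trans (hFle u huD)

/-- The extra functional is `n² (δ - u) + n (v - F δ) + s √n`: the quadratic term decides unless `u
= δ`, where the rest compares `v` with `F δ`. -/
theorem exists_space_of_concaveOn_Icc {p : ℝ} (hp : 1 < p) {δ s : ℝ} {F : ℝ → ℝ}
    (hδ : 0 ≤ δ) (hδ1 : δ ≤ 1) (hF : ConcaveOn ℝ (Icc δ 1) F) (hm : MonotoneOn F (Icc δ 1))
    (hF0 : MapsTo F (Icc δ 1) (Icc 0 1)) (hFle : ∀ u ∈ Icc δ 1, F u ≤ u) (hs : 0 ≤ s) :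
    ∃ Z : MetricMeasureSpace, ¬ Z.IsDoubling ∧ Z.IsCompositeTestSpace p ∧
      ∀ q r : ℝ≥0∞, 1 ≤ q → 1 ≤ r →
        (Z.bestConst p q r < ∞ ↔
          δ ≤ (q⁻¹).toReal ∧ BelowOrEq s (r⁻¹).toReal (F (q⁻¹).toReal)) := by
  have key : ∀ (u v : ℝ) (n : ℕ),
      (n : ℝ) ^ 2 * (δ - 1) - n * F δ + s * √n + (n : ℝ) ^ 2 * (1 - u) + n * v =
        n * (v - F δ) + (n : ℝ) ^ 2 * (δ - u) + s * √n := by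
    intro u v n
    ring
  have h01 : F δ ∈ Icc (0 : ℝ) 1 := hF0 ⟨le_rfl, hδ1⟩
  refine Exists.imp (fun Z h => ⟨h.1, h.2.1, fun q r hq hr => (h.2.2 q r hq hr).trans ?_⟩)
    (exists_space_of_constraints hp hδ Ioc_subset_Icc_self subset_rfl hF hm
    hFle hs (fun n => (n : ℝ) ^ 2) (fun n => (n : ℝ))
    (fun n => (n : ℝ) ^ 2 * (δ - 1) - n * F δ + s * √(n : ℝ)) (fun n => by positivity)
    (fun n => by positivity) ?_ ?_)
  · rw [mem_Icc, and_iff_left (toReal_inv_mem_Icc hq).2]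
  · intro u v hu hv huD hb
    simp only [key]
    rcases huD.1.eq_or_lt with rfl | hlt
    · obtain ⟨c, hc⟩ := hb.exists_bound
      exact ⟨c, fun n => by simpa using hc n _ le_rfl⟩
    · refine ⟨(1 + s) ^ 2 / (4 * (u - δ)), fun n => ?_⟩
      rw [le_div_iff₀ (by linarith)]
      have h1 : √(n : ℝ) ≤ n := by
        refine Real.sqrt_le_iff.2 ⟨n.cast_nonneg, ?_⟩
        exact_mod_cast Nat.le_self_pow two_ne_zero n
      have h2 : s * √(n : ℝ) ≤ s * n := mul_le_mul_of_nonneg_left h1 hs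
      have h3 : (n : ℝ) * (v - F δ) ≤ n * 1 :=
        mul_le_mul_of_nonneg_left (by linarith [hv.2, h01.1]) n.cast_nonneg
      have h4 : (n : ℝ) * (v - F δ) + (n : ℝ) ^ 2 * (δ - u) + s * √n ≤
          (1 + s) * n - (n : ℝ) ^ 2 * (u - δ) := by linarith
      calc _ ≤ ((1 + s) * n - (n : ℝ) ^ 2 * (u - δ)) * (4 * (u - δ)) :=
            mul_le_mul_of_nonneg_right h4 (by linarith)
        _ ≤ _ := by linarith [sq_nonneg ((1 + s) - 2 * (u - δ) * n)]
  · rintro u v hu hv ⟨c, hc⟩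
    simp only [key] at hc
    rcases lt_trichotomy u δ with hlt | rfl | hlt
    · exfalso
      have hη : 0 < δ - u := by linarith
      obtain ⟨n, hn⟩ := exists_nat_gt ((|c| + 1) / (δ - u))
      rw [div_lt_iff₀ hη] at hn
      have hn1 : (1 : ℝ) ≤ n := by
        rcases n.eq_zero_or_pos with rfl | hn0
        · rw [Nat.cast_zero, zero_mul] at hn
          linarith [abs_nonneg c]
        · exact_mod_cast hn0
      have h1 := hc n
      have h2 : (n : ℝ) * |c| < n * (n * (δ - u) - 1) :=
        mul_lt_mul_of_pos_left (by linarith) (by linarith)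
      have h3 : 1 * |c| ≤ n * |c| := mul_le_mul_of_nonneg_right hn1 (abs_nonneg c)
      have h4 : (n : ℝ) * (-1) ≤ n * (v - F δ) :=
        mul_le_mul_of_nonneg_left (by linarith [hv.1, h01.2]) (by linarith)
      have h5 := mul_nonneg hs (Real.sqrt_nonneg n)
      linarith [le_abs_self c]
    · refine Or.inr ⟨⟨le_rfl, hδ1⟩, belowOrEq_of_bound (c := c) hs fun n => ?_⟩
      simpa using hc n
    · exact Or.inl ⟨hlt, hu.2⟩

/-- The functional `n (δ - u) + √n` does not involve `v`, and is bounded above exactly when `δ < u`.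
-/
theorem exists_space_of_concaveOn_Ioc {p : ℝ} (hp : 1 < p) {δ s : ℝ} {F : ℝ → ℝ}
    (hδ : 0 ≤ δ) (hF : ConcaveOn ℝ (Ioc δ 1) F) (hm : MonotoneOn F (Ioc δ 1))
    (hFle : ∀ u ∈ Ioc δ 1, F u ≤ u) (hs : 0 ≤ s) :
    ∃ Z : MetricMeasureSpace, ¬ Z.IsDoubling ∧ Z.IsCompositeTestSpace p ∧
      ∀ q r : ℝ≥0∞, 1 ≤ q → 1 ≤ r →
        (Z.bestConst p q r < ∞ ↔
          δ < (q⁻¹).toReal ∧ BelowOrEq s (r⁻¹).toReal (F (q⁻¹).toReal)) := by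
  have key : ∀ (u v : ℝ) (n : ℕ),
      (n : ℝ) * (δ - 1) + √n + (n : ℝ) * (1 - u) + 0 * v = n * (δ - u) + 1 * √n := by
    intro u v n
    ring
  refine Exists.imp (fun Z h => ⟨h.1, h.2.1, fun q r hq hr => (h.2.2 q r hq hr).trans ?_⟩)
    (exists_space_of_constraints hp hδ subset_rfl Ioc_subset_Icc_self hF hm
    hFle hs (fun n => (n : ℝ)) (fun _ => 0) (fun n => (n : ℝ) * (δ - 1) + √(n : ℝ))
    (fun n => by positivity) (fun _ => le_rfl) ?_ ?_)
  · rw [mem_Ioc, and_iff_left (toReal_inv_mem_Icc hq).2]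
  · intro u v hu hv huD hb
    simp only [key]
    obtain ⟨c, hc⟩ := (belowOrEq_one.2 huD.1).exists_bound
    exact ⟨c, fun n => hc n _ le_rfl⟩
  · rintro u v hu hv ⟨c, hc⟩
    simp only [key] at hc
    exact Or.inl ⟨belowOrEq_one.1 (belowOrEq_of_bound zero_le_one hc), hu.2⟩

theorem mainTheorem2 (p : ℝ) (hp : 1 < p) :
    (∀ (δ : ℝ) (F : ℝ → ℝ), 0 ≤ δ → δ ≤ 1 →
      Set.MapsTo F (Set.Icc δ 1) (Set.Icc 0 1) → ConcaveOn ℝ (Set.Icc δ 1) F →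
      MonotoneOn F (Set.Icc δ 1) → (∀ u ∈ Set.Icc δ 1, F u ≤ u) →
      (∃ Z : MetricMeasureSpace, ¬ Z.IsDoubling ∧ Z.IsCompositeTestSpace p ∧
        ∀ q r : ENNReal, 1 ≤ q → 1 ≤ r →
          (Z.bestConst p q r < ⊤ ↔
            δ ≤ (q⁻¹).toReal ∧ (r⁻¹).toReal ≤ F (q⁻¹).toReal)) ∧
      (∃ Z' : MetricMeasureSpace, ¬ Z'.IsDoubling ∧ Z'.IsCompositeTestSpace p ∧
        ∀ q r : ENNReal, 1 ≤ q → 1 ≤ r →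
          (Z'.bestConst p q r < ⊤ ↔
            δ ≤ (q⁻¹).toReal ∧ (r⁻¹).toReal < F (q⁻¹).toReal))) ∧
    (∀ (δ : ℝ) (F : ℝ → ℝ), 0 ≤ δ → δ < 1 →
      Set.MapsTo F (Set.Ioc δ 1) (Set.Icc 0 1) → ConcaveOn ℝ (Set.Ioc δ 1) F →
      MonotoneOn F (Set.Ioc δ 1) → (∀ u ∈ Set.Ioc δ 1, F u ≤ u) →
      (∃ Z : MetricMeasureSpace, ¬ Z.IsDoubling ∧ Z.IsCompositeTestSpace p ∧
        ∀ q r : ENNReal, 1 ≤ q → 1 ≤ r →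
          (Z.bestConst p q r < ⊤ ↔
            δ < (q⁻¹).toReal ∧ (r⁻¹).toReal ≤ F (q⁻¹).toReal)) ∧
      (∃ Z' : MetricMeasureSpace, ¬ Z'.IsDoubling ∧ Z'.IsCompositeTestSpace p ∧
        ∀ q r : ENNReal, 1 ≤ q → 1 ≤ r →
          (Z'.bestConst p q r < ⊤ ↔
            δ < (q⁻¹).toReal ∧ (r⁻¹).toReal < F (q⁻¹).toReal))) := by
  refine ⟨fun δ F hδ hδ1 hF0 hF hm hFle => ⟨?_, ?_⟩, fun δ F hδ _ _ hF hm hFle => ⟨?_, ?_⟩⟩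
  · simpa only [belowOrEq_zero] using
      exists_space_of_concaveOn_Icc hp hδ hδ1 hF hm hF0 hFle le_rfl
  · simpa only [belowOrEq_one] using
      exists_space_of_concaveOn_Icc hp hδ hδ1 hF hm hF0 hFle zero_le_one
  · simpa only [belowOrEq_zero] using exists_space_of_concaveOn_Ioc hp hδ hF hm hFle le_rfl
  · simpa only [belowOrEq_one] using exists_space_of_concaveOn_Ioc hp hδ hF hm hFle zero_le_one
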